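/- **Setting.** A (randomized) streaming algorithm is an automaton with finitely many memory states, with a fresh, independent random coin available for the initialization and for each update; its space in bits is $\log_2$ of the number of states. For a stream $u_1,\dots,u_m\in[n]$ let $F(s:t)$ be the value of $F$ on the frequency vector of the updates $u_s,\dots,u_t$. For every $n\ge 2$ let $F=F_n:\mathbb{N}^n\to[0,\infty)$ be monotone (coordinatewise), and consider insertion-only streams of length $m=m(n)$ over $[n]$ with $\log m=O(\log n)$. All constants hidden in $O(\cdot)$ are uniform in $n\ge2$, $\varepsilon\in(0,\frac12]$, $\delta\in(0,1)$, $\gamma\in(0,1]$. * The $(\varepsilon,m)$-twist number of $F$ on a stream is the largest $k$ for which there are times $0\le i_1<\dots<i_k\le m$ such that for all $2\le j\le k$ either $F(1:i_{j-1})\notin[(1-\varepsilon)F(1:i_j),(1+\varepsilon)F(1:i_j)]$ or $F(i_{j-1}:i_j)\ge\varepsilon F(1:i_{j-1})$. * An $(\varepsilon,\delta)$-strong tracker for $F$ is a streaming algorithm that, on every fixed stream of length at most $m$, with probability at least $1-\delta$ outputs at all times $t\geq 1$ simultaneously an $X_t$ with $|X_t-F(1:t)|\le\varepsilon F(1:t)$.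 * A $(\gamma,\varepsilon,\delta)$-difference estimator for $F$ is a streaming algorithm that reads a stream of length at most $m$, fixed in advance, together with a splitting time revealed only when it occurs (at least one update precedes it). Let $v$ be the frequency vector of the updates up to the splitting time and $w_t$ that of the updates after it up to time $t$. With probability at least $1-\delta$, simultaneously for all $t$ from the splitting time on with $F(v+w_t)-F(v)\le\gamma F(v)$ and $F(w_t)\le\gamma F(v)$, its output is within $\varepsilon F(v)$ of $F(v+w_t)-F(v)$. * A space function is a function $S(n,\delta,\varepsilon)\ge0$ that is nondecreasing in $1/\varepsilon$ and satisfies $S(n,\delta,\varepsilon^2)=O(S(n,\delta,\varepsilon))$. * An algorithm is an adversarially robust $(1+\varepsilon)$-approximation of $F$ if, for every adversary that chooses each update as an arbitrary function of all previous outputs of the algorithm, with probability at least $\frac23$ its output $X_t$ satisfies $|X_t-F(1:t)|\le\varepsilon F(1:t)$ at all times $1\le t\le m$. **Theorem (Framework for adversarially robust algorithms on insertion-only streams).** Suppose that for every $\varepsilon\in(0,\frac12]$ the $(\varepsilon,m)$-twist number of $F$ on every stream of length $m$ over $[n]$ is $O\left(\frac{\log n}{\varepsilon}\right)$. Let $C\ge1$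 be a constant and let $S_1,S_2$ be space functions. Suppose that for all $\gamma\in(0,1]$, $\varepsilon\in(0,\frac12]$, $\delta\in(0,1)$ there are a $(\gamma,\varepsilon,\delta)$-difference estimator for $F$ that uses $O\left(\frac{\gamma^C}{\varepsilon^2}S_1(n,\delta,\varepsilon)+S_2(n,\delta,\varepsilon)\right)$ bits of space and an $(\varepsilon,\delta)$-strong tracker for $F$ that uses $O\left(\frac{1}{\varepsilon^2}S_1(n,\delta,\varepsilon)+S_2(n,\delta,\varepsilon)\right)$ bits of space. Then there are constants $c\in(0,1]$ and an integer $q\ge1$ such that, with $\delta'=c\left(\frac{\varepsilon}{\log n}\right)^{q}$, for all $n\ge2$ and $\varepsilon\in(0,\frac12]$ there is a streaming algorithm that is an adversarially robust $(1+\varepsilon)$-approximation of $F$ and that uses $$O\left(\frac{1}{\varepsilon^2}\log n\cdot S_1(n,\delta',\varepsilon)+\frac1\varepsilon\log n\log\frac1\varepsilon\cdot S_2(n,\delta',\varepsilon)+\frac{1}{\varepsilon^2}\log^2 n\right)$$ bits of space if $C>1$, and $$O\left(\frac{1}{\varepsilon^2}\log n\log^3\frac1\varepsilon\cdot S_1(n,\delta',\varepsilon)+\frac1\varepsilon\log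 n\log\frac1\varepsilon\cdot S_2(n,\delta',\varepsilon)+\frac{1}{\varepsilon^2}\log^2 n\right)$$ bits of space if $C=1$. -/

import Mathlib

open MeasureTheory

noncomputable section

/-- A randomized streaming algorithm reading symbols from `U`. It has finitely many memory states.
Fresh random coins, drawn independently from `coinDist`, are available for the initialization and
for each step; coins that are to be used again have to be stored in the state. -/
structure StreamAlg (U : Type) where
  State : Type
  Coin : Type
  finiteState : Finite State
  finiteCoin : Finite Coin
  coinDist : PMF Coin
  init : Coin → State
  step : Coin → State → U → State
  output : State → ℝ

namespace StreamAlg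

variable {U : Type} (A : StreamAlg U)

instance : MeasurableSpace A.Coin := ⊤

/-- The law of the sequence of independent coins. -/
def coinLaw : Measure (ℕ → A.Coin) := Measure.infinitePi fun _ => A.coinDist.toMeasure

/-- Space usage in bits: the binary logarithm of the number of memory states. -/
def bits : ℝ := Real.logb 2 (Nat.card A.State)

/-- The state after reading `σ`; the `t`-th symbol (counted from 1) is processed with coin `ω t`. -/
def stateAfter (ω : ℕ → A.Coin) (σ : List U) : A.State :=
  (σ.zipIdx 1).foldl (fun s p => A.step (ω p.2) s p.1) (A.init (ω 0))

/-- The output after reading `σ`. -/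
def outputAfter (ω : ℕ → A.Coin) (σ : List U) : ℝ := A.output (A.stateAfter ω σ)

/-- All outputs given while reading `σ`, one after each symbol. -/
def outputs (ω : ℕ → A.Coin) (σ : List U) : List ℝ :=
  (List.range σ.length).map fun i => A.outputAfter ω (σ.take (i + 1))

/-- The first `t` updates of the stream that an adaptive adversary produces: each update is an
arbitrary function of all earlier outputs of the algorithm. -/
def adaptiveStream (adv : List ℝ → U) (ω : ℕ → A.Coin) : ℕ → List U
  | 0 => []
  | t + 1 => adaptiveStream adv ω t ++ [adv (A.outputs ω (adaptiveStream adv ω t))]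

end StreamAlg

/-- The frequency vector of an insertion-only stream. -/
def freq {n : ℕ} (σ : List (Fin n)) : Fin n → ℕ := fun i => σ.count i

/-- The updates at the times `p, …, q` (inclusive, times counted from 1). -/
def substream {n : ℕ} (σ : List (Fin n)) (p q : ℕ) : List (Fin n) := (σ.take q).drop (p - 1)

/-- `i 0 < i 1 < … < i (k-1)` are times at which `F` twists on the stream `σ`: between any two
consecutive ones, either the value of `F` on the prefix changes by more than a factor `1 ± ε`, or
the value of `F` on the substream in between is at least `ε` times that on the earlier prefix. -/
def IsTwistSequence {n : ℕ} (F : (Fin n → ℕ) → ℝ) (ε : ℝ) (σ : List (Fin n)) {k : ℕ}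
    (i : Fin k → ℕ) : Prop :=
  StrictMono i ∧ (∀ j, i j ≤ σ.length) ∧
    ∀ (j : ℕ) (h : j + 1 < k),
      let p := i ⟨j, Nat.lt_of_succ_lt h⟩
      let q := i ⟨j + 1, h⟩
      F (freq (σ.take p)) ∉
          Set.Icc ((1 - ε) * F (freq (σ.take q))) ((1 + ε) * F (freq (σ.take q))) ∨
        ε * F (freq (σ.take p)) ≤ F (freq (substream σ p q))

/-- The twist number of `F` on the stream `σ`: the largest length of a twist sequence (lengths
are bounded by `σ.length + 1`). -/
def twistNumber {n : ℕ} (F : (Fin n → ℕ) → ℝ) (ε : ℝ) (σ : List (Fin n)) : ℕ :=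
  sSup {k : ℕ | ∃ i : Fin k → ℕ, IsTwistSequence F ε σ i}

/-- `(ε, δ)`-strong tracking of `F` on every (oblivious) stream of length at most `m`. -/
def IsStrongTracker {n : ℕ} (F : (Fin n → ℕ) → ℝ) (m : ℕ) (ε δ : ℝ)
    (A : StreamAlg (Fin n)) : Prop :=
  ∀ σ : List (Fin n), σ.length ≤ m →
    1 - δ ≤ A.coinLaw.real {ω | ∀ t, 1 ≤ t → t ≤ σ.length →
      |A.outputAfter ω (σ.take t) - F (freq (σ.take t))| ≤ ε * |F (freq (σ.take t))|}

/-- The input of a difference estimator: the prefix `v`, then the symbol `none`, which reveals the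
splitting time at the moment it occurs, then the suffix `w`. -/
def splitStream {n : ℕ} (v w : List (Fin n)) : List (Option (Fin n)) :=
  v.map some ++ none :: w.map some

/-- `(γ, ε, δ)`-(fixed-prefix) difference estimator for `F` on (oblivious) streams of length at
most `m`: with probability at least `1 - δ`, simultaneously at all times after the splitting time
at which both the difference and the value of the suffix are at most `γ F(v)`, the output is within
`ε F(v)` of the difference `F(v + w_t) - F(v)`. -/
def IsDifferenceEstimator {n : ℕ} (F : (Fin n → ℕ) → ℝ) (m : ℕ) (γ ε δ : ℝ)
    (B : StreamAlg (Option (Fin n))) : Prop :=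
  ∀ v w : List (Fin n), v ≠ [] → v.length + w.length ≤ m →
    1 - δ ≤ B.coinLaw.real {ω | ∀ t ≤ w.length,
      F (freq v + freq (w.take t)) - F (freq v) ≤ γ * F (freq v) →
      F (freq (w.take t)) ≤ γ * F (freq v) →
      |B.outputAfter ω (splitStream v (w.take t)) -
        (F (freq v + freq (w.take t)) - F (freq v))| ≤ ε * F (freq v)}

/-- Against every adaptive adversary, with probability at least `p`, the output is a
`(1 + ε)`-approximation of `F` at all times `1, …, m`. -/
def IsAdversariallyRobust {n : ℕ} (F : (Fin n → ℕ) → ℝ) (m : ℕ) (ε p : ℝ)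
    (A : StreamAlg (Fin n)) : Prop :=
  ∀ adv : List ℝ → Fin n,
    p ≤ A.coinLaw.real {ω | ∀ t, 1 ≤ t → t ≤ m →
      |A.outputAfter ω (A.adaptiveStream adv ω t) - F (freq (A.adaptiveStream adv ω t))| ≤
        ε * F (freq (A.adaptiveStream adv ω t))}

/-- Conventions on a space function `S(n, δ, ε)`: it is nonnegative, nondecreasing in `1/ε`, and its
dependence on `1/ε` is at most polylogarithmic, in the sense that replacing the accuracy `ε` by
`ε²` costs at most a constant factor. -/
structure IsSpaceFunction (S : ℕ → ℝ → ℝ → ℝ) : Prop where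
  nonneg : ∀ n ≥ 2, ∀ δ ∈ Set.Ioo (0 : ℝ) 1, ∀ ε ∈ Set.Ioc (0 : ℝ) (1 / 2), 0 ≤ S n δ ε
  antitone : ∀ n ≥ 2, ∀ δ ∈ Set.Ioo (0 : ℝ) 1, AntitoneOn (S n δ) (Set.Ioc (0 : ℝ) (1 / 2))
  square : ∃ K : ℝ, ∀ n ≥ 2, ∀ δ ∈ Set.Ioo (0 : ℝ) 1, ∀ ε ∈ Set.Ioc (0 : ℝ) (1 / 2),
    S n δ (ε ^ 2) ≤ K * S n δ ε

end

/-! The robust algorithm keeps a hierarchy of levels `l ≤ L` with `2⁻ᴸ ≈ ε`. Level `l` owns `M l`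
one-time blocks, used one after another; a block of level `l ≥ 1` holds a difference estimator with
`γ = 2⁻ˡ`, a block of level `0` a strong tracker of `F`, and every block also holds a tracker with
accuracy `1/4` of `F` on the updates since the block was opened. Closing a block freezes its
reading. The output is a telescoping sum of frozen readings: one value of `F` plus differences of
ever finer levels.

Robustness. Until a block is closed its readings are invisible: they enter only through alarms, and
an alarm closes the block. So up to that moment the run agrees with one in which this instance
always outputs `0` (`maskView_stateAfter_eq`). In the masked run the stream does not depend on the
coins of the instance; with all other coins fixed, the oblivious guarantee applies
(`coinField_maskedBad_le`). A union bound over the instances gives probability `2/3`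
(`le_coinLaw_of_forall_goodOn`).

Accuracy. If level `l` is silent, then both the growth of `F` since the level was last opened and
the value of `F` on the suffix are at most `2⁻ˡ⁻¹` times the old value, which is the range of the
estimators of level `l + 1` (`validAt_of_le_alarmLevel`). Hence all levels up to the coarsest alarm
can be trusted. At most three readings per level are in use, so the frozen errors add up to at most
`3 ∑ e l ≤ 2⁻ᴸ/32`, and silence of level `L` leaves at most `2⁻ᴸ/2` for the drift since then.

Number of blocks. An alarm with coarsest level `l` is a twist with parameter `2⁻ˡ/16`, so there are
at most `T 2ˡ` of them, with `T = O(log n)`. A closing moves from the alarm level to a coarser one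
only when the levels in between already hold three readings, which are then discarded. The potential
inequality `cur_count` turns this into at most `3 T 2ˡ + 1` blocks at level `l`
(`cur_le_of_counts`). The invariant `RunInvariant` carries accuracy and counting together through
the stream.

Space. The dominant cost is `log n · ∑ 2ˡ γₗ^C / eₗ²` times `S₁`. For `C > 1` geometrically
decreasing accuracies make the sum `O(1/ε²)`; for `C = 1` equal accuracies `ε/(192 (L+1))` give
`O(L³/ε²)`. There are `O(log n/ε)` instances, so `q = 1` suffices in `δ'`. -/

/-! ### Runs of streaming algorithms and adaptive streams -/

namespace StreamAlg

variable {U : Type} (A : StreamAlg U)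

instance : Finite A.State := A.finiteState
instance : Finite A.Coin := A.finiteCoin

instance : IsProbabilityMeasure A.coinLaw := by unfold coinLaw; infer_instance

lemma nonempty_state : Nonempty A.State :=
  ⟨A.init A.coinDist.support_nonempty.some⟩

@[simp] lemma stateAfter_nil (ω : ℕ → A.Coin) : A.stateAfter ω [] = A.init (ω 0) := rfl

lemma stateAfter_concat (ω : ℕ → A.Coin) (σ : List U) (u : U) :
    A.stateAfter ω (σ ++ [u]) = A.step (ω (σ.length + 1)) (A.stateAfter ω σ) u := by
  simp [stateAfter, List.zipIdx_append, List.foldl_append, add_comm]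

lemma stateAfter_congr {ω ω' : ℕ → A.Coin} (σ : List U) (h : ∀ t ≤ σ.length, ω t = ω' t) :
    A.stateAfter ω σ = A.stateAfter ω' σ := by
  induction σ using List.reverseRecOn with
  | nil => simp [h 0]
  | append_singleton σ u ih =>
    rw [stateAfter_concat, stateAfter_concat, ih fun t ht => h t (by simp; omega),
      h _ (by simp)]

@[simp] lemma adaptiveStream_length (adv : List ℝ → U) (ω : ℕ → A.Coin) (t : ℕ) :
    (A.adaptiveStream adv ω t).length = t := by
  induction t with
  | zero => rfl
  | succ t ih => simp [adaptiveStream, ih]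

lemma take_adaptiveStream (adv : List ℝ → U) (ω : ℕ → A.Coin) {s t : ℕ} (h : s ≤ t) :
    (A.adaptiveStream adv ω t).take s = A.adaptiveStream adv ω s := by
  induction t, h using Nat.le_induction with
  | base => simp [List.take_of_length_le]
  | succ t hst ih =>
    rw [adaptiveStream, List.take_append_of_le_length (by simpa using hst), ih]

lemma outputs_congr {ω ω' : ℕ → A.Coin} (σ : List U) (h : ∀ t ≤ σ.length, ω t = ω' t) :
    A.outputs ω σ = A.outputs ω' σ := by
  refine List.map_congr_left fun i hi => ?_
  rw [List.mem_range] at hi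
  exact congrArg _ (A.stateAfter_congr _ fun t ht => h t (by simp at ht; omega))

lemma adaptiveStream_congr (adv : List ℝ → U) {ω ω' : ℕ → A.Coin} (t : ℕ)
    (h : ∀ s ≤ t, ω s = ω' s) : A.adaptiveStream adv ω t = A.adaptiveStream adv ω' t := by
  induction t with
  | zero => rfl
  | succ t ih =>
    rw [adaptiveStream, adaptiveStream, ← ih fun s hs => h s (by omega)]
    rw [A.outputs_congr _ fun s hs => h s (by simp at hs; omega)]

end StreamAlg

/-! ### Resampling coordinates of an infinite product measure -/

section product

variable {ι : Type*} {X : ι → Type*} [∀ i, MeasurableSpace (X i)]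

/-- Such a set is the preimage of a subset of a finite product of finite spaces, where every set is
measurable. All finite-horizon events become measurable this way, with nothing to check about
adversaries or outputs. -/
lemma measurableSet_of_dependsOn_finset [∀ i, Finite (X i)] [∀ i, MeasurableSingletonClass (X i)]
    (s : Finset ι) (E : Set (∀ i, X i))
    (h : ∀ x y, (∀ i ∈ s, x i = y i) → x ∈ E → y ∈ E) : MeasurableSet E := by
  have hE : E = s.restrict ⁻¹' (s.restrict '' E) := by
    refine Set.Subset.antisymm (Set.subset_preimage_image _ _) ?_
    rintro y ⟨x, hx, hxy⟩
    exact h x y (fun i hi => congrFun hxy ⟨i, hi⟩) hx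
  rw [hE]
  exact Finset.measurable_restrict s (Set.toFinite _).measurableSet

open Classical in
/-- The point `x` with the coordinates in `S` replaced by those of `y`. -/
noncomputable def mixCoords (S : Set ι) (x y : ∀ i, X i) : ∀ i, X i := fun i => if i ∈ S then y i else x i

/-- It suffices to test boxes: the preimage of a box is a box over the coordinates outside `S` times
a box over those inside `S`. -/
lemma measurePreserving_mixCoords (μ : ∀ i, Measure (X i)) [∀ i, IsProbabilityMeasure (μ i)]
    (S : Set ι) :
    MeasurePreserving (fun p : (∀ i, X i) × (∀ i, X i) => mixCoords S p.1 p.2)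
      ((Measure.infinitePi μ).prod (Measure.infinitePi μ)) (Measure.infinitePi μ) := by
  classical
  have hm : Measurable fun p : (∀ i, X i) × (∀ i, X i) => mixCoords S p.1 p.2 := by
    refine measurable_pi_lambda _ fun i => ?_
    by_cases hi : i ∈ S
    · simp only [mixCoords, hi, if_true]; fun_prop
    · simp only [mixCoords, hi, if_false]; fun_prop
  refine ⟨hm, Measure.eq_infinitePi μ fun s t ht => ?_⟩
  rw [Measure.map_apply hm (.pi s.countable_toSet fun i _ => ht i)]
  have : (fun p : (∀ i, X i) × (∀ i, X i) => mixCoords S p.1 p.2) ⁻¹' (s : Set ι).pi t =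
      ((s.filter (· ∉ S) : Finset ι) : Set ι).pi t ×ˢ
        ((s.filter (· ∈ S) : Finset ι) : Set ι).pi t := by
    ext p
    simp only [Set.mem_preimage, Set.mem_pi, Set.mem_prod, Finset.coe_filter, Set.mem_ofPred_eq,
      Finset.mem_coe, mixCoords]
    constructor
    · intro h
      exact ⟨fun i hi => by simpa [hi.2] using h i hi.1, fun i hi => by simpa [hi.2] using h i hi.1⟩
    · intro h i hi
      by_cases hS : i ∈ S
      · simpa [hS] using h.2 i ⟨hi, hS⟩
      · simpa [hS] using h.1 i ⟨hi, hS⟩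
  rw [this, Measure.prod_prod, Measure.infinitePi_pi _ fun i _ => ht i,
    Measure.infinitePi_pi _ fun i _ => ht i, mul_comm, Finset.prod_filter_mul_prod_filter_not]

/-- An event whose sections over a resampling of the coordinates in `S` are all of measure at most
`δ` is itself of measure at most `δ`. -/
lemma infinitePi_le_of_forall_mixCoords (μ : ∀ i, Measure (X i)) [∀ i, IsProbabilityMeasure (μ i)]
    (S : Set ι) {B : Set (∀ i, X i)} (hB : MeasurableSet B) {δ : ENNReal}
    (h : ∀ x, Measure.infinitePi μ {y | mixCoords S x y ∈ B} ≤ δ) :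
    Measure.infinitePi μ B ≤ δ := by
  have hp := measurePreserving_mixCoords μ S
  -- Fubini takes the place of conditioning on the coordinates outside `S`.
  rw [← hp.measure_preimage hB.nullMeasurableSet, Measure.prod_apply (hp.measurable hB)]
  calc _ ≤ ∫⁻ _, δ ∂(Measure.infinitePi μ) := lintegral_mono fun x => h x
    _ = δ := by simp

end product

/-! ### Split streams, and trackers used as devices on them -/

lemma freq_append {n : ℕ} (v w : List (Fin n)) : freq (v ++ w) = freq v + freq w := by
  funext i
  simp [freq]

lemma splitStream_concat {n : ℕ} (v w : List (Fin n)) (u : Fin n) :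
    splitStream v (w ++ [u]) = splitStream v w ++ [some u] := by
  simp [splitStream]

lemma splitStream_nil {n : ℕ} (v : List (Fin n)) :
    splitStream v [] = v.map some ++ [none] := by
  simp [splitStream]

@[simp] lemma length_splitStream {n : ℕ} (v w : List (Fin n)) :
    (splitStream v w).length = v.length + 1 + w.length := by
  simp [splitStream]; omega

namespace StreamAlg

lemma measurableSet_of_dependsOn {U : Type} (A : StreamAlg U) (N : ℕ) (E : Set (ℕ → A.Coin))
    (h : ∀ ω ω' : ℕ → A.Coin, (∀ t ≤ N, ω t = ω' t) → ω ∈ E → ω' ∈ E) : MeasurableSet E :=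
  measurableSet_of_dependsOn_finset (Finset.range (N + 1)) E fun ω ω' hω =>
    h ω ω' fun t ht => hω t (by simp; omega)

/-- Independent identically distributed coins keep their law under injective reindexing. This
absorbs the shift of coins caused by the splitting symbol. -/
lemma measurePreserving_coinLaw_comp {U : Type} (A : StreamAlg U) {e : ℕ → ℕ}
    (he : Function.Injective e) :
    MeasurePreserving (fun (ω : ℕ → A.Coin) r => ω (e r)) A.coinLaw A.coinLaw :=
  ⟨by fun_prop, Measure.map_infinitePi_infinitePi_of_inj (P := fun _ => A.coinDist.toMeasure) he⟩

end StreamAlg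

/-- The coins with which, on every stream `v` that is split and continued by `w`, the output
satisfies `spec` at all times after the splitting time. -/
def goodCoins {n : ℕ} (spec : List (Fin n) → List (Fin n) → ℝ → Prop)
    (A : StreamAlg (Option (Fin n))) (v w : List (Fin n)) : Set (ℕ → A.Coin) :=
  {ω | ∀ t, 1 ≤ t → t ≤ w.length → spec v (w.take t) (A.outputAfter ω (splitStream v (w.take t)))}

/-- `A` satisfies `spec` after the splitting time with probability at least `1 - δ`. -/
def Satisfies {n : ℕ} (spec : List (Fin n) → List (Fin n) → ℝ → Prop) (m : ℕ) (δ : ℝ)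
    (A : StreamAlg (Option (Fin n))) : Prop :=
  ∀ v w : List (Fin n), v ≠ [] → v.length + w.length ≤ m →
    1 - δ ≤ A.coinLaw.real (goodCoins spec A v w)

lemma goodCoins_of_agree {n : ℕ} {spec : List (Fin n) → List (Fin n) → ℝ → Prop}
    {A : StreamAlg (Option (Fin n))} {v w : List (Fin n)} {ω ω' : ℕ → A.Coin}
    (h : ∀ t ≤ v.length + 1 + w.length, ω t = ω' t) (hω : ω ∈ goodCoins spec A v w) :
    ω' ∈ goodCoins spec A v w := by
  intro t h1 ht
  have := hω t h1 ht
  rwa [StreamAlg.outputAfter, A.stateAfter_congr _ fun s hs => h s (by simp at hs; omega)] at this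

lemma measurableSet_goodCoins {n : ℕ} (spec : List (Fin n) → List (Fin n) → ℝ → Prop)
    (A : StreamAlg (Option (Fin n))) (v w : List (Fin n)) :
    MeasurableSet (goodCoins spec A v w) :=
  A.measurableSet_of_dependsOn (v.length + 1 + w.length) _ fun _ _ h => goodCoins_of_agree h

/-- The output approximates `F` on the whole stream. -/
def TracksPrefix {n : ℕ} (F : (Fin n → ℕ) → ℝ) (ε : ℝ) (v w : List (Fin n)) (x : ℝ) : Prop :=
  |x - F (freq (v ++ w))| ≤ ε * F (freq (v ++ w))

/-- The output approximates `F` on the part of the stream after the splitting time. -/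
def TracksSuffix {n : ℕ} (F : (Fin n → ℕ) → ℝ) (ε : ℝ) (_ w : List (Fin n)) (x : ℝ) : Prop :=
  |x - F (freq w)| ≤ ε * F (freq w)

/-- The output approximates the difference, provided that the suffix changes `F` only little. -/
def EstimatesDifference {n : ℕ} (F : (Fin n → ℕ) → ℝ) (γ ε : ℝ) (v w : List (Fin n)) (x : ℝ) :
    Prop :=
  F (freq (v ++ w)) - F (freq v) ≤ γ * F (freq v) → F (freq w) ≤ γ * F (freq v) →
    |x - (F (freq (v ++ w)) - F (freq v))| ≤ ε * F (freq v)

lemma IsDifferenceEstimator.satisfies {n : ℕ} {F : (Fin n → ℕ) → ℝ} {m : ℕ} {γ ε δ : ℝ}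
    {B : StreamAlg (Option (Fin n))} (h : IsDifferenceEstimator F m γ ε δ B) :
    Satisfies (EstimatesDifference F γ ε) m δ B := by
  intro v w hv hm
  refine (h v w hv hm).trans (measureReal_mono fun ω hω t _ ht => ?_)
  simpa only [EstimatesDifference, freq_append] using hω t ht

namespace StreamAlg

variable {n : ℕ} (A : StreamAlg (Fin n))

/-- The algorithm `A`, run on split streams by ignoring the splitting time. -/
abbrev ignoreSplit : StreamAlg (Option (Fin n)) where
  State := A.State
  Coin := A.Coin
  finiteState := A.finiteState
  finiteCoin := A.finiteCoin
  coinDist := A.coinDist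
  init := A.init
  step c s o := o.elim s (A.step c s)
  output := A.output

/-- The algorithm `A`, started at the splitting time. -/
abbrev startAtSplit : StreamAlg (Option (Fin n)) where
  State := Option A.State
  Coin := A.Coin
  finiteState := inferInstance
  finiteCoin := A.finiteCoin
  coinDist := A.coinDist
  init _ := none
  step c s o := o.elim (some (A.init c)) fun u => s.map fun s => A.step c s u
  output s := s.elim 0 A.output

lemma ignoreSplit_stateAfter_map (ω : ℕ → A.Coin) (v : List (Fin n)) :
    A.ignoreSplit.stateAfter ω (v.map some) = A.stateAfter ω v := by
  induction v using List.reverseRecOn with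
  | nil => rfl
  | append_singleton v u ih =>
    rw [List.map_append, List.map_singleton, stateAfter_concat, stateAfter_concat, ih,
      List.length_map]
    rfl

/-- The splitting symbol uses up the coin with index `v.length + 1`, which the run of `A` itself has
to skip. -/
lemma ignoreSplit_stateAfter (ω : ℕ → A.Coin) (v w : List (Fin n)) :
    A.ignoreSplit.stateAfter ω (splitStream v w) =
      A.stateAfter (fun r => ω (if r ≤ v.length then r else r + 1)) (v ++ w) := by
  induction w using List.reverseRecOn with
  | nil =>
    rw [splitStream_nil, stateAfter_concat, ignoreSplit_stateAfter_map, List.append_nil]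
    exact A.stateAfter_congr _ fun t ht => by simp [ht]
  | append_singleton w u ih =>
    rw [splitStream_concat, stateAfter_concat, ih, ← List.append_assoc, stateAfter_concat]
    simp only [length_splitStream, List.length_append]
    rw [if_neg (by omega), show v.length + w.length + 1 + 1 = v.length + 1 + w.length + 1 by omega]
    rfl

lemma startAtSplit_stateAfter_map (ω : ℕ → A.Coin) (v : List (Fin n)) :
    A.startAtSplit.stateAfter ω (v.map some) = (none : Option A.State) := by
  induction v using List.reverseRecOn with
  | nil => rfl
  | append_singleton v u ih =>
    rw [List.map_append, List.map_singleton, stateAfter_concat, ih]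
    rfl

lemma startAtSplit_stateAfter (ω : ℕ → A.Coin) (v w : List (Fin n)) :
    A.startAtSplit.stateAfter ω (splitStream v w) =
      some (A.stateAfter (fun r => ω (v.length + 1 + r)) w) := by
  induction w using List.reverseRecOn with
  | nil =>
    rw [splitStream_nil, stateAfter_concat, startAtSplit_stateAfter_map, List.length_map]
    rfl
  | append_singleton w u ih =>
    rw [splitStream_concat, stateAfter_concat, ih, stateAfter_concat, length_splitStream]
    rfl

end StreamAlg

lemma measurableSet_strongTracking {n : ℕ} (F : (Fin n → ℕ) → ℝ) (ε : ℝ) (A : StreamAlg (Fin n))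
    (σ : List (Fin n)) : MeasurableSet {ω | ∀ t, 1 ≤ t → t ≤ σ.length →
      |A.outputAfter ω (σ.take t) - F (freq (σ.take t))| ≤ ε * |F (freq (σ.take t))|} := by
  refine A.measurableSet_of_dependsOn σ.length _ fun ω ω' h hω t h1 ht => ?_
  have := hω t h1 ht
  rwa [StreamAlg.outputAfter, A.stateAfter_congr _ fun s hs => h s (by simp at hs; omega)] at this

lemma IsStrongTracker.satisfies_ignoreSplit {n : ℕ} {F : (Fin n → ℕ) → ℝ} (hF : ∀ f, 0 ≤ F f)
    {m : ℕ} {ε δ : ℝ} {A : StreamAlg (Fin n)} (h : IsStrongTracker F m ε δ A) :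
    Satisfies (TracksPrefix F ε) m δ A.ignoreSplit := by
  intro v w _ hm
  refine (h (v ++ w) (by simpa using hm)).trans ?_
  have he : Function.Injective fun r => if r ≤ v.length then r else r + 1 := by
    intro a b hab
    simp only at hab
    split_ifs at hab <;> omega
  rw [← (A.measurePreserving_coinLaw_comp he).measureReal_preimage
    (measurableSet_strongTracking F ε A _).nullMeasurableSet]
  refine measureReal_mono (μ := A.coinLaw) fun ω hω t h1 ht => ?_
  have := hω (v.length + t) (by omega) (by simpa using ht)
  rw [List.take_length_add_append, abs_of_nonneg (hF _)] at this
  simpa only [TracksPrefix, StreamAlg.outputAfter, StreamAlg.ignoreSplit_stateAfter] using this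

lemma IsStrongTracker.satisfies_startAtSplit {n : ℕ} {F : (Fin n → ℕ) → ℝ} (hF : ∀ f, 0 ≤ F f)
    {m : ℕ} {ε δ : ℝ} {A : StreamAlg (Fin n)} (h : IsStrongTracker F m ε δ A) :
    Satisfies (TracksSuffix F ε) m δ A.startAtSplit := by
  intro v w _ hm
  refine (h w (by omega)).trans ?_
  have he : Function.Injective fun r => v.length + 1 + r := add_right_injective _
  rw [← (A.measurePreserving_coinLaw_comp he).measureReal_preimage
    (measurableSet_strongTracking F ε A _).nullMeasurableSet]
  refine measureReal_mono (μ := A.coinLaw) fun ω hω t h1 ht => ?_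
  have := hω t h1 ht
  rw [abs_of_nonneg (hF _)] at this
  simpa only [TracksSuffix, StreamAlg.outputAfter, StreamAlg.startAtSplit_stateAfter,
    Option.elim_some] using this

/-- The only additional state is `none`, and adding one state at most doubles their number. -/
lemma StreamAlg.startAtSplit_bits_le {n : ℕ} (A : StreamAlg (Fin n)) :
    A.startAtSplit.bits ≤ A.bits + 1 := by
  have := A.nonempty_state
  have hpos : 0 < Nat.card A.State := Nat.card_pos
  have hcard : Nat.card A.startAtSplit.State = Nat.card A.State + 1 := Finite.card_option
  have h2 : (1 : ℝ) = Real.logb 2 2 := by simp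
  rw [bits, bits, hcard, h2, ← Real.logb_mul (by positivity) (by norm_num)]
  refine Real.logb_le_logb_of_le one_lt_two (by positivity) ?_
  have : (1 : ℝ) ≤ Nat.card A.State := by exact_mod_cast hpos
  push_cast
  linarith

/-! ### The switching algorithm -/

/-- The blocks: `M l` of them at each level `l ≤ L`. -/
abbrev Block (L : ℕ) (M : ℕ → ℕ) : Type := (l : Fin (L + 1)) × Fin (M l)

/-- Every block has two instances of streaming algorithms: `true` for the one that estimates values
of `F` and `false` for the one that tracks `F` on the suffix. -/
abbrev Inst (L : ℕ) (M : ℕ → ℕ) : Type := Block L M × Bool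

section Switching

variable {n : ℕ} {L : ℕ} {M : ℕ → ℕ}

/-- The algorithm that is run as the instance `a`. -/
abbrev algOf (dev : ℕ → Bool → StreamAlg (Option (Fin n))) (a : Inst L M) :
    StreamAlg (Option (Fin n)) := dev a.1.1 a.2

/-- The memory of the switching algorithm. At each level `l` the block `k` is open if
`cur l = k + 1`, it has been closed if `k + 1 < cur l`, and it will be opened later otherwise. -/
structure Memory (L : ℕ) (M : ℕ → ℕ) (dev : ℕ → Bool → StreamAlg (Option (Fin n))) where
  first : Option (Fin n)
  cur : (l : Fin (L + 1)) → Fin (M l + 2)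
  flag : Block L M → Bool
  inst : (a : Inst L M) → (algOf dev a).State

namespace Memory

/-- The sum of `w` over the flagged blocks of level at most `l`. -/
noncomputable def flagSum (flag : Block L M → Bool) (w : Block L M → ℝ) (l : ℕ) : ℝ :=
  ∑ i with flag i = true ∧ (i.1 : ℕ) ≤ l, w i

/-- The number of flagged blocks of level `l`. -/
def flagCount (flag : Block L M → Bool) (l : ℕ) : ℕ :=
  Finset.card {i : Block L M | flag i = true ∧ (i.1 : ℕ) = l}

variable {dev : ℕ → Bool → StreamAlg (Option (Fin n))} (base : Fin n → ℝ)
  (view : (a : Inst L M) → (algOf dev a).State → ℝ)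

/-- Is the block open? -/
def IsOpen (s : Memory L M dev) (i : Block L M) : Prop := (s.cur i.1 : ℕ) = i.2 + 1

/-- Has the block been closed? -/
def IsClosed (s : Memory L M dev) (i : Block L M) : Prop := (i.2 : ℕ) + 1 < s.cur i.1

/-- The estimate of `F` at the last time at which a block of level at most `l` was closed. -/
noncomputable def est (s : Memory L M dev) (l : ℕ) : ℝ :=
  -- Before the first closing of level `0` there is no frozen value of `F`; the exact value at time
  -- `1`, computed from the stored first update, replaces it.
  (if flagCount s.flag 0 = 0 then s.first.elim 0 base else 0) +
    flagSum s.flag (fun i => view (i, true) (s.inst (i, true))) l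

open Classical in
/-- The states of the instances after reading the update `u`. -/
noncomputable def read (s : Memory L M dev) (c : (x : Inst L M × Bool) → (algOf dev x.1).Coin)
    (u : Fin n) (a : Inst L M) : (algOf dev a).State :=
  -- Blocks that are still to be opened read as well, since a difference estimator needs the prefix.
  if s.IsClosed a.1 then s.inst a else (algOf dev a).step (c (a, false)) (s.inst a) (some u)

/-- The condition under which the open block `i` raises an alarm when its instances are in the
states `st`. -/
def Alarm (s : Memory L M dev) (st : (a : Inst L M) → (algOf dev a).State) (i : Block L M) : Prop :=
  -- Level `0` reports `F` itself, the other levels a difference, hence the additional `1`. The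
  -- `max` with `0` keeps the thresholds nonnegative, so an output masked by `0` never raises an
  -- alarm.
  ((if (i.1 : ℕ) = 0 then 1 else 0) + (1 / 2) ^ (i.1 : ℕ) / 4) * max (s.est base view i.1) 0 <
      view (i, true) (st (i, true)) ∨
    (1 / 2) ^ (i.1 : ℕ) / 4 * max (s.est base view i.1) 0 < view (i, false) (st (i, false))

/-- The coarsest level at which there is an alarm; it is `L + 1` if there is none. -/
noncomputable def alarmLevel (s : Memory L M dev) (st : (a : Inst L M) → (algOf dev a).State) : ℕ :=
  sInf {l | l = L + 1 ∨ ∃ i : Block L M, (i.1 : ℕ) = l ∧ s.IsOpen i ∧ s.Alarm base view st i}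

/-- The level at which a block is closed; it is `L + 1` if none is. -/
noncomputable def closeLevel (s : Memory L M dev) (st : (a : Inst L M) → (algOf dev a).State) : ℕ :=
  if s.first = none then 0
  -- A level with three flags is full and passes the closing on to a coarser level. Level `L + 1`
  -- never has flags, so nothing is closed when there is no alarm.
  else Nat.findGreatest (fun j => flagCount s.flag j < 3) (s.alarmLevel base view st)

open Classical in
/-- The new memory when the level `j` is closed while the instances are in the states `st`. -/
noncomputable def close (s : Memory L M dev) (st : (a : Inst L M) → (algOf dev a).State)
    (c : (x : Inst L M × Bool) → (algOf dev x.1).Coin) (u : Fin n) (j : ℕ) : Memory L M dev where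
  first := some (s.first.getD u)
  -- The cap only keeps the counter in its finite range; it is never active in a good run.
  cur l := if j ≤ l then ⟨min (s.cur l + 1) (M l + 1), by omega⟩ else s.cur l
  -- Finer readings are superseded and lose their flags. A new reading of level `0` also replaces
  -- the old one, while differences of level `j ≠ 0` accumulate.
  flag i := if (i.1 : ℕ) < j then s.flag i else
    decide ((i.1 : ℕ) = j ∧ (s.IsOpen i ∨ (s.flag i = true ∧ j ≠ 0)))
  -- The next block of each level `≥ j` has index `cur` before the step; it gets the splitting
  -- symbol after the current update.
  inst a := if j ≤ a.1.1 ∧ (s.cur a.1.1 : ℕ) = a.1.2 then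
    (algOf dev a).step (c (a, true)) (st a) none else st a

/-- The product of the laws of the coins of all instances, two coins for each. -/
noncomputable def coinProduct (L : ℕ) (M : ℕ → ℕ) (dev : ℕ → Bool → StreamAlg (Option (Fin n))) :
    Measure ((x : Inst L M × Bool) → (algOf dev x.1).Coin) :=
  Measure.infinitePi fun x => (algOf dev x.1).coinDist.toMeasure

instance : IsProbabilityMeasure (coinProduct L M dev) := by
  unfold coinProduct; infer_instance

instance : Finite (Memory L M dev) :=
  Finite.of_injective
    (fun s : Memory L M dev => (s.first, s.cur, s.flag, s.inst))
    (by rintro ⟨⟩ ⟨⟩ h; simp only [Prod.mk.injEq] at h; simp [h])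

end Memory

open Memory in
/-- The switching algorithm, with the outputs of the instances replaced by `view`. -/
noncomputable abbrev switching (dev : ℕ → Bool → StreamAlg (Option (Fin n))) (base : Fin n → ℝ)
    (view : (a : Inst L M) → (algOf dev a).State → ℝ) : StreamAlg (Fin n) where
  State := Memory L M dev
  Coin := (x : Inst L M × Bool) → (algOf dev x.1).Coin
  finiteState := inferInstance
  finiteCoin := inferInstance
  coinDist := (Memory.coinProduct L M dev).toPMF
  init c := ⟨none, fun _ => 0, fun _ => false, fun a => (algOf dev a).init (c (a, false))⟩
  step c s u := s.close (s.read c u) c u (s.closeLevel base view (s.read c u))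
  output s := s.est base view L

/-- The law of all coins: instance `a` has at each time `t` the coins `(t, a, false)` and
`(t, a, true)`. -/
noncomputable def coinField (L : ℕ) (M : ℕ → ℕ) (dev : ℕ → Bool → StreamAlg (Option (Fin n))) :
    Measure ((x : (_ : ℕ) × (Inst L M × Bool)) → (algOf dev x.2.1).Coin) :=
  Measure.infinitePi fun x => (algOf dev x.2.1).coinDist.toMeasure

instance (dev : ℕ → Bool → StreamAlg (Option (Fin n))) :
    IsProbabilityMeasure (coinField L M dev) := by
  unfold coinField; infer_instance

/-- The product σ-algebra on the joint coins and `⊤` are equal because the coins are finite, but not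
by definition; this transports the measure between the two. -/
lemma infinitePi_toMeasure_of_eq_top {C : Type} (m : MeasurableSpace C) (hm : m = ⊤) (p : PMF C) :
    (@Measure.infinitePi ℕ (fun _ => C) (fun _ => ⊤) (fun _ => @PMF.toMeasure C ⊤ p) :
      Set (ℕ → C) → ENNReal) =
    @Measure.infinitePi ℕ (fun _ => C) (fun _ => m) (fun _ => @PMF.toMeasure C m p) := by
  subst hm; rfl

/-- One inequality is enough, and it holds without measurability of `E`. -/
lemma coinField_preimage_le (dev : ℕ → Bool → StreamAlg (Option (Fin n))) (base : Fin n → ℝ)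
    (view : (a : Inst L M) → (algOf dev a).State → ℝ)
    (E : Set (ℕ → (x : Inst L M × Bool) → (algOf dev x.1).Coin)) :
    coinField L M dev ((fun ω t x => ω ⟨t, x⟩) ⁻¹' E) ≤ (switching dev base view).coinLaw E := by
  have hm : (MeasurableSpace.pi : MeasurableSpace ((x : Inst L M × Bool) → (algOf dev x.1).Coin)) =
      ⊤ := by
    refine top_unique fun s _ => ?_
    exact (Set.toFinite s).measurableSet
  have h := Measure.infinitePi_map_piCurry
    (fun (_ : ℕ) (x : Inst L M × Bool) => (algOf dev x.1).coinDist.toMeasure)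
  have hE : (switching dev base view).coinLaw E = (Measure.infinitePi fun _ : ℕ =>
      Measure.infinitePi fun x : Inst L M × Bool => (algOf dev x.1).coinDist.toMeasure) E := by
    have := congrFun (infinitePi_toMeasure_of_eq_top MeasurableSpace.pi hm
      (Memory.coinProduct L M dev).toPMF) E
    rw [Measure.toPMF_toMeasure] at this
    exact this
  rw [hE, ← h]
  exact Measure.le_map_apply (MeasurableEquiv.measurable _).aemeasurable E

end Switching

/-! ### Masking the outputs of one instance -/

section Switching

variable {n : ℕ} {L : ℕ} {M : ℕ → ℕ} {dev : ℕ → Bool → StreamAlg (Option (Fin n))}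
  {base : Fin n → ℝ} {view view' : (a : Inst L M) → (algOf dev a).State → ℝ}

namespace Memory

lemma cur_le_close_cur (s : Memory L M dev) (st : (a : Inst L M) → (algOf dev a).State)
    (c : (x : Inst L M × Bool) → (algOf dev x.1).Coin) (u : Fin n) (j : ℕ) (l : Fin (L + 1)) :
    (s.cur l : ℕ) ≤ (s.close st c u j).cur l := by
  have := (s.cur l).2
  simp only [close]
  split_ifs
  · simp only; omega
  · exact le_rfl

lemma close_cur_of_le (s : Memory L M dev) (st : (a : Inst L M) → (algOf dev a).State)
    (c : (x : Inst L M × Bool) → (algOf dev x.1).Coin) (u : Fin n) {j : ℕ} {l : Fin (L + 1)}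
    (h : j ≤ l) (hl : (s.cur l : ℕ) ≤ M l) : ((s.close st c u j).cur l : ℕ) = s.cur l + 1 := by
  simp only [close, if_pos h]
  omega

lemma close_cur_of_lt (s : Memory L M dev) (st : (a : Inst L M) → (algOf dev a).State)
    (c : (x : Inst L M × Bool) → (algOf dev x.1).Coin) (u : Fin n) {j : ℕ} {l : Fin (L + 1)}
    (h : l < j) : (s.close st c u j).cur l = s.cur l := by
  simp only [close, if_neg (not_le.2 h)]

lemma close_flag_iff (s : Memory L M dev) (st : (a : Inst L M) → (algOf dev a).State)
    (c : (x : Inst L M × Bool) → (algOf dev x.1).Coin) (u : Fin n) (j : ℕ) (i : Block L M) :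
    (s.close st c u j).flag i = true ↔ ((i.1 : ℕ) < j ∧ s.flag i = true) ∨
      ((i.1 : ℕ) = j ∧ (s.IsOpen i ∨ (s.flag i = true ∧ j ≠ 0))) := by
  classical
  simp only [close]
  split_ifs with h
  · simp [h, h.ne]
  · simp [h]

lemma flagSum_congr {flag : Block L M → Bool} {w w' : Block L M → ℝ}
    (h : ∀ i, flag i = true → w i = w' i) (l : ℕ) : flagSum flag w l = flagSum flag w' l :=
  Finset.sum_congr rfl fun i hi => h i (Finset.mem_filter.1 hi).2.1

lemma est_congr {s s' : Memory L M dev} (hfirst : s.first = s'.first) (hflag : s.flag = s'.flag)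
    (h : ∀ i, s.flag i = true → view (i, true) (s.inst (i, true)) =
      view' (i, true) (s'.inst (i, true))) (l : ℕ) : s.est base view l = s'.est base view' l := by
  unfold est
  rw [flagSum_congr h, hfirst, hflag]

lemma alarmLevel_le (s : Memory L M dev) (st : (a : Inst L M) → (algOf dev a).State) :
    s.alarmLevel base view st ≤ L + 1 := Nat.sInf_le (Or.inl rfl)

lemma closeLevel_le_alarmLevel (s : Memory L M dev) (st : (a : Inst L M) → (algOf dev a).State) :
    s.closeLevel base view st ≤ s.alarmLevel base view st := by
  unfold closeLevel
  split_ifs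
  · exact Nat.zero_le _
  · exact Nat.findGreatest_le _

lemma alarmLevel_congr {s s' : Memory L M dev} {st st' : (a : Inst L M) → (algOf dev a).State}
    (h : ∀ i, s.IsOpen i ∧ s.Alarm base view st i ↔ s'.IsOpen i ∧ s'.Alarm base view' st' i) :
    s.alarmLevel base view st = s'.alarmLevel base view' st' := by
  unfold alarmLevel
  congr! 7 with l i
  exact h i

/-- The memories agree, except possibly for the state of the instance `a`. -/
structure EqOff (a : Inst L M) (s s' : Memory L M dev) : Prop where
  first : s.first = s'.first
  cur : s.cur = s'.cur
  flag : s.flag = s'.flag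
  inst : ∀ b ≠ a, s.inst b = s'.inst b

end Memory

open Classical in
/-- The outputs with those of the instance `a` replaced by `0`. -/
noncomputable def maskView (view : (a : Inst L M) → (algOf dev a).State → ℝ) (a b : Inst L M)
    (x : (algOf dev b).State) : ℝ := if b = a then 0 else view b x

lemma maskView_self (a : Inst L M) (x : (algOf dev a).State) : maskView view a a x = 0 := by
  simp [maskView]

lemma maskView_of_ne {a b : Inst L M} (h : b ≠ a) (x : (algOf dev b).State) :
    maskView view a b x = view b x := by
  simp [maskView, h]

namespace Memory

/-- With the outputs of `a` masked, no alarm, level or estimate looks at the state of `a`, so its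
coins influence nothing else. -/
lemma EqOff.step {a : Inst L M} {s s' : Memory L M dev} (h : EqOff a s s')
    {c c' : (x : Inst L M × Bool) → (algOf dev x.1).Coin} (hc : ∀ x, x.1 ≠ a → c x = c' x)
    (u : Fin n) :
    EqOff a ((switching dev base (maskView view a)).step c s u)
      ((switching dev base (maskView view a)).step c' s' u) := by
  have hview : ∀ (f f' : (b : Inst L M) → (algOf dev b).State), (∀ b ≠ a, f b = f' b) →
      ∀ b, maskView view a b (f b) = maskView view a b (f' b) := by
    intro f f' hf b
    by_cases hb : b = a
    · subst hb; simp [maskView_self]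
    · rw [hf b hb]
  have hopen : ∀ i, s.IsOpen i ↔ s'.IsOpen i := fun i => by simp only [IsOpen, h.cur]
  have hread : ∀ b ≠ a, s.read c u b = s'.read c' u b := by
    intro b hb
    have hcl : s.IsClosed b.1 ↔ s'.IsClosed b.1 := by simp only [IsClosed, h.cur]
    by_cases hx : s'.IsClosed b.1
    · rw [read, read, if_pos (hcl.2 hx), if_pos hx, h.inst b hb]
    · rw [read, read, if_neg (hcl.not.2 hx), if_neg hx, h.inst b hb, hc (b, false) hb]
  have hest : ∀ l, s.est base (maskView view a) l = s'.est base (maskView view a) l :=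
    est_congr h.first h.flag fun i _ => hview _ _ h.inst _
  have hal : s.alarmLevel base (maskView view a) (s.read c u) =
      s'.alarmLevel base (maskView view a) (s'.read c' u) := by
    refine alarmLevel_congr fun i => and_congr (hopen i) ?_
    simp only [Alarm, hest, hview _ _ hread]
  have hcl : s.closeLevel base (maskView view a) (s.read c u) =
      s'.closeLevel base (maskView view a) (s'.read c' u) := by
    simp only [closeLevel, hal, h.first, h.flag]
  constructor
  · simp only [close, h.first]
  · simp only [close, hcl, h.cur]
  · funext i
    simp only [close, hcl, h.flag]
    split_ifs
    · rfl
    · exact decide_eq_decide.2 (by rw [hopen i, hcl, h.flag])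
  · intro b hb
    simp only [close, hcl, h.cur, hread b hb, hc (b, true) hb]

end Memory

lemma eqOff_stateAfter {a : Inst L M}
    {ω ω' : ℕ → (x : Inst L M × Bool) → (algOf dev x.1).Coin}
    (hω : ∀ t x, x.1 ≠ a → ω t x = ω' t x) (σ : List (Fin n)) :
    Memory.EqOff a ((switching dev base (maskView view a)).stateAfter ω σ)
      ((switching dev base (maskView view a)).stateAfter ω' σ) := by
  induction σ using List.reverseRecOn with
  | nil => exact ⟨rfl, rfl, rfl, fun b hb => congrArg (algOf dev b).init (hω 0 _ hb)⟩
  | append_singleton σ u ih =>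
    rw [StreamAlg.stateAfter_concat, StreamAlg.stateAfter_concat]
    exact ih.step (hω _) u

lemma maskView_outputAfter_eq {a : Inst L M}
    {ω ω' : ℕ → (x : Inst L M × Bool) → (algOf dev x.1).Coin}
    (hω : ∀ t x, x.1 ≠ a → ω t x = ω' t x) (σ : List (Fin n)) :
    (switching dev base (maskView view a)).outputAfter ω σ =
      (switching dev base (maskView view a)).outputAfter ω' σ := by
  have h := eqOff_stateAfter (base := base) (view := view) hω σ
  refine Memory.est_congr h.first h.flag (fun i _ => ?_) L
  by_cases hb : (i, true) = a
  · subst hb; simp [maskView_self]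
  · rw [h.inst _ hb]

lemma maskView_adaptiveStream_eq {a : Inst L M} (adv : List ℝ → Fin n)
    {ω ω' : ℕ → (x : Inst L M × Bool) → (algOf dev x.1).Coin}
    (hω : ∀ t x, x.1 ≠ a → ω t x = ω' t x) (t : ℕ) :
    (switching dev base (maskView view a)).adaptiveStream adv ω t =
      (switching dev base (maskView view a)).adaptiveStream adv ω' t := by
  induction t with
  | zero => rfl
  | succ t ih =>
    rw [StreamAlg.adaptiveStream, StreamAlg.adaptiveStream, ← ih]
    simp only [StreamAlg.outputs, maskView_outputAfter_eq hω]

lemma step_eq (c : (x : Inst L M × Bool) → (algOf dev x.1).Coin) (s : Memory L M dev) (u : Fin n) :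
    (switching dev base view).step c s u =
      s.close (s.read c u) c u (s.closeLevel base view (s.read c u)) := rfl

/-- Flagged blocks have been closed. -/
lemma isClosed_of_flag (ω : ℕ → (x : Inst L M × Bool) → (algOf dev x.1).Coin) (σ : List (Fin n))
    (i : Block L M) (h : ((switching dev base view).stateAfter ω σ).flag i = true) :
    ((switching dev base view).stateAfter ω σ).IsClosed i := by
  induction σ using List.reverseRecOn with
  | nil => simp [switching] at h
  | append_singleton σ u ih =>
    rw [StreamAlg.stateAfter_concat] at h ⊢
    rw [step_eq] at h ⊢
    generalize (switching dev base view).stateAfter ω σ = s at *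
    have hmono := s.cur_le_close_cur (s.read (ω (σ.length + 1)) u) (ω (σ.length + 1)) u
      (s.closeLevel base view (s.read (ω (σ.length + 1)) u)) i.1
    set j := s.closeLevel base view (s.read (ω (σ.length + 1)) u)
    have key : s.flag i = true ∨ (i.1 : ℕ) = j ∧ s.IsOpen i := by
      have := (s.close_flag_iff _ _ _ _ _).1 h
      tauto
    rcases key with hf | ⟨hj, ho⟩
    · exact (ih hf).trans_le hmono
    · have ho' : (s.cur i.1 : ℕ) = i.2 + 1 := ho
      have := s.close_cur_of_le (s.read (ω (σ.length + 1)) u) (ω (σ.length + 1)) u hj.ge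
        (by have := i.2.2; omega)
      unfold Memory.IsClosed
      omega

lemma isClosed_concat {ω : ℕ → (x : Inst L M × Bool) → (algOf dev x.1).Coin} {σ : List (Fin n)}
    {i : Block L M} (h : ((switching dev base view).stateAfter ω σ).IsClosed i) (u : Fin n) :
    ((switching dev base view).stateAfter ω (σ ++ [u])).IsClosed i := by
  rw [StreamAlg.stateAfter_concat, step_eq]
  exact h.trans_le (Memory.cur_le_close_cur _ _ _ _ _ _)

/-- Until the block of `a` is closed, replacing the outputs of `a` by `0` has no effect. -/
lemma maskView_stateAfter_eq (a : Inst L M) (ω : ℕ → (x : Inst L M × Bool) → (algOf dev x.1).Coin)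
    (σ : List (Fin n)) (h : ¬ ((switching dev base view).stateAfter ω σ).IsClosed a.1) :
    (switching dev base (maskView view a)).stateAfter ω σ =
      (switching dev base view).stateAfter ω σ := by
  induction σ using List.reverseRecOn with
  | nil => rfl
  | append_singleton σ u ih =>
    have ih := ih fun hc => h (isClosed_concat hc u)
    have hflag := isClosed_of_flag (base := base) (view := view) ω σ
    rw [StreamAlg.stateAfter_concat] at h ⊢
    rw [StreamAlg.stateAfter_concat]
    rw [ih]
    rw [step_eq] at h ⊢
    rw [step_eq]
    set c := ω (σ.length + 1)
    generalize hs : (switching dev base view).stateAfter ω σ = s at *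
    have hclosed : ¬ s.IsClosed a.1 := fun hc => h (hc.trans_le (Memory.cur_le_close_cur _ _ _ _ _ _))
    have hest : ∀ l, s.est base (maskView view a) l = s.est base view l := by
      refine Memory.est_congr rfl rfl fun i hi => maskView_of_ne ?_ _
      rintro rfl
      exact hclosed (hflag i hi)
    have hcl : s.closeLevel base (maskView view a) (s.read c u) =
        s.closeLevel base view (s.read c u) := by
      unfold Memory.closeLevel
      split_ifs with hf
      · rfl
      congr 1
      refine Memory.alarmLevel_congr fun i => and_congr_right fun ho => ?_
      by_cases hi : i = a.1
      -- An alarm of the block would close it in this very step, as the closing level is at most the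
      -- alarm level, and it is assumed not to be closed afterwards. So there is no alarm in the
      -- true run, and none in the masked one since `0` does not exceed the threshold.
      · have hno : ¬ s.Alarm base view (s.read c u) i := by
          intro hal
          apply h
          have h1 : s.alarmLevel base view (s.read c u) ≤ i.1 := Nat.sInf_le (Or.inr ⟨i, rfl, ho, hal⟩)
          have h2 := (s.closeLevel_le_alarmLevel (base := base) (view := view) (s.read c u)).trans h1
          have ho' : (s.cur i.1 : ℕ) = i.2 + 1 := ho
          have := s.close_cur_of_le (s.read c u) c u h2 (by have := i.2.2; omega)
          rw [← hi]
          unfold Memory.IsClosed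
          omega
        refine iff_of_false ?_ hno
        simp only [Memory.Alarm, not_or, not_lt, hest] at hno ⊢
        have h0 : 0 ≤ max (s.est base view i.1) 0 := le_max_right _ _
        constructor
        · by_cases hb : (i, true) = a
          · subst hb
            rw [maskView_self]
            positivity
          · rw [maskView_of_ne hb]; exact hno.1
        · by_cases hb : (i, false) = a
          · subst hb
            rw [maskView_self]
            positivity
          · rw [maskView_of_ne hb]; exact hno.2
      · have hb : ∀ b, (i, b) ≠ a := fun b hb => hi (congrArg Prod.fst hb)
        simp only [Memory.Alarm, hest, maskView_of_ne (hb _)]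
    rw [hcl]

lemma maskView_outputAfter (a : Inst L M) (ω : ℕ → (x : Inst L M × Bool) → (algOf dev x.1).Coin)
    (σ : List (Fin n)) (h : ¬ ((switching dev base view).stateAfter ω σ).IsClosed a.1) :
    (switching dev base (maskView view a)).outputAfter ω σ =
      (switching dev base view).outputAfter ω σ := by
  unfold StreamAlg.outputAfter
  rw [maskView_stateAfter_eq a ω σ h]
  refine Memory.est_congr rfl rfl (fun i hi => maskView_of_ne ?_ _) L
  rintro rfl
  exact h (isClosed_of_flag ω σ i hi)

lemma isClosed_of_take {ω : ℕ → (x : Inst L M × Bool) → (algOf dev x.1).Coin} {σ : List (Fin n)}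
    {i : Block L M} (s : ℕ) (h : ((switching dev base view).stateAfter ω (σ.take s)).IsClosed i) :
    ((switching dev base view).stateAfter ω σ).IsClosed i := by
  induction σ using List.reverseRecOn with
  | nil => simpa using h
  | append_singleton σ u ih =>
    rcases le_or_gt s σ.length with hs | hs
    · rw [List.take_append_of_le_length hs] at h
      exact isClosed_concat (ih h) u
    · rwa [List.take_of_length_le (by simp; omega)] at h

/-- The time is `t + 1` and not `t`: the next update depends only on outputs given while the block
was not yet closed. -/
lemma maskView_adaptiveStream (a : Inst L M) (adv : List ℝ → Fin n)
    (ω : ℕ → (x : Inst L M × Bool) → (algOf dev x.1).Coin) (t : ℕ)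
    (h : ¬ ((switching dev base view).stateAfter ω
      ((switching dev base view).adaptiveStream adv ω t)).IsClosed a.1) :
    (switching dev base (maskView view a)).adaptiveStream adv ω (t + 1) =
      (switching dev base view).adaptiveStream adv ω (t + 1) := by
  have key : (switching dev base (maskView view a)).adaptiveStream adv ω t =
      (switching dev base view).adaptiveStream adv ω t := by
    cases t with
    | zero => rfl
    | succ t =>
      refine maskView_adaptiveStream a adv ω t fun hc => h ?_
      rw [StreamAlg.adaptiveStream]
      exact isClosed_concat hc _
  rw [StreamAlg.adaptiveStream, StreamAlg.adaptiveStream, key]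
  congr 3
  refine List.map_congr_left fun i _ => maskView_outputAfter a ω _ fun hc => h ?_
  exact isClosed_of_take _ hc

/-- The coins that the instance `a` uses when the splitting time is `s`. -/
def splitCoins (s : ℕ) (a : Inst L M) (ω : ℕ → (x : Inst L M × Bool) → (algOf dev x.1).Coin)
    (r : ℕ) : (algOf dev a).Coin :=
  ω (if r ≤ s then r else r - 1) (a, decide (r = s + 1))

lemma splitCoins_of_le {s r : ℕ} (h : r ≤ s) (a : Inst L M)
    (ω : ℕ → (x : Inst L M × Bool) → (algOf dev x.1).Coin) :
    splitCoins s a ω r = ω r (a, false) := by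
  have hb : decide (r = s + 1) = false := by simp; omega
  unfold splitCoins
  generalize decide (r = s + 1) = b at *
  subst hb
  rw [if_pos h]

lemma splitCoins_succ (s : ℕ) (a : Inst L M)
    (ω : ℕ → (x : Inst L M × Bool) → (algOf dev x.1).Coin) :
    splitCoins s a ω (s + 1) = ω s (a, true) := by
  have hb : decide (s + 1 = s + 1) = true := by simp
  unfold splitCoins
  generalize decide (s + 1 = s + 1) = b at *
  subst hb
  rw [if_neg (by omega), Nat.add_sub_cancel]

lemma splitCoins_succ_of_lt {s r : ℕ} (h : s < r) (a : Inst L M)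
    (ω : ℕ → (x : Inst L M × Bool) → (algOf dev x.1).Coin) :
    splitCoins s a ω (r + 1) = ω r (a, false) := by
  have hb : decide (r + 1 = s + 1) = false := by simp; omega
  unfold splitCoins
  generalize decide (r + 1 = s + 1) = b at *
  subst hb
  rw [if_neg (by omega), Nat.add_sub_cancel]

lemma inst_of_cur_le (a : Inst L M) (ω : ℕ → (x : Inst L M × Bool) → (algOf dev x.1).Coin)
    (σ : List (Fin n))
    (h : (((switching dev base view).stateAfter ω σ).cur a.1.1 : ℕ) ≤ a.1.2) :
    ((switching dev base view).stateAfter ω σ).inst a =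
      (algOf dev a).stateAfter (fun r => ω r (a, false)) (σ.map some) := by
  induction σ using List.reverseRecOn with
  | nil => rfl
  | append_singleton σ u ih =>
    rw [List.map_append, List.map_singleton, (algOf dev a).stateAfter_concat, List.length_map]
    rw [StreamAlg.stateAfter_concat, step_eq] at h ⊢
    generalize (switching dev base view).stateAfter ω σ = s at *
    set c := ω (σ.length + 1)
    set j := s.closeLevel base view (s.read c u)
    have hle := (s.cur_le_close_cur (s.read c u) c u j a.1.1).trans h
    have hnew : ¬ (j ≤ a.1.1 ∧ (s.cur a.1.1 : ℕ) = a.1.2) := by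
      rintro ⟨h1, h2⟩
      have := s.close_cur_of_le (s.read c u) c u h1 (by have := a.1.2.2; omega)
      omega
    have hcl : ¬ s.IsClosed a.1 := by unfold Memory.IsClosed; omega
    rw [← ih hle]
    simp only [Memory.close, if_neg hnew, Memory.read, if_neg hcl]

/-- The block `i` is opened at time `s`. -/
def OpensAt (base : Fin n → ℝ) (view : (a : Inst L M) → (algOf dev a).State → ℝ)
    (i : Block L M) (ω : ℕ → (x : Inst L M × Bool) → (algOf dev x.1).Coin) (σ : List (Fin n))
    (s : ℕ) : Prop :=
  1 ≤ s ∧ s ≤ σ.length ∧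
    (((switching dev base view).stateAfter ω (σ.take s)).cur i.1 : ℕ) = i.2 + 1 ∧
    (((switching dev base view).stateAfter ω (σ.take (s - 1))).cur i.1 : ℕ) = i.2

lemma cur_mono (ω : ℕ → (x : Inst L M × Bool) → (algOf dev x.1).Coin) (σ : List (Fin n)) (s : ℕ)
    (l : Fin (L + 1)) :
    (((switching dev base view).stateAfter ω (σ.take s)).cur l : ℕ) ≤
      ((switching dev base view).stateAfter ω σ).cur l := by
  induction σ using List.reverseRecOn with
  | nil => simp
  | append_singleton σ u ih =>
    rcases le_or_gt s σ.length with hs | hs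
    · rw [List.take_append_of_le_length hs, StreamAlg.stateAfter_concat, step_eq]
      exact ih.trans (Memory.cur_le_close_cur _ _ _ _ _ _)
    · rw [List.take_of_length_le (by simp; omega)]

lemma cur_mono' (ω : ℕ → (x : Inst L M × Bool) → (algOf dev x.1).Coin) (σ : List (Fin n)) {s t : ℕ}
    (h : s ≤ t) (l : Fin (L + 1)) :
    (((switching dev base view).stateAfter ω (σ.take s)).cur l : ℕ) ≤
      ((switching dev base view).stateAfter ω (σ.take t)).cur l := by
  have := cur_mono (base := base) (view := view) ω (σ.take t) s l
  rwa [List.take_take, min_eq_left h] at this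

lemma OpensAt.unique {i : Block L M} {ω : ℕ → (x : Inst L M × Bool) → (algOf dev x.1).Coin}
    {σ : List (Fin n)} {s s' : ℕ} (h : OpensAt base view i ω σ s) (h' : OpensAt base view i ω σ s') :
    s = s' := by
  by_contra hne
  rcases Nat.lt_or_gt_of_ne hne with hlt | hlt
  · have := cur_mono' (base := base) (view := view) ω σ (show s ≤ s' - 1 by omega) i.1
    have := h.2.2.1
    have := h'.2.2.2
    omega
  · have := cur_mono' (base := base) (view := view) ω σ (show s' ≤ s - 1 by omega) i.1
    have := h'.2.2.1
    have := h.2.2.2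
    omega

/-- The hypothesis asks that the block is open before the last update, so that update may close it.
Closing freezes only the later states; the reading that raises the alarm is thus still one of an
honest run on the split stream. -/
lemma inst_of_opensAt (a : Inst L M) (ω : ℕ → (x : Inst L M × Bool) → (algOf dev x.1).Coin)
    (σ : List (Fin n)) (s : ℕ) (hs : OpensAt base view a.1 ω σ s)
    (h : s = σ.length ∨ (((switching dev base view).stateAfter ω
      (σ.take (σ.length - 1))).cur a.1.1 : ℕ) = a.1.2 + 1) :
    ((switching dev base view).stateAfter ω σ).inst a =
      (algOf dev a).stateAfter (splitCoins s a ω) (splitStream (σ.take s) (σ.drop s)) := by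
  induction σ using List.reverseRecOn with
  | nil => exact absurd hs.2.1 (by have := hs.1; simp; omega)
  | append_singleton σ u ih =>
    obtain ⟨h1, h2, h3, h4⟩ := hs
    rcases Nat.lt_or_ge σ.length s with hlt | hle
    · have hsl : s = σ.length + 1 := by simp at h2; omega
      subst hsl
      rw [Nat.add_sub_cancel, List.take_left] at h4
      rw [List.take_of_length_le (by simp)] at h3
      have hi := inst_of_cur_le a ω σ h4.le
      rw [List.take_of_length_le (by simp), List.drop_of_length_le (by simp), splitStream_nil,
        (algOf dev a).stateAfter_concat, List.map_append, List.map_singleton,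
        (algOf dev a).stateAfter_concat]
      rw [(algOf dev a).stateAfter_congr (ω' := fun r => ω r (a, false)) _ fun t ht => by
        have ht : t ≤ σ.length + 1 := by simp at ht; omega
        exact splitCoins_of_le ht a ω, ← hi]
      rw [StreamAlg.stateAfter_concat, step_eq] at h3 ⊢
      generalize (switching dev base view).stateAfter ω σ = S at *
      have hcl : ¬ S.IsClosed a.1 := by unfold Memory.IsClosed; omega
      have hj : S.closeLevel base view (S.read (ω (σ.length + 1)) u) ≤ a.1.1 := by
        by_contra hj
        rw [Memory.close_cur_of_lt _ _ _ _ (not_le.1 hj)] at h3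
        omega
      simp only [Memory.close, if_pos (And.intro hj h4), Memory.read, if_neg hcl]
      simp only [List.length_append, List.length_map, List.length_singleton]
      rw [splitCoins_succ, splitCoins_of_le le_rfl]
    · rw [List.take_append_of_le_length hle] at h3 ⊢
      rw [List.take_append_of_le_length (by omega)] at h4
      have hcur : (((switching dev base view).stateAfter ω σ).cur a.1.1 : ℕ) = a.1.2 + 1 := by
        rcases h with h | h
        · simp at h; omega
        · simpa using h
      have hi := ih ⟨h1, hle, h3, h4⟩ (by
        rcases Nat.eq_or_lt_of_le hle with h | h
        · exact Or.inl h
        · refine Or.inr (le_antisymm ((cur_mono ω σ _ _).trans hcur.le) (h3.ge.trans ?_))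
          exact cur_mono' ω σ (by omega) _)
      rw [List.drop_append_of_le_length hle, splitStream_concat, (algOf dev a).stateAfter_concat,
        ← hi, StreamAlg.stateAfter_concat, step_eq]
      generalize (switching dev base view).stateAfter ω σ = S at *
      have hcl : ¬ S.IsClosed a.1 := by unfold Memory.IsClosed; omega
      simp only [Memory.close, Memory.read, if_neg hcl]
      rw [if_neg (by omega)]
      have hlen : (splitStream (List.take s σ) (List.drop s σ)).length + 1 = σ.length + 2 := by
        simp; omega
      rw [hlen, splitCoins_succ_of_lt (by omega)]

end Switching

/-! ### Oblivious guarantees hold against adaptive adversaries -/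

section Switching

variable {n : ℕ} {L : ℕ} {M : ℕ → ℕ} {dev : ℕ → Bool → StreamAlg (Option (Fin n))}
  {base : Fin n → ℝ}

/-- The outputs of the instances. -/
abbrev instOutput (a : Inst L M) (x : (algOf dev a).State) : ℝ := (algOf dev a).output x

/-- While its block is open, the instance `a` satisfies its specification on the stream `σ`. -/
def GoodOn (base : Fin n → ℝ) (spec : ℕ → Bool → List (Fin n) → List (Fin n) → ℝ → Prop)
    (ω : ℕ → (x : Inst L M × Bool) → (algOf dev x.1).Coin) (σ : List (Fin n)) (a : Inst L M) :
    Prop :=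
  ∀ s t, OpensAt base instOutput a.1 ω σ s → s < t → t ≤ σ.length →
    (((switching dev base instOutput).stateAfter ω (σ.take (t - 1))).cur a.1.1 : ℕ) = a.1.2 + 1 →
    spec a.1.1 a.2 (σ.take s) ((σ.take t).drop s)
      (instOutput a (((switching dev base instOutput).stateAfter ω (σ.take t)).inst a))

/-- The coins for which the instance `a` violates its specification in the run in which its outputs
are replaced by `0`. -/
def maskedBad (base : Fin n → ℝ) (spec : ℕ → Bool → List (Fin n) → List (Fin n) → ℝ → Prop)
    (m : ℕ) (adv : List ℝ → Fin n) (a : Inst L M) :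
    Set (ℕ → (x : Inst L M × Bool) → (algOf dev x.1).Coin) :=
  {ω | let σ := (switching dev base (maskView instOutput a)).adaptiveStream adv ω m
    ∃ s, OpensAt base (maskView instOutput a) a.1 ω σ s ∧
      splitCoins s a ω ∉ goodCoins (spec a.1.1 a.2) (algOf dev a) (σ.take s) (σ.drop s)}

/-- Up to time `t - 1` the block is not closed, so the true and the masked run have the same states,
and update `t` was chosen from the same outputs. The streams agree up to `t`, and together with the
coins of `a` they determine its state then. -/
lemma mem_maskedBad_of_not_goodOn
    {spec : ℕ → Bool → List (Fin n) → List (Fin n) → ℝ → Prop} {m : ℕ} {adv : List ℝ → Fin n}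
    {a : Inst L M} {ω : ℕ → (x : Inst L M × Bool) → (algOf dev x.1).Coin}
    (h : ¬ GoodOn base spec ω ((switching dev base instOutput).adaptiveStream adv ω m) a) :
    ω ∈ maskedBad base spec m adv a := by
  simp only [GoodOn, not_forall] at h
  obtain ⟨s, t, hs, hst, htm, hopen, hbad⟩ := h
  rw [StreamAlg.adaptiveStream_length] at htm
  have hnc : ∀ r ≤ t - 1, ¬ ((switching dev base instOutput).stateAfter ω
      ((switching dev base instOutput).adaptiveStream adv ω r)).IsClosed a.1 := by
    intro r hr hc
    have := cur_mono' (base := base) (view := instOutput) ω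
      ((switching dev base instOutput).adaptiveStream adv ω m) hr a.1.1
    rw [StreamAlg.take_adaptiveStream _ _ _ (by omega)] at this
    unfold Memory.IsClosed at hc
    omega
  have hstream : ∀ r ≤ t, (switching dev base (maskView instOutput a)).adaptiveStream adv ω r =
      (switching dev base instOutput).adaptiveStream adv ω r := by
    intro r hr
    cases r with
    | zero => rfl
    | succ r => exact maskView_adaptiveStream a adv ω r (hnc r (by omega))
  have hstate : ∀ r ≤ t - 1, (switching dev base (maskView instOutput a)).stateAfter ω
      (((switching dev base (maskView instOutput a)).adaptiveStream adv ω m).take r) =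
      (switching dev base instOutput).stateAfter ω
        (((switching dev base instOutput).adaptiveStream adv ω m).take r) := by
    intro r hr
    rw [StreamAlg.take_adaptiveStream _ _ _ (by omega), hstream r (by omega),
      StreamAlg.take_adaptiveStream _ _ _ (by omega)]
    exact maskView_stateAfter_eq a ω _ (hnc r hr)
  have htake : ∀ r ≤ t, ((switching dev base (maskView instOutput a)).adaptiveStream adv ω m).take r
      = ((switching dev base instOutput).adaptiveStream adv ω m).take r := by
    intro r hr
    rw [StreamAlg.take_adaptiveStream _ _ _ (by omega), hstream r hr,
      StreamAlg.take_adaptiveStream _ _ _ (by omega)]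
  refine ⟨s, ⟨hs.1, by simp; omega, ?_, ?_⟩, fun hgood => hbad ?_⟩
  · rw [hstate s (by omega)]; exact hs.2.2.1
  · rw [hstate (s - 1) (by omega)]; exact hs.2.2.2
  · have := hgood (t - s) (by omega) (by simp; omega)
    rw [← List.drop_take, htake s hst.le, htake t le_rfl] at this
    rw [inst_of_opensAt a ω _ s]
    · rwa [List.take_take, min_eq_left hst.le]
    · refine ⟨hs.1, by simp; omega, ?_, ?_⟩
      · rw [List.take_take, min_eq_left hst.le]; exact hs.2.2.1
      · rw [List.take_take, min_eq_left (by omega)]; exact hs.2.2.2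
    · right
      rw [List.length_take, StreamAlg.adaptiveStream_length, min_eq_left htm, List.take_take,
        min_eq_left (by omega)]
      exact hopen

lemma maskedBad_of_agree {spec : ℕ → Bool → List (Fin n) → List (Fin n) → ℝ → Prop} {m : ℕ}
    {adv : List ℝ → Fin n} {a : Inst L M}
    {ω ω' : ℕ → (x : Inst L M × Bool) → (algOf dev x.1).Coin} (h : ∀ t ≤ m + 1, ω t = ω' t)
    (hω : ω ∈ maskedBad base spec m adv a) : ω' ∈ maskedBad base spec m adv a := by
  have hstream := (switching dev base (maskView instOutput a)).adaptiveStream_congr adv m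
    fun t ht => h t (by omega)
  obtain ⟨s, ⟨h1, h2, h3, h4⟩, hbad⟩ := hω
  have h2' := h2
  rw [StreamAlg.adaptiveStream_length] at h2'
  rw [hstream] at h2 h3 h4 hbad
  rw [StreamAlg.stateAfter_congr _ _ fun t ht => h t (by simp at ht; omega)] at h3 h4
  refine ⟨s, ⟨h1, h2, h3, h4⟩, fun hgood => hbad (goodCoins_of_agree (fun t ht => ?_) hgood)⟩
  have ht : t ≤ m + 1 := by simp at ht; omega
  simp only [splitCoins]
  rw [h _ (by split_ifs <;> omega)]

lemma measurePreserving_splitCoins (s : ℕ) (a : Inst L M) :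
    MeasurePreserving (fun (ω : (x : (_ : ℕ) × (Inst L M × Bool)) → (algOf dev x.2.1).Coin) =>
      splitCoins s a fun t x => ω ⟨t, x⟩) (coinField L M dev) (algOf dev a).coinLaw := by
  have hf : Function.Injective fun r : ℕ =>
      (⟨if r ≤ s then r else r - 1, (a, decide (r = s + 1))⟩ : (_ : ℕ) × (Inst L M × Bool)) := by
    intro r r' h
    simp only [Sigma.mk.injEq, heq_eq_eq, Prod.mk.injEq, true_and, decide_eq_decide] at h
    obtain ⟨h1, h2⟩ := h
    split_ifs at h1 <;> omega
  refine ⟨measurable_pi_lambda _ fun r => measurable_pi_apply _, ?_⟩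
  exact Measure.map_infinitePi_infinitePi_of_inj
    (P := fun x : (_ : ℕ) × (Inst L M × Bool) => (algOf dev x.2.1).coinDist.toMeasure) hf

/-- When all coins except those of `a` are fixed, the masked run has a fixed stream and a fixed
splitting time. The coins of `a` are fresh, so its oblivious guarantee bounds every section of the
event. -/
lemma coinField_maskedBad_le {spec : ℕ → Bool → List (Fin n) → List (Fin n) → ℝ → Prop} {m : ℕ}
    {δ : ℝ} (adv : List ℝ → Fin n) (a : Inst L M)
    (hspec : Satisfies (spec a.1.1 a.2) m δ (algOf dev a)) :
    coinField L M dev {ω | (fun t x => ω ⟨t, x⟩) ∈ maskedBad base spec m adv a} ≤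
      ENNReal.ofReal δ := by
  refine infinitePi_le_of_forall_mixCoords _ {x | x.2.1 = a} ?_ fun x => ?_
  · refine measurableSet_of_dependsOn_finset
      ((Finset.range (m + 2)).sigma fun _ => Finset.univ) _ fun ω ω' h hω => ?_
    exact maskedBad_of_agree (fun t ht => funext fun x => h ⟨t, x⟩ (by simp; omega)) hω
  · have hoff : ∀ y : (x : (_ : ℕ) × (Inst L M × Bool)) → (algOf dev x.2.1).Coin,
        ∀ t (z : Inst L M × Bool), z.1 ≠ a →
          mixCoords {x | x.2.1 = a} x y ⟨t, z⟩ = x ⟨t, z⟩ := by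
      intro y t z hz
      simp [mixCoords, hz]
    set σ := (switching dev base (maskView instOutput a)).adaptiveStream adv (fun t z => x ⟨t, z⟩) m
      with hσ
    have hσl : σ.length = m := StreamAlg.adaptiveStream_length _ _ _ _
    have hstream : ∀ y, (switching dev base (maskView instOutput a)).adaptiveStream adv
        (fun t z => mixCoords {x | x.2.1 = a} x y ⟨t, z⟩) m = σ :=
      fun y => maskView_adaptiveStream_eq adv (hoff y) m
    have hopen : ∀ y s, OpensAt base (maskView instOutput a) a.1
        (fun t z => mixCoords {x | x.2.1 = a} x y ⟨t, z⟩) σ s ↔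
        OpensAt base (maskView instOutput a) a.1 (fun t z => x ⟨t, z⟩) σ s := by
      intro y s
      unfold OpensAt
      rw [(eqOff_stateAfter (hoff y) _).cur, (eqOff_stateAfter (hoff y) _).cur]
    have hcoins : ∀ y s, splitCoins s a (fun t z => mixCoords {x | x.2.1 = a} x y ⟨t, z⟩) =
        splitCoins s a (fun t z => y ⟨t, z⟩) := by
      intro y s
      funext r
      simp [splitCoins, mixCoords]
    by_cases hex : ∃ s, OpensAt base (maskView instOutput a) a.1 (fun t z => x ⟨t, z⟩) σ s
    · obtain ⟨s, hs⟩ := hex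
      have hg := hspec (σ.take s) (σ.drop s) (by
        have := hs.1
        have := hs.2.1
        rw [← List.length_pos_iff, List.length_take]
        omega) (by simp; omega)
      have hmeas := measurableSet_goodCoins (spec a.1.1 a.2) (algOf dev a) (σ.take s) (σ.drop s)
      have hbad : (algOf dev a).coinLaw
          (goodCoins (spec a.1.1 a.2) (algOf dev a) (σ.take s) (σ.drop s))ᶜ ≤ ENNReal.ofReal δ := by
        rw [← ofReal_measureReal, probReal_compl_eq_one_sub hmeas]
        exact ENNReal.ofReal_le_ofReal (by linarith)
      refine le_trans ?_ hbad
      rw [← (measurePreserving_splitCoins (dev := dev) s a).measure_preimage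
        hmeas.compl.nullMeasurableSet]
      refine measure_mono fun y hy => ?_
      obtain ⟨s', hs', hb⟩ := hy
      rw [hstream, hopen] at hs'
      rw [hstream, hs'.unique hs, hcoins] at hb
      exact hb
    -- If the block is never opened, the section is empty.
    · convert zero_le (a := ENNReal.ofReal δ)
      rw [← nonpos_iff_eq_zero, ← measure_empty (μ := coinField L M dev)]
      refine measure_mono fun y hy => hex ?_
      obtain ⟨s', hs', -⟩ := hy
      rw [hstream, hopen] at hs'
      exact ⟨s', hs'⟩

/-- With high probability all instances satisfy their specifications on the stream of the
adversary. -/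
lemma le_coinLaw_of_forall_goodOn {spec : ℕ → Bool → List (Fin n) → List (Fin n) → ℝ → Prop}
    {m : ℕ} {δ p : ℝ} (hδ : 0 ≤ δ) (adv : List ℝ → Fin n)
    (hspec : ∀ a : Inst L M, Satisfies (spec a.1.1 a.2) m δ (algOf dev a))
    (hp : Nat.card (Inst L M) * δ ≤ 1 - p)
    (E : Set (ℕ → (x : Inst L M × Bool) → (algOf dev x.1).Coin))
    (hE : ∀ ω, (∀ a : Inst L M, GoodOn base spec ω
      ((switching dev base instOutput).adaptiveStream adv ω m) a) → ω ∈ E) :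
    p ≤ (switching dev base instOutput).coinLaw.real E := by
  have hbad : coinField L M dev (⋃ a : Inst L M,
      {ω | (fun t x => ω ⟨t, x⟩) ∈ maskedBad base spec m adv a}) ≤ ENNReal.ofReal (1 - p) := by
    refine (measure_iUnion_fintype_le _ _).trans ?_
    refine (Finset.sum_le_sum fun a _ => coinField_maskedBad_le adv a (hspec a)).trans ?_
    rw [Finset.sum_const, nsmul_eq_mul, Finset.card_univ, ← Nat.card_eq_fintype_card,
      ← ENNReal.ofReal_natCast, ← ENNReal.ofReal_mul (by positivity)]
    exact ENNReal.ofReal_le_ofReal hp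
  -- `E` may be nonmeasurable, so the whole space is covered by the bad events and `E` instead of
  -- passing to complements.
  have hone : (1 : ENNReal) ≤ ENNReal.ofReal (1 - p) + (switching dev base instOutput).coinLaw E := by
    rw [← measure_univ (μ := coinField L M dev)]
    refine le_trans (measure_mono (t := (⋃ a : Inst L M,
      {ω | (fun t x => ω ⟨t, x⟩) ∈ maskedBad base spec m adv a}) ∪
        (fun ω t x => ω ⟨t, x⟩) ⁻¹' E) fun ω _ => ?_)
      ((measure_union_le _ _).trans (add_le_add hbad (coinField_preimage_le dev base instOutput E)))
    by_cases h : ∀ a : Inst L M, GoodOn base spec (fun t x => ω ⟨t, x⟩)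
      ((switching dev base instOutput).adaptiveStream adv (fun t x => ω ⟨t, x⟩) m) a
    · exact Or.inr (hE _ h)
    · obtain ⟨a, ha⟩ := not_forall.1 h
      exact Or.inl (Set.mem_iUnion.2 ⟨a, mem_maskedBad_of_not_goodOn ha⟩)
  have hp0 : 0 ≤ 1 - p := le_trans (by positivity) hp
  rw [← ofReal_measureReal, ← ENNReal.ofReal_add hp0 measureReal_nonneg,
    ← ENNReal.ofReal_one, ENNReal.ofReal_le_ofReal_iff (by positivity)] at hone
  linarith

end Switching

/-! ### Twist sequences and numerical estimates for alarms -/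

section Values

variable {n : ℕ} {F : (Fin n → ℕ) → ℝ}

lemma freq_le_of_sublist {v w : List (Fin n)} (h : v.Sublist w) : freq v ≤ freq w :=
  fun i => h.count_le i

lemma le_twistNumber {ε : ℝ} {σ : List (Fin n)} {k : ℕ} {i : Fin k → ℕ}
    (h : IsTwistSequence F ε σ i) : k ≤ twistNumber F ε σ := by
  refine le_csSup ⟨σ.length + 1, ?_⟩ ⟨i, h⟩
  rintro k ⟨i, hi⟩
  have := Fintype.card_le_of_injective (fun j => (⟨i j, Nat.lt_succ_of_le (hi.2.1 j)⟩ :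
    Fin (σ.length + 1))) fun a b hab => hi.1.injective (by simpa using hab)
  simpa using this

/-- The twist is observed since `p`, which may be later than the last time of the sequence. By
monotonicity an earlier starting time has a smaller prefix value and a larger suffix value, so
either kind of twist persists. -/
lemma IsTwistSequence.snoc (hF : Monotone F) {η : ℝ} (h0 : 0 ≤ η) {σ : List (Fin n)} {x : ℕ}
    {i : Fin (x + 1) → ℕ} (h : IsTwistSequence F η σ i) {p q : ℕ} (hp : ∀ j, i j ≤ p) (hpq : p < q)
    (hq : q ≤ σ.length)
    (htw : F (freq (σ.take p)) < (1 - η) * F (freq (σ.take q)) ∨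
      η * F (freq (σ.take p)) ≤ F (freq ((σ.take q).drop p))) :
    IsTwistSequence F η σ (Fin.snoc i q : Fin (x + 1 + 1) → ℕ) := by
  refine ⟨?_, ?_, ?_⟩
  · rw [Fin.strictMono_iff_lt_succ]
    intro j
    refine Fin.lastCases ?_ (fun j => ?_) j
    · rw [Fin.snoc_castSucc, Fin.succ_last, Fin.snoc_last]
      exact (hp _).trans_lt hpq
    · rw [Fin.snoc_castSucc, Fin.succ_castSucc, Fin.snoc_castSucc]
      exact h.1 Fin.castSucc_lt_succ
  · intro j
    refine Fin.lastCases ?_ (fun j => ?_) j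
    · rwa [Fin.snoc_last]
    · rw [Fin.snoc_castSucc]; exact h.2.1 j
  · intro j hj
    rcases Nat.lt_or_ge (j + 1) (x + 1) with hlt | hge
    · have h1 : (Fin.snoc i q : Fin (x + 1 + 1) → ℕ) ⟨j, Nat.lt_of_succ_lt hj⟩ =
          i ⟨j, Nat.lt_of_succ_lt hlt⟩ := Fin.snoc_castSucc (α := fun _ => ℕ) q i ⟨j, _⟩
      have h2 : (Fin.snoc i q : Fin (x + 1 + 1) → ℕ) ⟨j + 1, hj⟩ = i ⟨j + 1, hlt⟩ :=
        Fin.snoc_castSucc (α := fun _ => ℕ) q i ⟨j + 1, _⟩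
      simp only [h1, h2]
      exact h.2.2 j hlt
    · have hjx : j = x := by omega
      subst hjx
      have h1 : (Fin.snoc i q : Fin (j + 1 + 1) → ℕ) ⟨j, Nat.lt_of_succ_lt hj⟩ =
          i (Fin.last j) := Fin.snoc_castSucc (α := fun _ => ℕ) q i (Fin.last j)
      have h2 : (Fin.snoc i q : Fin (j + 1 + 1) → ℕ) ⟨j + 1, hj⟩ = q :=
        Fin.snoc_last (α := fun _ => ℕ) q i
      simp only [h1, h2]
      have hle : F (freq (σ.take (i (Fin.last j)))) ≤ F (freq (σ.take p)) :=
        hF (freq_le_of_sublist (List.take_sublist_take_left (hp _)))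
      rcases htw with htw | htw
      · left
        intro hmem
        linarith [hmem.1]
      · right
        refine (mul_le_mul_of_nonneg_left hle h0).trans (htw.trans (hF (freq_le_of_sublist ?_)))
        -- `substream` includes the update at its starting time, so it drops one update fewer.
        exact List.drop_sublist_drop_left _ ((Nat.sub_le _ _).trans (hp _))

end Values

section Estimates

variable {γ e E err x y v d : ℝ}

/-- If a device that reports the difference is silent, then the value has grown only little. -/
lemma small_of_silent_difference (hx : 0 ≤ x) (he : e ≤ γ / 32) (hγ : 0 < γ)
    (hE : |E - x| ≤ err * x) (herr : err ≤ 1 / 32) (hd : |d - (y - x)| ≤ e * x)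
    (hs : d ≤ γ / 4 * max E 0) : y - x ≤ γ / 2 * x := by
  have h1 : err * x ≤ 1 / 32 * x := mul_le_mul_of_nonneg_right herr hx
  have h2 : e * x ≤ γ / 32 * x := mul_le_mul_of_nonneg_right he hx
  have h3 : max E 0 ≤ 33 / 32 * x := max_le (by linarith [(abs_le.1 hE).2]) (by positivity)
  have h4 : γ / 4 * max E 0 ≤ γ / 4 * (33 / 32 * x) := mul_le_mul_of_nonneg_left h3 (by positivity)
  have h5 : 0 ≤ γ * x := by positivity
  linarith [(abs_le.1 hd).1]

lemma small_of_silent_value (hx : 0 ≤ x) (hy : 0 ≤ y) (he : e ≤ 1 / 32)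
    (hE : |E - x| ≤ err * x) (herr : err ≤ 1 / 32) (hd : |d - y| ≤ e * y)
    (hs : d ≤ (1 + 1 / 4) * max E 0) : y - x ≤ 1 / 2 * x := by
  have h1 : err * x ≤ 1 / 32 * x := mul_le_mul_of_nonneg_right herr hx
  have h2 : e * y ≤ 1 / 32 * y := mul_le_mul_of_nonneg_right he hy
  have h3 : max E 0 ≤ 33 / 32 * x := max_le (by linarith [(abs_le.1 hE).2]) (by positivity)
  linarith [(abs_le.1 hd).1]

lemma small_of_silent_suffix (hx : 0 ≤ x) (hγ : 0 < γ)
    (hE : |E - x| ≤ err * x) (herr : err ≤ 1 / 32) (hd : |d - y| ≤ 1 / 4 * y)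
    (hs : d ≤ γ / 4 * max E 0) : y ≤ γ / 2 * x := by
  have h1 : err * x ≤ 1 / 32 * x := mul_le_mul_of_nonneg_right herr hx
  have h3 : max E 0 ≤ 33 / 32 * x := max_le (by linarith [(abs_le.1 hE).2]) (by positivity)
  have h4 : γ / 4 * max E 0 ≤ γ / 4 * (33 / 32 * x) := mul_le_mul_of_nonneg_left h3 (by positivity)
  have h5 : 0 ≤ γ * x := by positivity
  linarith [(abs_le.1 hd).1]

/-- The reason is `(1 - γ/16) (1 + γ/8) ≥ 1` for `γ ≤ 1`. -/
lemma lt_of_growth (hx : 0 ≤ x) (hγ : 0 < γ) (hγ1 : γ ≤ 1) (h : (1 + γ / 8) * x < y) :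
    x < (1 - γ / 16) * y := by
  have h1 : (1 - γ / 16) * ((1 + γ / 8) * x) < (1 - γ / 16) * y :=
    mul_lt_mul_of_pos_left h (by linarith)
  have h2 : 0 ≤ γ * (1 - γ) * x := by
    have : 0 ≤ 1 - γ := by linarith
    positivity
  have h3 : 0 ≤ γ * x := by positivity
  nlinarith

/-- The threshold is at least `31/128 · γ x` and the reading is off by at most `4/128 · γ x`; the
remaining growth of `27/128 · γ x` exceeds `γ/8 · x`. -/
lemma twist_of_alarm_difference (hx : 0 ≤ x) (he : e ≤ γ / 32) (hγ : 0 < γ) (hγ1 : γ ≤ 1)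
    (hE : |E - x| ≤ err * x) (herr : err ≤ 1 / 32) (hd : |d - (y - x)| ≤ e * x)
    (hs : γ / 4 * max E 0 < d) : x < (1 - γ / 16) * y := by
  have h1 : err * x ≤ 1 / 32 * x := mul_le_mul_of_nonneg_right herr hx
  have h2 : e * x ≤ γ / 32 * x := mul_le_mul_of_nonneg_right he hx
  have h3 : 31 / 32 * x ≤ max E 0 := le_max_of_le_left (by linarith [(abs_le.1 hE).1])
  have h4 : γ / 4 * (31 / 32 * x) ≤ γ / 4 * max E 0 := mul_le_mul_of_nonneg_left h3 (by positivity)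
  have h5 : 0 ≤ γ * x := by positivity
  exact lt_of_growth hx hγ hγ1 (by linarith [(abs_le.1 hd).2])

lemma twist_of_alarm_value (hx : 0 ≤ x) (hy : 0 ≤ y) (he : e ≤ 1 / 32)
    (hE : |E - x| ≤ err * x) (herr : err ≤ 1 / 32) (hd : |d - y| ≤ e * y)
    (hs : (1 + 1 / 4) * max E 0 < d) : x < (1 - 1 / 16) * y := by
  have h1 : err * x ≤ 1 / 32 * x := mul_le_mul_of_nonneg_right herr hx
  have h2 : e * y ≤ 1 / 32 * y := mul_le_mul_of_nonneg_right he hy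
  have h3 : 31 / 32 * x ≤ max E 0 := le_max_of_le_left (by linarith [(abs_le.1 hE).1])
  exact lt_of_growth hx one_pos le_rfl (by linarith [(abs_le.1 hd).2])

lemma twist_of_alarm_suffix (hx : 0 ≤ x) (hγ : 0 < γ)
    (hE : |E - x| ≤ err * x) (herr : err ≤ 1 / 32) (hd : |d - y| ≤ 1 / 4 * y)
    (hs : γ / 4 * max E 0 < d) : γ / 16 * x ≤ y := by
  have h1 : err * x ≤ 1 / 32 * x := mul_le_mul_of_nonneg_right herr hx
  have h3 : 31 / 32 * x ≤ max E 0 := le_max_of_le_left (by linarith [(abs_le.1 hE).1])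
  have h4 : γ / 4 * (31 / 32 * x) ≤ γ / 4 * max E 0 := mul_le_mul_of_nonneg_left h3 (by positivity)
  have h5 : 0 ≤ γ * x := by positivity
  linarith [(abs_le.1 hd).2]

end Estimates

/-! ### How closing a level changes flags and estimates -/

section Flags

variable {n : ℕ} {L : ℕ} {M : ℕ → ℕ} {dev : ℕ → Bool → StreamAlg (Option (Fin n))}
  {base : Fin n → ℝ} {view : (a : Inst L M) → (algOf dev a).State → ℝ}

namespace Memory

lemma IsOpen.eq_of_level_eq {s : Memory L M dev} {i o : Block L M} (hi : s.IsOpen i)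
    (ho : s.IsOpen o) (h : (i.1 : ℕ) = o.1) : i = o := by
  obtain ⟨l, k⟩ := i
  obtain ⟨l', k'⟩ := o
  obtain rfl : l = l' := Fin.ext h
  unfold IsOpen at hi ho
  simp only at hi ho
  obtain rfl : k = k' := Fin.ext (by omega)
  rfl

lemma flagCount_eq_zero_of_lt (flag : Block L M → Bool) {l : ℕ} (h : L < l) :
    flagCount flag l = 0 := by
  rw [flagCount, Finset.card_eq_zero, Finset.filter_eq_empty_iff]
  rintro i - ⟨-, hi⟩
  have := i.1.2
  omega

variable {s : Memory L M dev} {st : (a : Inst L M) → (algOf dev a).State}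
  {c : (x : Inst L M × Bool) → (algOf dev x.1).Coin} {u : Fin n} {j : ℕ}

lemma flagSum_close_of_lt (w : Block L M → ℝ) {l : ℕ} (h : l < j) :
    flagSum (s.close st c u j).flag w l = flagSum s.flag w l := by
  unfold flagSum
  congr 1
  refine Finset.filter_congr fun i _ => ?_
  rw [close_flag_iff]
  constructor
  · rintro ⟨h1 | h1, h2⟩
    · exact ⟨h1.2, h2⟩
    · omega
  · rintro ⟨h1, h2⟩
    exact ⟨Or.inl ⟨by omega, h1⟩, h2⟩

/-- No flags finer than `j` survive the closing, so the sum is the same for all `l ≥ j`. -/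
lemma flagSum_close_of_le {o : Block L M} (ho : s.IsOpen o) (hoj : (o.1 : ℕ) = j)
    (hof : s.flag o ≠ true) (w : Block L M → ℝ) {l : ℕ} (h : j ≤ l) :
    flagSum (s.close st c u j).flag w l =
      (if j = 0 then 0 else flagSum s.flag w j) + w o := by
  have hmem : ∀ i, ((s.close st c u j).flag i = true ∧ (i.1 : ℕ) ≤ l) ↔
      (i = o ∨ (j ≠ 0 ∧ s.flag i = true ∧ (i.1 : ℕ) ≤ j)) := by
    intro i
    rw [close_flag_iff]
    constructor
    · rintro ⟨h1 | ⟨h1, h2 | h2⟩, h3⟩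
      · exact Or.inr ⟨by omega, h1.2, h1.1.le⟩
      · exact Or.inl (h2.eq_of_level_eq ho (h1.trans hoj.symm))
      · exact Or.inr ⟨h2.2, h2.1, h1.le⟩
    · rintro (rfl | ⟨h1, h2, h3⟩)
      · exact ⟨Or.inr ⟨hoj, Or.inl ho⟩, hoj.trans_le h⟩
      · refine ⟨?_, h3.trans h⟩
        rcases h3.lt_or_eq with h3 | h3
        · exact Or.inl ⟨h3, h2⟩
        · exact Or.inr ⟨h3, Or.inr ⟨h2, h1⟩⟩
  classical
  unfold flagSum
  split_ifs with hj
  · have : Finset.univ.filter (fun i => (s.close st c u j).flag i = true ∧ (i.1 : ℕ) ≤ l) = {o} := by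
      ext i; simp only [Finset.mem_filter, Finset.mem_univ, true_and, hmem]; simp [hj]
    rw [this]; simp
  · have : Finset.univ.filter (fun i => (s.close st c u j).flag i = true ∧ (i.1 : ℕ) ≤ l) =
        insert o (Finset.univ.filter fun i => s.flag i = true ∧ (i.1 : ℕ) ≤ j) := by
      ext i; simp only [Finset.mem_filter, Finset.mem_univ, true_and, hmem]; simp [hj]
    rw [this, Finset.sum_insert (by simp [hof]), add_comm]

lemma flagCount_close_of_lt {l : ℕ} (h : l < j) :
    flagCount (s.close st c u j).flag l = flagCount s.flag l := by
  unfold flagCount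
  congr 1
  refine Finset.filter_congr fun i _ => ?_
  rw [close_flag_iff]
  constructor
  · rintro ⟨h1 | h1, h2⟩
    · exact ⟨h1.2, h2⟩
    · omega
  · rintro ⟨h1, h2⟩
    exact ⟨Or.inl ⟨by omega, h1⟩, h2⟩

lemma flagCount_close_of_gt {l : ℕ} (h : j < l) :
    flagCount (s.close st c u j).flag l = 0 := by
  rw [flagCount, Finset.card_eq_zero, Finset.filter_eq_empty_iff]
  rintro i - ⟨h1, h2⟩
  rw [close_flag_iff] at h1
  omega

lemma flagCount_close_self {o : Block L M} (ho : s.IsOpen o) (hoj : (o.1 : ℕ) = j)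
    (hof : s.flag o ≠ true) :
    flagCount (s.close st c u j).flag j = (if j = 0 then 0 else flagCount s.flag j) + 1 := by
  have hmem : ∀ i, ((s.close st c u j).flag i = true ∧ (i.1 : ℕ) = j) ↔
      (i = o ∨ (j ≠ 0 ∧ s.flag i = true ∧ (i.1 : ℕ) = j)) := by
    intro i
    rw [close_flag_iff]
    constructor
    · rintro ⟨h1 | ⟨h1, h2 | h2⟩, h3⟩
      · omega
      · exact Or.inl (h2.eq_of_level_eq ho (h1.trans hoj.symm))
      · exact Or.inr ⟨h2.2, h2.1, h1⟩
    · rintro (rfl | ⟨h1, h2, h3⟩)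
      · exact ⟨Or.inr ⟨hoj, Or.inl ho⟩, hoj⟩
      · exact ⟨Or.inr ⟨h3, Or.inr ⟨h2, h1⟩⟩, h3⟩
  classical
  unfold flagCount
  split_ifs with hj
  · have : Finset.univ.filter (fun i => (s.close st c u j).flag i = true ∧ (i.1 : ℕ) = j) = {o} := by
      ext i; simp only [Finset.mem_filter, Finset.mem_univ, true_and, hmem]; simp [hj]
    rw [this]; simp
  · have : Finset.univ.filter (fun i => (s.close st c u j).flag i = true ∧ (i.1 : ℕ) = j) =
        insert o (Finset.univ.filter fun i => s.flag i = true ∧ (i.1 : ℕ) = j) := by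
      ext i; simp only [Finset.mem_filter, Finset.mem_univ, true_and, hmem]; simp [hj]
    rw [this, Finset.card_insert_of_notMem (by simp [hof])]

lemma flagSum_level_le (flag : Block L M → Bool) (e : ℕ → ℝ) (he : ∀ l, 0 ≤ e l)
    (hcnt : ∀ l ≤ L, flagCount flag l ≤ 3) (l : ℕ) :
    flagSum flag (fun i => e i.1) l ≤ 3 * ∑ k ∈ Finset.range (L + 1), e k := by
  have h1 : flagSum flag (fun i => e i.1) l ≤
      ∑ i : Block L M with flag i = true, e i.1 := by
    refine Finset.sum_le_sum_of_subset_of_nonneg ?_ fun _ _ _ => he _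
    intro i
    simp +contextual
  refine h1.trans ?_
  rw [← Finset.sum_fiberwise_of_maps_to (t := Finset.range (L + 1)) (g := fun i => (i.1 : ℕ))
    (fun i _ => by have := i.1.2; simp; omega), Finset.mul_sum]
  refine Finset.sum_le_sum fun k hk => ?_
  rw [Finset.filter_filter, Finset.sum_congr rfl (g := fun _ => e k)
    (fun i hi => by rw [(Finset.mem_filter.1 hi).2.2]), Finset.sum_const, nsmul_eq_mul]
  refine mul_le_mul_of_nonneg_right ?_ (he k)
  exact_mod_cast hcnt k (by simp at hk; omega)

/-- The estimates after level `j` has been closed, in terms of the outputs before. -/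
lemma est_close (hflag : ∀ i, s.flag i = true → s.IsClosed i) (hfirst : s.first ≠ none)
    {o : Block L M} (ho : s.IsOpen o) (hoj : (o.1 : ℕ) = j) (l : ℕ) :
    (s.close (s.read c u) c u j).est base view l = if l < j then s.est base view l else
      (if j = 0 then 0 else s.est base view j) + view (o, true) (s.read c u (o, true)) := by
  have hof : s.flag o ≠ true := by
    intro h
    have := hflag o h
    unfold IsOpen at ho
    unfold IsClosed at this
    omega
  have hw : ∀ l', flagSum s.flag (fun i => view (i, true) (s.inst (i, true))) l' =
      flagSum s.flag (fun i => view (i, true) (s.read c u (i, true))) l' := by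
    intro l'
    refine flagSum_congr (fun i hi => ?_) l'
    simp only [read, if_pos (hflag i hi)]
  have hw' : flagSum (s.close (s.read c u) c u j).flag (fun i => view (i, true)
      ((s.close (s.read c u) c u j).inst (i, true))) l =
      flagSum (s.close (s.read c u) c u j).flag (fun i => view (i, true)
        (s.read c u (i, true))) l := by
    refine flagSum_congr (fun i hi => ?_) l
    rw [close_flag_iff] at hi
    have : ¬ (j ≤ (i, true).1.1 ∧ (s.cur (i, true).1.1 : ℕ) = (i, true).1.2) := by
      rintro ⟨-, h2⟩
      simp only at h2
      rcases hi with hi | ⟨-, hi | hi⟩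
      · have := hflag i hi.2
        unfold IsClosed at this
        omega
      · unfold IsOpen at hi
        omega
      · have := hflag i hi.1
        unfold IsClosed at this
        omega
    simp only [close, if_neg this]
  obtain ⟨u0, hu0⟩ := Option.ne_none_iff_exists'.1 hfirst
  have hfirst' : (s.close (s.read c u) c u j).first = s.first := by
    simp [close, hu0]
  unfold est
  rw [hw', hfirst']
  rcases lt_or_ge l j with hl | hl
  · rw [if_pos hl, flagCount_close_of_lt (by omega), flagSum_close_of_lt _ hl, hw]
  · rw [if_neg hl.not_gt, flagSum_close_of_le ho hoj hof _ hl]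
    by_cases hj : j = 0
    · subst hj
      rw [flagCount_close_self ho hoj hof]
      simp
    · rw [flagCount_close_of_lt (by omega), if_neg hj, if_neg hj, hw]
      ring

/-- Nothing happens to the estimates when no level is closed. -/
lemma est_close_of_gt (hflag : ∀ i, s.flag i = true → s.IsClosed i) (hfirst : s.first ≠ none)
    (hj : L < j) (l : ℕ) :
    (s.close (s.read c u) c u j).est base view l = s.est base view l := by
  obtain ⟨u0, hu0⟩ := Option.ne_none_iff_exists'.1 hfirst
  have hf : (s.close (s.read c u) c u j).flag = s.flag := by
    funext i
    have := i.1.2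
    rw [Bool.eq_iff_iff, close_flag_iff]
    constructor
    · rintro (h | h)
      · exact h.2
      · omega
    · exact fun h => Or.inl ⟨by omega, h⟩
  refine est_congr (by simp [close, hu0]) hf (fun i hi => ?_) l
  rw [hf] at hi
  have := i.1.2
  simp only [close, read, if_pos (hflag i hi)]
  rw [if_neg (by omega)]

end Memory

end Flags

/-! ### The invariant of a good run -/

section Run

variable {n : ℕ} {L : ℕ} {M : ℕ → ℕ} {dev : ℕ → Bool → StreamAlg (Option (Fin n))}

open Classical in
/-- What is required from the instances of level `l`. -/
noncomputable def deviceSpec (F : (Fin n → ℕ) → ℝ) (e : ℕ → ℝ) (l : ℕ) (b : Bool) :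
    List (Fin n) → List (Fin n) → ℝ → Prop :=
  if b = true then
    if l = 0 then TracksPrefix F (e 0) else EstimatesDifference F ((1 / 2) ^ l) (e l)
  else TracksSuffix F (1 / 4)

/-- A run of the switching algorithm on the stream `σ` in which all instances satisfy their
specifications, together with the assumptions on the parameters. -/
structure GoodRun (F : (Fin n → ℕ) → ℝ) (L : ℕ) (M : ℕ → ℕ)
    (dev : ℕ → Bool → StreamAlg (Option (Fin n))) (e : ℕ → ℝ) (T : ℝ)
    (ω : ℕ → (x : Inst L M × Bool) → (algOf dev x.1).Coin) (σ : List (Fin n)) : Prop where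
  nonneg : ∀ f, 0 ≤ F f
  mono : Monotone F
  e_nonneg : ∀ l, 0 ≤ e l
  e_sum : 3 * ∑ l ∈ Finset.range (L + 1), e l ≤ (1 / 2) ^ L / 32
  size : ∀ l ≤ L, 3 * T * 2 ^ l + 1 ≤ M l
  twist : ∀ l ≤ L, (twistNumber F ((1 / 2) ^ l / 16) σ : ℝ) ≤ T * 2 ^ l
  good : ∀ a : Inst L M, GoodOn (fun u => F (freq [u])) (deviceSpec F e) ω σ a

namespace Memory

/-- The number of the current block at level `l`. -/
def curAt (s : Memory L M dev) (l : ℕ) : ℕ := if h : l < L + 1 then s.cur ⟨l, h⟩ else 0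

lemma curAt_coe (s : Memory L M dev) (l : Fin (L + 1)) : s.curAt l = s.cur l := by
  rw [curAt, dif_pos l.2]

lemma curAt_close (s : Memory L M dev) (st : (a : Inst L M) → (algOf dev a).State)
    (c : (x : Inst L M × Bool) → (algOf dev x.1).Coin) (u : Fin n) (j : ℕ) {l : ℕ} (hl : l ≤ L)
    (h : s.curAt l ≤ M l) :
    (s.close st c u j).curAt l = if j ≤ l then s.curAt l + 1 else s.curAt l := by
  have hl' : l < L + 1 := by omega
  simp only [curAt, dif_pos hl'] at h ⊢
  split_ifs with hj
  · exact s.close_cur_of_le st c u (l := ⟨l, hl'⟩) hj h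
  · rw [s.close_cur_of_lt st c u (l := ⟨l, hl'⟩) (not_le.1 hj)]

lemma exists_isOpen (s : Memory L M dev) {l : ℕ} (hl : l ≤ L) (h1 : 1 ≤ s.curAt l)
    (h : s.curAt l ≤ M l) : ∃ o : Block L M, (o.1 : ℕ) = l ∧ s.IsOpen o := by
  have hl' : l < L + 1 := by omega
  refine ⟨⟨⟨l, hl'⟩, ⟨s.curAt l - 1, by simp only; omega⟩⟩, rfl, ?_⟩
  simp only [IsOpen, ← curAt_coe]
  omega

lemma IsOpen.curAt_eq {s : Memory L M dev} {o : Block L M} (ho : s.IsOpen o) :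
    s.curAt o.1 = o.2 + 1 := by rw [curAt_coe]; exact ho

end Memory

/-- The memory after `t` updates. -/
noncomputable abbrev memAt (F : (Fin n → ℕ) → ℝ)
    (ω : ℕ → (x : Inst L M × Bool) → (algOf dev x.1).Coin) (σ : List (Fin n)) (t : ℕ) :
    Memory L M dev :=
  (switching dev (fun u => F (freq [u])) instOutput).stateAfter ω (σ.take t)

/-- The value of `F` after `t` updates. -/
abbrev valAt (F : (Fin n → ℕ) → ℝ) (σ : List (Fin n)) (t : ℕ) : ℝ := F (freq (σ.take t))

/-- The value of `F` on the updates after time `p` up to time `t`. -/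
abbrev suffixAt (F : (Fin n → ℕ) → ℝ) (σ : List (Fin n)) (p t : ℕ) : ℝ :=
  F (freq ((σ.take t).drop p))

/-- The invariant of a good run: `P l` is the time at which the current block of level `l` was
opened and `x l` is the number of alarms so far of which the coarsest level was `l`. -/
structure RunInvariant (F : (Fin n → ℕ) → ℝ) (e : ℕ → ℝ)
    (ω : ℕ → (x : Inst L M × Bool) → (algOf dev x.1).Coin) (σ : List (Fin n)) (t : ℕ)
    (P x : ℕ → ℕ) : Prop where
  first : (memAt F ω σ t).first ≠ none
  cur_pos : ∀ l ≤ L, 1 ≤ (memAt F ω σ t).curAt l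
  cur_le : ∀ l ≤ L, (memAt F ω σ t).curAt l ≤ M l
  opens : ∀ o : Block L M, (memAt F ω σ t).IsOpen o →
    OpensAt (fun u => F (freq [u])) instOutput o ω σ (P o.1)
  P_le : ∀ l, P l ≤ t
  P_mono : ∀ l, P l ≤ P (l + 1)
  acc : ∀ l ≤ L, |(memAt F ω σ t).est (fun u => F (freq [u])) instOutput l - valAt F σ (P l)| ≤
    Memory.flagSum (memAt F ω σ t).flag (fun i => e i.1) l * valAt F σ (P l)
  count_le : ∀ l ≤ L, Memory.flagCount (memAt F ω σ t).flag l ≤ 3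
  out : |(memAt F ω σ t).est (fun u => F (freq [u])) instOutput L - valAt F σ t| ≤
    (1 / 2) ^ L * valAt F σ t
  chain : ∀ l ≤ L, ∃ i : Fin (x l + 1) → ℕ,
    IsTwistSequence F ((1 / 2) ^ l / 16) σ i ∧ ∀ k, i k ≤ P l
  cur_count : ∀ l < L, 4 * (memAt F ω σ t).curAt l + Memory.flagCount (memAt F ω σ t).flag (l + 1) ≤
    3 * ∑ k ∈ Finset.range (l + 1), x k + (memAt F ω σ t).curAt (l + 1) + 3
  cur_count_last : (memAt F ω σ t).curAt L ≤ 1 + ∑ k ∈ Finset.range (L + 1), x k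

variable {F : (Fin n → ℕ) → ℝ} {e : ℕ → ℝ} {T : ℝ}
  {ω : ℕ → (x : Inst L M × Bool) → (algOf dev x.1).Coin} {σ : List (Fin n)} {t : ℕ}
  {P x : ℕ → ℕ}

lemma memAt_succ (ht : t < σ.length) : memAt F ω σ (t + 1) =
    (memAt F ω σ t).close ((memAt F ω σ t).read (ω (t + 1)) σ[t]) (ω (t + 1)) σ[t]
      ((memAt F ω σ t).closeLevel (fun u => F (freq [u])) instOutput
        ((memAt F ω σ t).read (ω (t + 1)) σ[t])) := by
  unfold memAt
  rw [List.take_succ_eq_append_getElem ht, StreamAlg.stateAfter_concat, step_eq,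
    List.length_take, min_eq_left ht.le]

lemma valAt_mono (hF : Monotone F) {s t : ℕ} (h : s ≤ t) : valAt F σ s ≤ valAt F σ t :=
  hF (freq_le_of_sublist (List.take_sublist_take_left h))

lemma suffixAt_anti (hF : Monotone F) {p q : ℕ} (h : p ≤ q) :
    suffixAt F σ q t ≤ suffixAt F σ p t :=
  hF (freq_le_of_sublist (List.drop_sublist_drop_left _ h))

/-- A level is valid at time `t` if `F` has changed since `p` by at most what the estimators of this
level can handle. -/
def ValidAt (F : (Fin n → ℕ) → ℝ) (σ : List (Fin n)) (t p l : ℕ) : Prop :=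
  l = 0 ∨ (valAt F σ t - valAt F σ p ≤ (1 / 2) ^ l * valAt F σ p ∧
    suffixAt F σ p t ≤ (1 / 2) ^ l * valAt F σ p)

namespace RunInvariant

lemma take_append_drop_eq (h : RunInvariant F e ω σ t P x) (l : ℕ) :
    σ.take (P l) ++ (σ.take (t + 1)).drop (P l) = σ.take (t + 1) := by
  have hP := h.P_le l
  have : σ.take (P l) = (σ.take (t + 1)).take (P l) := by
    rw [List.take_take, min_eq_left (by omega)]
  rw [this, List.take_append_drop]

section Observations

variable (h : RunInvariant F e ω σ t P x) (G : GoodRun F L M dev e T ω σ) (ht : t < σ.length)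
  {o : Block L M} (ho : (memAt F ω σ t).IsOpen o)

include h G ht ho

lemma spec_read (b : Bool) : deviceSpec F e o.1 b (σ.take (P o.1)) ((σ.take (t + 1)).drop (P o.1))
    (instOutput (o, b) ((memAt F ω σ t).read (ω (t + 1)) σ[t] (o, b))) := by
  have hP := h.P_le o.1
  have := G.good (o, b) (P o.1) (t + 1) (h.opens o ho) (by omega) (by omega) ho
  have hne : ¬ ((memAt F ω σ t).closeLevel (fun u => F (freq [u])) instOutput
      ((memAt F ω σ t).read (ω (t + 1)) σ[t]) ≤ o.1 ∧ ((memAt F ω σ t).cur o.1 : ℕ) = o.2) := by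
    unfold Memory.IsOpen at ho
    omega
  have hinst : (memAt F ω σ (t + 1)).inst (o, b) =
      (memAt F ω σ t).read (ω (t + 1)) σ[t] (o, b) := by
    rw [memAt_succ ht]
    simp only [Memory.close]
    rw [if_neg hne]
  rw [← hinst]
  exact this

lemma obs_suffix :
    |instOutput (o, false) ((memAt F ω σ t).read (ω (t + 1)) σ[t] (o, false)) -
      suffixAt F σ (P o.1) (t + 1)| ≤ 1 / 4 * suffixAt F σ (P o.1) (t + 1) :=
  h.spec_read G ht ho false

lemma obs_value (hl : (o.1 : ℕ) = 0) :
    |instOutput (o, true) ((memAt F ω σ t).read (ω (t + 1)) σ[t] (o, true)) -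
      valAt F σ (t + 1)| ≤ e o.1 * valAt F σ (t + 1) := by
  have := h.spec_read G ht ho true
  simp only [deviceSpec, if_pos hl, if_true, TracksPrefix,
    h.take_append_drop_eq] at this
  rwa [hl]

lemma obs_difference (hl : (o.1 : ℕ) ≠ 0) (hv : ValidAt F σ (t + 1) (P o.1) o.1) :
    |instOutput (o, true) ((memAt F ω σ t).read (ω (t + 1)) σ[t] (o, true)) -
      (valAt F σ (t + 1) - valAt F σ (P o.1))| ≤ e o.1 * valAt F σ (P o.1) := by
  have := h.spec_read G ht ho true
  simp only [deviceSpec, if_neg hl, if_true, EstimatesDifference,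
    h.take_append_drop_eq] at this
  have hv := hv.resolve_left hl
  exact this hv.1 hv.2

end Observations

section

variable (h : RunInvariant F e ω σ t P x) (G : GoodRun F L M dev e T ω σ)

include h G

lemma flagSum_le (l : ℕ) :
    Memory.flagSum (memAt F ω σ t).flag (fun i => e i.1) l ≤ (1 / 2) ^ L / 32 :=
  (Memory.flagSum_level_le _ e G.e_nonneg h.count_le l).trans G.e_sum

lemma flagSum_le_const (l : ℕ) :
    Memory.flagSum (memAt F ω σ t).flag (fun i => e i.1) l ≤ 1 / 32 := by
  have : ((1 : ℝ) / 2) ^ L ≤ 1 := pow_le_one₀ (by norm_num) (by norm_num)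
  linarith [h.flagSum_le G l]

end

end RunInvariant

lemma GoodRun.e_le (G : GoodRun F L M dev e T ω σ) {l : ℕ} (hl : l ≤ L) :
    e l ≤ (1 / 2) ^ l / 32 := by
  have h1 : e l ≤ ∑ l ∈ Finset.range (L + 1), e l :=
    Finset.single_le_sum (fun k _ => G.e_nonneg k) (by simp; omega)
  have h2 : ((1 : ℝ) / 2) ^ L ≤ (1 / 2) ^ l :=
    pow_le_pow_of_le_one (by norm_num) (by norm_num) hl
  linarith [G.e_sum, G.e_nonneg l]

namespace RunInvariant

variable (h : RunInvariant F e ω σ t P x) (G : GoodRun F L M dev e T ω σ) (ht : t < σ.length)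

section Observations

variable {o : Block L M} (ho : (memAt F ω σ t).IsOpen o)
  (hv : ValidAt F σ (t + 1) (P o.1) o.1)

include h G ht ho hv

lemma small_of_not_alarm (hs : ¬ (memAt F ω σ t).Alarm (fun u => F (freq [u])) instOutput
      ((memAt F ω σ t).read (ω (t + 1)) σ[t]) o) :
    valAt F σ (t + 1) - valAt F σ (P o.1) ≤ (1 / 2) ^ (o.1 : ℕ) / 2 * valAt F σ (P o.1) ∧
      suffixAt F σ (P o.1) (t + 1) ≤ (1 / 2) ^ (o.1 : ℕ) / 2 * valAt F σ (P o.1) := by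
  have hl : (o.1 : ℕ) ≤ L := by omega
  have hγ : (0 : ℝ) < (1 / 2) ^ (o.1 : ℕ) := by positivity
  have hacc := h.acc o.1 hl
  have herr := h.flagSum_le_const G o.1
  have he := G.e_le hl
  simp only [Memory.Alarm, not_or, not_lt] at hs
  refine ⟨?_, small_of_silent_suffix (G.nonneg _) hγ hacc herr (h.obs_suffix G ht ho) hs.2⟩
  by_cases h0 : (o.1 : ℕ) = 0
  · have hs1 := hs.1
    have hobs := h.obs_value G ht ho h0
    rw [if_pos h0] at hs1
    rw [h0] at hs1 hobs hacc herr he ⊢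
    simp only [pow_zero] at hs1 he ⊢
    exact small_of_silent_value (G.nonneg _) (G.nonneg _) he hacc herr hobs hs1
  · have hs1 := hs.1
    rw [if_neg h0, zero_add] at hs1
    exact small_of_silent_difference (G.nonneg _) he hγ hacc herr
      (h.obs_difference G ht ho h0 hv) hs1

lemma twist_of_alarm (hs : (memAt F ω σ t).Alarm (fun u => F (freq [u])) instOutput
      ((memAt F ω σ t).read (ω (t + 1)) σ[t]) o) :
    valAt F σ (P o.1) < (1 - (1 / 2) ^ (o.1 : ℕ) / 16) * valAt F σ (t + 1) ∨
      (1 / 2) ^ (o.1 : ℕ) / 16 * valAt F σ (P o.1) ≤ suffixAt F σ (P o.1) (t + 1) := by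
  have hl : (o.1 : ℕ) ≤ L := by omega
  have hγ : (0 : ℝ) < (1 / 2) ^ (o.1 : ℕ) := by positivity
  have hγ1 : ((1 : ℝ) / 2) ^ (o.1 : ℕ) ≤ 1 := pow_le_one₀ (by norm_num) (by norm_num)
  have hacc := h.acc o.1 hl
  have herr := h.flagSum_le_const G o.1
  have he := G.e_le hl
  rcases hs with hs | hs
  · left
    by_cases h0 : (o.1 : ℕ) = 0
    · have hobs := h.obs_value G ht ho h0
      rw [if_pos h0] at hs
      rw [h0] at hs hobs hacc herr he ⊢
      simp only [pow_zero] at hs he ⊢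
      exact twist_of_alarm_value (G.nonneg _) (G.nonneg _) he hacc herr hobs hs
    · rw [if_neg h0, zero_add] at hs
      exact twist_of_alarm_difference (G.nonneg _) he hγ hγ1 hacc herr
        (h.obs_difference G ht ho h0 hv) hs
  · exact Or.inr (twist_of_alarm_suffix (G.nonneg _) hγ hacc herr (h.obs_suffix G ht ho) hs)

/-- The estimate at the opening time and the estimated difference telescope. Both errors are
relative to the value of `F` at that time, which by monotonicity is at most the current value, so
the relative errors add. -/
lemma newEstimate :
    |(if (o.1 : ℕ) = 0 then 0 else
        (memAt F ω σ t).est (fun u => F (freq [u])) instOutput o.1) +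
      instOutput (o, true) ((memAt F ω σ t).read (ω (t + 1)) σ[t] (o, true)) -
        valAt F σ (t + 1)| ≤
    ((if (o.1 : ℕ) = 0 then 0 else Memory.flagSum (memAt F ω σ t).flag (fun i => e i.1) o.1) +
      e o.1) * valAt F σ (t + 1) := by
  by_cases h0 : (o.1 : ℕ) = 0
  · rw [if_pos h0, if_pos h0, zero_add, zero_add]
    exact h.obs_value G ht ho h0
  · rw [if_neg h0, if_neg h0]
    have h1 := h.acc o.1 (by omega)
    have h2 := h.obs_difference G ht ho h0 hv
    have hmono : valAt F σ (P o.1) ≤ valAt F σ (t + 1) :=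
      valAt_mono G.mono ((h.P_le _).trans (Nat.le_succ t))
    have h3 : 0 ≤ Memory.flagSum (memAt F ω σ t).flag (fun i => e i.1) o.1 :=
      Finset.sum_nonneg fun i _ => G.e_nonneg _
    have h4 := mul_le_mul_of_nonneg_left hmono (add_nonneg h3 (G.e_nonneg o.1))
    rw [abs_le] at h1 h2 ⊢
    constructor <;> nlinarith

end Observations

include h G ht

/-- Induction over the levels. A silent level `l` bounds growth and suffix since `P l` by `2⁻ˡ/2 =
2⁻ˡ⁻¹` times the value at `P l`; since level `l + 1` was opened no earlier, the same bounds hold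
relative to `P (l + 1)`. Level `0` tracks `F` directly and is always valid. Large jumps in one
update are covered too. -/
lemma validAt_of_le_alarmLevel {l : ℕ} (hl : l ≤ L)
    (hal : l ≤ (memAt F ω σ t).alarmLevel (fun u => F (freq [u])) instOutput
      ((memAt F ω σ t).read (ω (t + 1)) σ[t])) : ValidAt F σ (t + 1) (P l) l := by
  induction l with
  | zero => exact Or.inl rfl
  | succ l ih =>
    have hv := ih (by omega) (by omega)
    obtain ⟨o, hol, ho⟩ := (memAt F ω σ t).exists_isOpen (show l ≤ L by omega)
      (h.cur_pos l (by omega)) (h.cur_le l (by omega))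
    have hs : ¬ (memAt F ω σ t).Alarm (fun u => F (freq [u])) instOutput
        ((memAt F ω σ t).read (ω (t + 1)) σ[t]) o := by
      intro hs
      have := hal.trans (Nat.sInf_le (Or.inr ⟨o, hol, ho, hs⟩))
      omega
    have hsmall := h.small_of_not_alarm G ht ho (by rwa [hol]) hs
    rw [hol] at hsmall
    have hP : valAt F σ (P l) ≤ valAt F σ (P (l + 1)) := valAt_mono G.mono (h.P_mono l)
    have hg : suffixAt F σ (P (l + 1)) (t + 1) ≤ suffixAt F σ (P l) (t + 1) :=
      suffixAt_anti G.mono (h.P_mono l)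
    have hpow : ((1 : ℝ) / 2) ^ (l + 1) = (1 / 2) ^ l / 2 := by ring
    have hle := mul_le_mul_of_nonneg_left hP (show (0 : ℝ) ≤ (1 / 2) ^ l / 2 by positivity)
    right
    rw [hpow]
    constructor <;> linarith [hsmall.1, hsmall.2]

end RunInvariant

end Run

/-! ### Counting blocks and preserving the invariant -/

section Run

variable {n : ℕ} {L : ℕ} {M : ℕ → ℕ} {dev : ℕ → Bool → StreamAlg (Option (Fin n))}
  {F : (Fin n → ℕ) → ℝ} {e : ℕ → ℝ} {T : ℝ}
  {ω : ℕ → (x : Inst L M × Bool) → (algOf dev x.1).Coin} {σ : List (Fin n)} {t : ℕ}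
  {P x : ℕ → ℕ}

/-- The number of current blocks is bounded in terms of the number of alarms. -/
lemma cur_le_of_counts {T : ℝ} (hT : 0 ≤ T) {L : ℕ} {cur x : ℕ → ℕ}
    (hx : ∀ l ≤ L, (x l : ℝ) ≤ T * 2 ^ l)
    (hc : ∀ l < L, 4 * cur l ≤ 3 * ∑ k ∈ Finset.range (l + 1), x k + cur (l + 1) + 3)
    (hL : cur L ≤ 1 + ∑ k ∈ Finset.range (L + 1), x k) {l : ℕ} (hl : l ≤ L) :
    (cur l : ℝ) ≤ 3 * T * 2 ^ l + 1 := by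
  -- The bounds on the alarms are geometric in `l`, so the last one dominates up to a factor `2`.
  have hsum : ∀ l ≤ L, ((∑ k ∈ Finset.range (l + 1), x k : ℕ) : ℝ) ≤ 2 * T * 2 ^ l := by
    intro l
    induction l with
    | zero =>
      intro _
      have := hx 0 (by omega)
      simp at this ⊢
      linarith
    | succ l ih =>
      intro hl
      have := hx (l + 1) hl
      have := ih (by omega)
      rw [Finset.sum_range_succ]
      push_cast
      push_cast at this
      have : (2 : ℝ) ^ (l + 1) = 2 * 2 ^ l := by ring
      nlinarith
  induction hl using Nat.decreasingInduction with
  | self =>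
    have h1 := hsum L le_rfl
    have h2 : (cur L : ℝ) ≤ 1 + ((∑ k ∈ Finset.range (L + 1), x k : ℕ) : ℝ) := by exact_mod_cast hL
    have : 0 ≤ T * 2 ^ L := by positivity
    linarith
  | of_succ l hl ih =>
    have h1 := hsum l hl.le
    have h2 : 4 * (cur l : ℝ) ≤ 3 * ((∑ k ∈ Finset.range (l + 1), x k : ℕ) : ℝ) + cur (l + 1) + 3 := by
      exact_mod_cast hc l hl
    have h3 : (2 : ℝ) ^ (l + 1) = 2 * 2 ^ l := by ring
    rw [h3] at ih
    -- The sum is `4 cur l ≤ 6 T 2ˡ + (6 T 2ˡ + 1) + 3`, which reproduces the bound.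
    linarith

lemma GoodRun.runInvariant_one (G : GoodRun F L M dev e T ω σ) (ht : 0 < σ.length) :
    RunInvariant F e ω σ 1 (fun _ => 1) (fun _ => 0) := by
  set s0 := memAt F ω σ 0 with hs0
  have hs0' : s0 = (switching dev (fun u => F (freq [u])) instOutput).init (ω 0) := by
    rw [hs0]; rfl
  have hfirst0 : s0.first = none := by rw [hs0']
  have hcur0 : ∀ l, (s0.cur l : ℕ) = 0 := fun l => by rw [hs0']; rfl
  have hflag0 : ∀ i, s0.flag i = false := fun i => by rw [hs0']
  have hstep := memAt_succ (F := F) (ω := ω) ht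
  rw [← hs0, zero_add] at hstep
  rw [show s0.closeLevel (fun u => F (freq [u])) instOutput (s0.read (ω 1) σ[0]) = 0 by
    simp [Memory.closeLevel, hfirst0]] at hstep
  have hopen0 : ∀ i, ¬ s0.IsOpen i := fun i hi => by
    unfold Memory.IsOpen at hi
    rw [hcur0] at hi
    omega
  have hcurAt0 : ∀ l ≤ L, s0.curAt l = 0 := by
    intro l hl
    rw [Memory.curAt, dif_pos (by omega), hcur0]
  have hM : ∀ l ≤ L, 1 ≤ M l := by
    intro l hl
    have h1 := G.size l hl
    have h2 : (0 : ℝ) ≤ 3 * (T * 2 ^ l) :=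
      mul_nonneg (by norm_num) ((Nat.cast_nonneg _).trans (G.twist l hl))
    have : (1 : ℝ) ≤ M l := by linarith
    exact_mod_cast this
  have hcur : ∀ l ≤ L, (memAt F ω σ 1).curAt l = 1 := by
    intro l hl
    rw [hstep, Memory.curAt_close _ _ _ _ _ hl (by rw [hcurAt0 l hl]; omega), hcurAt0 l hl]
    simp
  have hflag : ∀ i, ¬ (memAt F ω σ 1).flag i = true := by
    intro i hi
    rw [hstep, Memory.close_flag_iff] at hi
    simp [hflag0, hopen0] at hi
  have hcount : ∀ l, Memory.flagCount (memAt F ω σ 1).flag l = 0 := by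
    intro l
    simp [Memory.flagCount, hflag]
  have hsum : ∀ w l, Memory.flagSum (memAt F ω σ 1).flag w l = 0 := by
    intro w l
    simp [Memory.flagSum, hflag]
  have hfirst : (memAt F ω σ 1).first = some σ[0] := by
    rw [hstep]; simp [Memory.close, hfirst0]
  have hest : ∀ l, (memAt F ω σ 1).est (fun u => F (freq [u])) instOutput l = valAt F σ 1 := by
    intro l
    rw [Memory.est, hcount, hsum, hfirst]
    have : σ.take 1 = [σ[0]] := by
      rw [List.take_succ_eq_append_getElem ht]; simp
    simp [valAt, this]
  constructor
  · rw [hfirst]; simp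
  · intro l hl; rw [hcur l hl]
  · intro l hl; rw [hcur l hl]; exact hM l hl
  · intro o ho
    have h1 := ho.curAt_eq
    rw [hcur _ (by omega)] at h1
    refine ⟨le_rfl, ht, ho, ?_⟩
    have := hcur0 o.1
    rw [hs0] at this
    simp only [Nat.sub_self]
    unfold memAt at this
    omega
  · intro l; exact le_rfl
  · intro l; exact le_rfl
  · intro l _; rw [hest, hsum]; simp
  · intro l _; rw [hcount]; omega
  · rw [hest, sub_self, abs_zero]
    exact mul_nonneg (by positivity) (G.nonneg _)
  · intro l _
    -- Every chain starts with the single time `1`, hence the length `x l + 1`.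
    refine ⟨fun _ => 1, ⟨?_, fun _ => ht, fun j hj => by omega⟩, fun _ => le_rfl⟩
    intro a b hab
    have := a.2
    have := b.2
    omega
  · intro l hl; rw [hcur l hl.le, hcur (l + 1) hl, hcount]; simp
  · rw [hcur L le_rfl]; simp

namespace RunInvariant

variable (h : RunInvariant F e ω σ t P x) (G : GoodRun F L M dev e T ω σ) (ht : t < σ.length)

include h G ht

/-- A step without alarms preserves the invariant. -/
lemma succ_of_no_alarm (hal : (memAt F ω σ t).alarmLevel (fun u => F (freq [u])) instOutput
    ((memAt F ω σ t).read (ω (t + 1)) σ[t]) = L + 1) : RunInvariant F e ω σ (t + 1) P x := by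
  have hstep := memAt_succ (F := F) (ω := ω) ht
  have hcl : (memAt F ω σ t).closeLevel (fun u => F (freq [u])) instOutput
      ((memAt F ω σ t).read (ω (t + 1)) σ[t]) = L + 1 := by
    rw [Memory.closeLevel, if_neg h.first, hal]
    refine Nat.findGreatest_eq ?_
    rw [Memory.flagCount_eq_zero_of_lt _ (Nat.lt_succ_self L)]
    norm_num
  rw [hcl] at hstep
  have hest : ∀ l, (memAt F ω σ (t + 1)).est (fun u => F (freq [u])) instOutput l =
      (memAt F ω σ t).est (fun u => F (freq [u])) instOutput l := by
    intro l
    rw [hstep]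
    exact Memory.est_close_of_gt (isClosed_of_flag ω _) h.first (Nat.lt_succ_self L) l
  have hflag : (memAt F ω σ (t + 1)).flag = (memAt F ω σ t).flag := by
    funext i
    have := i.1.2
    rw [hstep, Bool.eq_iff_iff, Memory.close_flag_iff]
    constructor
    · rintro (h | h)
      · exact h.2
      · omega
    · exact fun h => Or.inl ⟨by omega, h⟩
  have hcurf : (memAt F ω σ (t + 1)).cur = (memAt F ω σ t).cur := by
    funext l
    rw [hstep]
    exact Memory.close_cur_of_lt _ _ _ _ l.2
  have hcur : ∀ l, (memAt F ω σ (t + 1)).curAt l = (memAt F ω σ t).curAt l := by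
    intro l
    simp only [Memory.curAt, hcurf]
  refine ⟨?_, ?_, ?_, ?_, fun l => (h.P_le l).trans (Nat.le_succ t), h.P_mono, ?_, ?_, ?_, h.chain,
    ?_, ?_⟩
  · rw [hstep]; simp [Memory.close]
  · simpa only [hcur] using h.cur_pos
  · simpa only [hcur] using h.cur_le
  · intro o ho
    refine h.opens o ?_
    unfold Memory.IsOpen at ho ⊢
    rwa [hcurf] at ho
  · simpa only [hest, hflag] using h.acc
  · simpa only [hflag] using h.count_le
  · rw [hest]
    obtain ⟨o, hol, ho⟩ := (memAt F ω σ t).exists_isOpen le_rfl (h.cur_pos L le_rfl)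
      (h.cur_le L le_rfl)
    -- Silence of level `L` bounds the drift since `P L` by half of `2⁻ᴸ`; the frozen error of at
    -- most `2⁻ᴸ/32` fits into the other half.
    have hs : ¬ (memAt F ω σ t).Alarm (fun u => F (freq [u])) instOutput
        ((memAt F ω σ t).read (ω (t + 1)) σ[t]) o := by
      intro hs
      have := hal.symm.trans_le (Nat.sInf_le (Or.inr ⟨o, hol, ho, hs⟩))
      omega
    have hv := h.validAt_of_le_alarmLevel G ht le_rfl (by omega)
    have hsmall := (h.small_of_not_alarm G ht ho (by rwa [hol]) hs).1
    rw [hol] at hsmall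
    have hacc := h.acc L le_rfl
    have herr := mul_le_mul_of_nonneg_right (h.flagSum_le G L) (G.nonneg (freq (σ.take (P L))))
    have hmono : valAt F σ (P L) ≤ valAt F σ (t + 1) :=
      valAt_mono G.mono ((h.P_le _).trans (Nat.le_succ t))
    have hle := mul_le_mul_of_nonneg_left hmono (show (0 : ℝ) ≤ (1 / 2) ^ L by positivity)
    have h0 : 0 ≤ (1 / 2) ^ L * valAt F σ (P L) := mul_nonneg (by positivity) (G.nonneg _)
    rw [abs_le] at hacc ⊢
    constructor <;> linarith
  · simpa only [hcur, hflag] using h.cur_count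
  · simpa only [hcur] using h.cur_count_last

/-- A step with alarms, the coarsest of level `j₀`, preserves the invariant. -/
lemma succ_of_alarm {j₀ j : ℕ} (hal : (memAt F ω σ t).alarmLevel (fun u => F (freq [u])) instOutput
      ((memAt F ω σ t).read (ω (t + 1)) σ[t]) = j₀) (hj₀ : j₀ ≤ L)
    (hcl : (memAt F ω σ t).closeLevel (fun u => F (freq [u])) instOutput
      ((memAt F ω σ t).read (ω (t + 1)) σ[t]) = j) :
    RunInvariant F e ω σ (t + 1) (fun l => if l < j then P l else t + 1)
      (fun l => if l = j₀ then x l + 1 else x l) := by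
  have hjj : j ≤ j₀ := by rw [← hal, ← hcl]; exact Memory.closeLevel_le_alarmLevel _ _
  have hjL : j ≤ L := hjj.trans hj₀
  have hgr : Nat.findGreatest (fun j => Memory.flagCount (memAt F ω σ t).flag j < 3) j₀ = j := by
    rw [← hcl, Memory.closeLevel, if_neg h.first, hal]
  have hcntj : j ≠ 0 → Memory.flagCount (memAt F ω σ t).flag j < 3 :=
    fun hj => Nat.findGreatest_of_ne_zero
      (P := fun j => Memory.flagCount (memAt F ω σ t).flag j < 3) hgr hj
  have hcntgt : ∀ l, j < l → l ≤ j₀ → 3 ≤ Memory.flagCount (memAt F ω σ t).flag l := by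
    intro l h1 h2
    exact not_lt.1 (Nat.findGreatest_is_greatest
      (P := fun j => Memory.flagCount (memAt F ω σ t).flag j < 3) (hgr.trans_lt h1) h2)
  have hstep := memAt_succ (F := F) (ω := ω) ht
  rw [hcl] at hstep
  obtain ⟨o, hoj, ho⟩ := (memAt F ω σ t).exists_isOpen hjL (h.cur_pos j hjL) (h.cur_le j hjL)
  have hof : (memAt F ω σ t).flag o ≠ true := by
    intro hf
    have h1 : (o.2 : ℕ) + 1 < (memAt F ω σ t).cur o.1 := isClosed_of_flag ω _ o hf
    have h2 : ((memAt F ω σ t).cur o.1 : ℕ) = o.2 + 1 := ho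
    omega
  have hest : ∀ l, (memAt F ω σ (t + 1)).est (fun u => F (freq [u])) instOutput l =
      if l < j then (memAt F ω σ t).est (fun u => F (freq [u])) instOutput l else
      (if j = 0 then 0 else (memAt F ω σ t).est (fun u => F (freq [u])) instOutput j) +
        instOutput (o, true) ((memAt F ω σ t).read (ω (t + 1)) σ[t] (o, true)) := by
    intro l
    rw [hstep]
    exact Memory.est_close (isClosed_of_flag ω _) h.first ho hoj l
  have hnew := h.newEstimate G ht ho
    (by rw [hoj]; exact h.validAt_of_le_alarmLevel G ht hjL (by omega))
  rw [hoj] at hnew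
  have hcount : ∀ l, Memory.flagCount (memAt F ω σ (t + 1)).flag l =
      if l < j then Memory.flagCount (memAt F ω σ t).flag l
      else if l = j then (if j = 0 then 0 else Memory.flagCount (memAt F ω σ t).flag j) + 1
      else 0 := by
    intro l
    rw [hstep]
    split_ifs with h1 h2 h3
    · exact Memory.flagCount_close_of_lt h1
    · rw [h2, Memory.flagCount_close_self ho hoj hof, if_pos h3]
    · rw [h2, Memory.flagCount_close_self ho hoj hof, if_neg h3]
    · exact Memory.flagCount_close_of_gt (by omega)
  have hcount3 : ∀ l ≤ L, Memory.flagCount (memAt F ω σ (t + 1)).flag l ≤ 3 := by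
    intro l hl
    rw [hcount]
    split_ifs with h1 h2 h3
    · exact h.count_le l hl
    · omega
    · have := hcntj h3
      omega
    · omega
  have hcur : ∀ l ≤ L, (memAt F ω σ (t + 1)).curAt l =
      if j ≤ l then (memAt F ω σ t).curAt l + 1 else (memAt F ω σ t).curAt l := by
    intro l hl
    rw [hstep]
    exact Memory.curAt_close _ _ _ _ _ hl (h.cur_le l hl)
  have hacc : ∀ l ≤ L, |(memAt F ω σ (t + 1)).est (fun u => F (freq [u])) instOutput l -
      valAt F σ (if l < j then P l else t + 1)| ≤
      Memory.flagSum (memAt F ω σ (t + 1)).flag (fun i => e i.1) l *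
        valAt F σ (if l < j then P l else t + 1) := by
    intro l hl
    rw [hest]
    rcases lt_or_ge l j with hlj | hlj
    · rw [if_pos hlj, if_pos hlj, hstep, Memory.flagSum_close_of_lt _ hlj]
      exact h.acc l hl
    · rw [if_neg hlj.not_gt, if_neg hlj.not_gt, hstep,
        Memory.flagSum_close_of_le ho hoj hof _ hlj, hoj]
      exact hnew
  have hchain : ∀ l ≤ L, ∃ i : Fin ((if l = j₀ then x l + 1 else x l) + 1) → ℕ,
      IsTwistSequence F ((1 / 2) ^ l / 16) σ i ∧ ∀ k, i k ≤ if l < j then P l else t + 1 := by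
    intro l hl
    obtain ⟨i, hi, hiP⟩ := h.chain l hl
    have hPle : P l ≤ if l < j then P l else t + 1 := by
      have := h.P_le l
      split_ifs <;> omega
    by_cases hlj : l = j₀
    -- Only the chain of the alarm level gets longer. As `j ≤ j₀`, that level is reopened, so its
    -- `P` moves to the new time `t + 1`.
    · subst hlj
      rw [if_pos rfl, if_neg (by omega)]
      have hmem : (memAt F ω σ t).alarmLevel (fun u => F (freq [u])) instOutput
          ((memAt F ω σ t).read (ω (t + 1)) σ[t]) ∈ {l | l = L + 1 ∨ ∃ i : Block L M, (i.1 : ℕ) = l ∧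
            (memAt F ω σ t).IsOpen i ∧ (memAt F ω σ t).Alarm (fun u => F (freq [u])) instOutput
              ((memAt F ω σ t).read (ω (t + 1)) σ[t]) i} := Nat.sInf_mem ⟨L + 1, Or.inl rfl⟩
      rw [hal] at hmem
      rcases hmem with hmem | ⟨o', ho'l, ho', hal'⟩
      · omega
      have htw := h.twist_of_alarm G ht ho'
        (by rw [ho'l]; exact h.validAt_of_le_alarmLevel G ht hl hal.ge) hal'
      rw [ho'l] at htw
      refine ⟨Fin.snoc i (t + 1), hi.snoc G.mono (by positivity) hiP
        (Nat.lt_succ_of_le (h.P_le l)) ht htw, fun k => ?_⟩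
      refine Fin.lastCases ?_ (fun k => ?_) k
      · rw [Fin.snoc_last]
      · rw [Fin.snoc_castSucc]
        exact (hiP k).trans ((h.P_le l).trans (Nat.le_succ t))
    · rw [if_neg hlj]
      exact ⟨i, hi, fun k => (hiP k).trans hPle⟩
  have hsumx : ∀ l, ∑ k ∈ Finset.range (l + 1), (if k = j₀ then x k + 1 else x k) =
      (∑ k ∈ Finset.range (l + 1), x k) + if j₀ ≤ l then 1 else 0 := by
    intro l
    have : ∀ k, (if k = j₀ then x k + 1 else x k) = x k + if k = j₀ then 1 else 0 := by
      intro k; split_ifs <;> rfl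
    simp only [this, Finset.sum_add_distrib, Finset.sum_ite_eq', Finset.mem_range,
      Nat.lt_succ_iff]
  have hcc : ∀ l < L, 4 * (memAt F ω σ (t + 1)).curAt l +
      Memory.flagCount (memAt F ω σ (t + 1)).flag (l + 1) ≤
      3 * ∑ k ∈ Finset.range (l + 1), (if k = j₀ then x k + 1 else x k) +
        (memAt F ω σ (t + 1)).curAt (l + 1) + 3 := by
    intro l hl
    -- If `j₀ ≤ l`, the left side grows by at most `4` and the right by `3 + 1`. If `j ≤ l < j₀`,
    -- level `l + 1` was full and loses three flags, so the left grows by at most `1`, as does `cur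
    -- (l + 1)`. If `j = l + 1`, one flag and one block are added. Otherwise nothing changes.
    have hc := h.cur_count l hl
    have hgt := hcntgt (l + 1)
    rw [hsumx, hcur l hl.le, hcur (l + 1) hl, hcount]
    have hjl : j = l + 1 → Memory.flagCount (memAt F ω σ t).flag j =
        Memory.flagCount (memAt F ω σ t).flag (l + 1) := fun h => by rw [h]
    split_ifs <;> omega
  have hccl : (memAt F ω σ (t + 1)).curAt L ≤
      1 + ∑ k ∈ Finset.range (L + 1), (if k = j₀ then x k + 1 else x k) := by
    have := h.cur_count_last
    rw [hsumx, hcur L le_rfl, if_pos hjL, if_pos hj₀]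
    omega
  have hT : 0 ≤ T := by
    have := (Nat.cast_nonneg _).trans (G.twist 0 (Nat.zero_le L))
    simpa using this
  refine ⟨?_, ?_, ?_, ?_, ?_, ?_, hacc, hcount3, ?_, hchain, hcc, hccl⟩
  · rw [hstep]; simp [Memory.close]
  · intro l hl
    have := h.cur_pos l hl
    rw [hcur l hl]
    split_ifs <;> omega
  · intro l hl
    -- The counts after the step are bounded by the twist numbers, through the extended chains; so
    -- no level runs out of blocks.
    have hb := cur_le_of_counts hT (L := L) (cur := (memAt F ω σ (t + 1)).curAt)
      (x := fun l => if l = j₀ then x l + 1 else x l) (fun l hl => ?_)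
      (fun l hl => le_trans (Nat.le_add_right _ _) (hcc l hl)) hccl hl
    · exact_mod_cast hb.trans (G.size l hl)
    · obtain ⟨i, hi, -⟩ := hchain l hl
      have h1 : ((((if l = j₀ then x l + 1 else x l) + 1 : ℕ)) : ℝ) ≤
          twistNumber F ((1 / 2) ^ l / 16) σ := by exact_mod_cast le_twistNumber hi
      have h2 := G.twist l hl
      rw [Nat.cast_add] at h1
      linarith
  · intro o' ho'
    have hl : (o'.1 : ℕ) ≤ L := by omega
    have h1 := ho'.curAt_eq
    rw [hcur _ hl] at h1
    rcases lt_or_ge (o'.1 : ℕ) j with hlj | hlj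
    · rw [if_pos hlj]
      rw [if_neg hlj.not_ge] at h1
      refine h.opens o' ?_
      rw [Memory.curAt_coe] at h1
      exact h1
    · rw [if_neg hlj.not_gt]
      rw [if_pos hlj] at h1
      refine ⟨by omega, ht, ho', ?_⟩
      rw [Memory.curAt_coe] at h1
      have h2 : ((memAt F ω σ t).cur o'.1 : ℕ) = o'.2 := by omega
      exact h2
  · intro l
    have := h.P_le l
    split_ifs <;> omega
  · intro l
    have h1 := h.P_le l
    have h2 := h.P_mono l
    split_ifs <;> omega
  · have h1 := hacc L le_rfl
    rw [if_neg hjL.not_gt] at h1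
    have h2 := (Memory.flagSum_level_le (memAt F ω σ (t + 1)).flag e G.e_nonneg hcount3 L).trans
      G.e_sum
    refine h1.trans (mul_le_mul_of_nonneg_right (h2.trans ?_) (G.nonneg _))
    have : (0 : ℝ) ≤ (1 / 2) ^ L := by positivity
    linarith

end RunInvariant

/-- In a good run all outputs are accurate. -/
lemma GoodRun.abs_output_sub_le (G : GoodRun F L M dev e T ω σ) (h1 : 1 ≤ t) (ht : t ≤ σ.length) :
    |(switching dev (fun u => F (freq [u])) instOutput).outputAfter ω (σ.take t) -
      F (freq (σ.take t))| ≤ (1 / 2) ^ L * F (freq (σ.take t)) := by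
  have key : ∃ P x, RunInvariant F e ω σ t P x := by
    induction t, h1 using Nat.le_induction with
    | base => exact ⟨_, _, G.runInvariant_one ht⟩
    | succ t _ ih =>
      obtain ⟨P, x, h⟩ := ih (by omega)
      rcases Nat.lt_or_ge L ((memAt F ω σ t).alarmLevel (fun u => F (freq [u])) instOutput
        ((memAt F ω σ t).read (ω (t + 1)) σ[t])) with hlt | hge
      · exact ⟨_, _, h.succ_of_no_alarm G ht (le_antisymm (Memory.alarmLevel_le _ _) hlt)⟩
      · exact ⟨_, _, h.succ_of_alarm G ht rfl hge rfl⟩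
  obtain ⟨P, x, h⟩ := key
  exact h.out

end Run

/-! ### Robustness and space of the switching algorithm -/

section Switching

variable {n : ℕ} {L : ℕ} {M : ℕ → ℕ} {dev : ℕ → Bool → StreamAlg (Option (Fin n))}

lemma card_inst (L : ℕ) (M : ℕ → ℕ) :
    Nat.card (Inst L M) = 2 * ∑ l ∈ Finset.range (L + 1), M l := by
  rw [Nat.card_prod, Nat.card_sigma, Nat.card_eq_fintype_card (α := Bool), Fintype.card_bool,
    mul_comm, ← Fin.sum_univ_eq_sum_range]
  simp

theorem switching_isAdversariallyRobust {F : (Fin n → ℕ) → ℝ} (hF0 : ∀ f, 0 ≤ F f)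
    (hF : Monotone F) {m : ℕ} {e : ℕ → ℝ} {T ε δ : ℝ} (he : ∀ l, 0 ≤ e l)
    (hsum : 3 * ∑ l ∈ Finset.range (L + 1), e l ≤ (1 / 2) ^ L / 32)
    (hM : ∀ l ≤ L, 3 * T * 2 ^ l + 1 ≤ M l)
    (htwist : ∀ σ : List (Fin n), σ.length = m → ∀ l ≤ L,
      (twistNumber F ((1 / 2) ^ l / 16) σ : ℝ) ≤ T * 2 ^ l)
    (hε : (1 / 2) ^ L ≤ ε) (hδ : 0 ≤ δ)
    (hdev : ∀ l ≤ L, ∀ b, Satisfies (deviceSpec F e l b) m δ (dev l b))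
    (hcard : (2 * ∑ l ∈ Finset.range (L + 1), M l : ℕ) * δ ≤ 1 / 3) :
    IsAdversariallyRobust F m ε (2 / 3)
      (switching (L := L) (M := M) dev (fun u => F (freq [u])) instOutput) := by
  intro adv
  refine le_coinLaw_of_forall_goodOn (spec := deviceSpec F e) (δ := δ) hδ adv
    (fun a => hdev a.1.1 (by omega) a.2) (by rw [card_inst]; linarith) _ fun ω hω t h1 ht => ?_
  have hlen := (switching (L := L) (M := M) dev (fun u => F (freq [u])) instOutput
    ).adaptiveStream_length adv ω m
  have G : GoodRun F L M dev e T ω _ := ⟨hF0, hF, he, hsum, hM, htwist _ hlen, hω⟩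
  have := G.abs_output_sub_le h1 (ht.trans hlen.ge)
  rw [StreamAlg.take_adaptiveStream _ _ _ ht] at this
  exact this.trans (mul_le_mul_of_nonneg_right hε (hF0 _))

lemma card_memory_le : Nat.card (Memory L M dev) ≤
    (n + 1) * ((∏ l : Fin (L + 1), (M l + 2)) * (2 ^ (∑ l : Fin (L + 1), M l) *
      ∏ a : Inst L M, Nat.card (algOf dev a).State)) := by
  have hinj : Function.Injective
      (fun s : Memory L M dev => (s.first, s.cur, s.flag, s.inst)) := by
    rintro ⟨⟩ ⟨⟩ h
    simp only [Prod.mk.injEq] at h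
    simp [h]
  refine (Nat.card_le_card_of_injective _ hinj).trans (le_of_eq ?_)
  rw [Nat.card_prod, Nat.card_prod, Nat.card_prod, Nat.card_pi, Nat.card_pi, Nat.card_pi,
    Finite.card_option]
  simp

lemma logb_natCast_le (M : ℕ) : Real.logb 2 (M + 2) ≤ M + 1 := by
  have h : ((M + 2 : ℕ) : ℝ) ≤ ((2 ^ (M + 1) : ℕ) : ℝ) := by
    exact_mod_cast Nat.succ_le_of_lt (Nat.lt_two_pow_self (n := M + 1))
  push_cast at h
  rw [Real.logb_le_iff_le_rpow one_lt_two (by positivity)]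
  calc (M : ℝ) + 2 ≤ 2 ^ (M + 1) := h
    _ = (2 : ℝ) ^ ((M : ℝ) + 1) := by rw [← Real.rpow_natCast]; push_cast; rfl

/-- Besides the instances, level `l` stores one flag per block and a counter with `M l + 2` values,
of at most `M l + 1` bits; `log (n + 1)` bits hold the first update. -/
theorem switching_bits_le (base : Fin n → ℝ)
    (view : (a : Inst L M) → (algOf dev a).State → ℝ) :
    (switching dev base view).bits ≤ Real.logb 2 (n + 1) +
      ∑ l ∈ Finset.range (L + 1), (M l * ((dev l true).bits + (dev l false).bits + 2) + 1) := by
  have hst : ∀ a : Inst L M, Nat.card (algOf dev a).State ≠ 0 := fun a => by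
    have := (algOf dev a).nonempty_state
    exact Nat.card_pos.ne'
  have hpos : 0 < Nat.card (Memory L M dev) := by
    have := (switching dev base view).nonempty_state
    exact Nat.card_pos (α := (switching dev base view).State)
  have h1 : (switching dev base view).bits ≤ Real.logb 2 (((n + 1) *
      ((∏ l : Fin (L + 1), (M l + 2)) * (2 ^ (∑ l : Fin (L + 1), M l) *
        ∏ a : Inst L M, Nat.card (algOf dev a).State)) : ℕ) : ℝ) :=
    Real.logb_le_logb_of_le one_lt_two (by exact_mod_cast hpos) (by exact_mod_cast card_memory_le)
  refine h1.trans ?_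
  push_cast
  have hp : ∏ a : Inst L M, (Nat.card (algOf dev a).State : ℝ) ≠ 0 :=
    Finset.prod_ne_zero_iff.2 fun a _ => by exact_mod_cast hst a
  have hp' : ∏ l : Fin (L + 1), ((M l : ℝ) + 2) ≠ 0 :=
    Finset.prod_ne_zero_iff.2 fun l _ => by positivity
  rw [Real.logb_mul (by positivity) (mul_ne_zero hp' (mul_ne_zero (by positivity) hp)),
    Real.logb_mul hp' (mul_ne_zero (by positivity) hp), Real.logb_mul (by positivity) hp,
    Real.logb_prod _ _ (fun l _ => by positivity),
    Real.logb_prod _ _ (fun a _ => by exact_mod_cast hst a), Real.logb_pow, Real.logb_self_eq_one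
    one_lt_two, mul_one]
  have hinst : ∑ a : Inst L M, Real.logb 2 (Nat.card (algOf dev a).State) =
      ∑ l ∈ Finset.range (L + 1), (M l : ℝ) * ((dev l true).bits + (dev l false).bits) := by
    rw [Fintype.sum_prod_type, ← Finset.univ_sigma_univ, Finset.sum_sigma,
      ← Fin.sum_univ_eq_sum_range
        (fun l => (M l : ℝ) * ((dev l true).bits + (dev l false).bits))]
    refine Finset.sum_congr rfl fun l _ => ?_
    have : ∀ s : Fin (M l), ∑ b : Bool, Real.logb 2 (Nat.card (algOf dev (⟨l, s⟩, b)).State) =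
        (dev l true).bits + (dev l false).bits := fun s => Fintype.sum_bool _
    rw [Finset.sum_congr rfl fun s _ => this s]
    simp [mul_add]
  rw [hinst]
  push_cast
  rw [Fin.sum_univ_eq_sum_range (fun l => Real.logb 2 ((M l : ℝ) + 2)),
    Fin.sum_univ_eq_sum_range (fun l => (M l : ℝ))]
  gcongr
  rw [← Finset.sum_add_distrib, ← Finset.sum_add_distrib]
  refine Finset.sum_le_sum fun l _ => ?_
  linarith [logb_natCast_le (M l)]

end Switching

/-! ### Choice of the accuracies -/

/-- A space function grows at most by a constant factor when the accuracy is replaced by a fixed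
power of it. -/
lemma IsSpaceFunction.exists_pow_le {S : ℕ → ℝ → ℝ → ℝ} (hS : IsSpaceFunction S) (R : ℕ) :
    ∃ K : ℝ, 0 ≤ K ∧ ∀ n ≥ 2, ∀ δ ∈ Set.Ioo (0 : ℝ) 1, ∀ ε ∈ Set.Ioc (0 : ℝ) (1 / 2),
      ∀ η ∈ Set.Ioc (0 : ℝ) (1 / 2), ε ^ 2 ^ R ≤ η → S n δ η ≤ K * S n δ ε := by
  obtain ⟨K, hK⟩ := hS.square
  have hpow : ∀ R : ℕ, ∀ ε ∈ Set.Ioc (0 : ℝ) (1 / 2), ε ^ 2 ^ R ∈ Set.Ioc (0 : ℝ) (1 / 2) := by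
    intro R ε hε
    refine ⟨pow_pos hε.1 _, le_trans (pow_le_of_le_one hε.1.le ?_ (by positivity)) hε.2⟩
    linarith [hε.2]
  refine ⟨|K| ^ R, by positivity, fun n hn δ hδ ε hε η hη h => ?_⟩
  refine (hS.antitone n hn δ hδ (hpow R ε hε) hη h).trans ?_
  clear h
  induction R with
  | zero => simp
  | succ R ih =>
    have h1 := hK n hn δ hδ _ (hpow R ε hε)
    rw [← pow_mul, ← pow_succ] at h1
    have h0 := hS.nonneg n hn δ hδ _ (hpow R ε hε)
    calc _ ≤ K * S n δ (ε ^ 2 ^ R) := h1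
      _ ≤ |K| * S n δ (ε ^ 2 ^ R) := mul_le_mul_of_nonneg_right (le_abs_self K) h0
      _ ≤ |K| * (|K| ^ R * S n δ ε) := mul_le_mul_of_nonneg_left ih (abs_nonneg K)
      _ = _ := by ring

/-- Accuracies `e l` for the levels `l ≤ L` that add up to a small multiple of `ε`, are not too
small, and for which the weighted sum of the costs is at most `cost`. -/
structure IsSchedule (C : ℝ) (R : ℕ) (ε cost : ℝ) (L : ℕ) (e : ℕ → ℝ) : Prop where
  pos : ∀ l, 0 < e l
  sum_le : 3 * ∑ l ∈ Finset.range (L + 1), e l ≤ (1 / 2) ^ L / 32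
  pow_le : ∀ l ≤ L, ε ^ 2 ^ R ≤ e l
  cost_le : ∑ l ∈ Finset.range (L + 1), 2 ^ l * (((1 / 2) ^ l) ^ C / e l ^ 2) ≤ cost

/-- With `e l = a ε ρˡ` the cost of level `l` is proportional to `(β/ρ²)ˡ` for `β = 2^(1-C) < 1`.
The choice `ρ = (1 + β)/2` makes both series converge: `ρ < 1`, and `ρ² > β` by the inequality of
arithmetic and geometric means. -/
lemma exists_schedule_of_one_lt {C : ℝ} (hC : 1 < C) : ∃ (R : ℕ) (H : ℝ), 0 ≤ H ∧
    ∀ ε ∈ Set.Ioc (0 : ℝ) (1 / 2), ∀ L : ℕ, (1 / 2) ^ L ≤ ε → ε ≤ 2 * (1 / 2) ^ L →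
      ∃ e, IsSchedule C R ε (H * (1 / ε ^ 2)) L e := by
  set β : ℝ := 2 * (1 / 2) ^ C with hβ
  have hβ0 : 0 < β := by positivity
  have hβ1 : β < 1 := by
    have : ((1 : ℝ) / 2) ^ C < (1 / 2) ^ (1 : ℝ) :=
      Real.rpow_lt_rpow_of_exponent_gt (by norm_num) (by norm_num) hC
    rw [Real.rpow_one] at this
    linarith
  set ρ : ℝ := (1 + β) / 2 with hρ
  have hρ1 : ρ < 1 := by linarith
  have hρ2 : 1 / 2 ≤ ρ := by linarith
  have hρ0 : 0 < ρ := by linarith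
  have hθ : β / ρ ^ 2 < 1 := by
    rw [div_lt_one (by positivity), hρ]
    nlinarith [sq_pos_of_pos (sub_pos.2 hβ1)]
  have hθ0 : 0 < β / ρ ^ 2 := by positivity
  -- Here `192 = 3 · 32 · 2`: the `3` and the `32` come from `sum_le`, the `2` from `ε ≤ 2 · 2⁻ᴸ`.
  set a : ℝ := (1 - ρ) / 192 with ha
  have ha0 : 0 < a := by rw [ha]; linarith
  obtain ⟨r, hr⟩ := exists_pow_lt_of_lt_one (show 0 < a / 2 by positivity)
    (show (1 : ℝ) / 2 < 1 by norm_num)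
  refine ⟨r + 2, 1 / ((1 - β / ρ ^ 2) * a ^ 2), by
    have : 0 < 1 - β / ρ ^ 2 := by linarith
    positivity, fun ε hε L hL1 hL2 => ⟨fun l => a * ε * ρ ^ l, ?_, ?_, ?_, ?_⟩⟩
  · intro l
    have := hε.1
    positivity
  · have hgeom : ∑ l ∈ Finset.range (L + 1), ρ ^ l ≤ (1 - ρ)⁻¹ := by
      rw [← tsum_geometric_of_lt_one hρ0.le hρ1]
      exact (summable_geometric_of_lt_one hρ0.le hρ1).sum_le_tsum _ fun _ _ => by positivity
    have hεa : 0 ≤ a * ε := mul_nonneg ha0.le hε.1.le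
    rw [← Finset.mul_sum]
    have h1 := mul_le_mul_of_nonneg_left hgeom hεa
    have h2 : a * ε * (1 - ρ)⁻¹ = ε / 192 := by
      have : 1 - ρ ≠ 0 := by linarith
      rw [ha]; field_simp
    linarith
  · intro l hl
    have h1 : ε ^ r ≤ (1 / 2) ^ r := pow_le_pow_left₀ hε.1.le hε.2 r
    have h2 : (1 / 2) ^ L ≤ ρ ^ l := by
      calc ((1 : ℝ) / 2) ^ L ≤ (1 / 2) ^ l :=
            pow_le_pow_of_le_one (by norm_num) (by norm_num) hl
        _ ≤ ρ ^ l := pow_le_pow_left₀ (by norm_num) hρ2 l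
    have h3 : ε ^ 2 ^ (r + 2) ≤ ε ^ (r + 2) :=
      pow_le_pow_of_le_one hε.1.le (by linarith [hε.2]) Nat.lt_two_pow_self.le
    calc ε ^ 2 ^ (r + 2) ≤ ε ^ (r + 2) := h3
      _ = ε ^ r * ε * ε := by ring
      _ ≤ a / 2 * ε * ε := by
          have := hε.1
          gcongr
          exact h1.trans hr.le
      _ = a * ε * (ε / 2) := by ring
      _ ≤ a * ε * ρ ^ l := by
          have := hε.1
          gcongr
          linarith
  · have hterm : ∀ l : ℕ, (2 : ℝ) ^ l * (((1 / 2) ^ l) ^ C / (a * ε * ρ ^ l) ^ 2) =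
        1 / (a * ε) ^ 2 * (β / ρ ^ 2) ^ l := by
      intro l
      have h1 : (((1 : ℝ) / 2) ^ l) ^ C = ((1 / 2) ^ C) ^ l := by
        rw [← Real.rpow_natCast, ← Real.rpow_mul (by norm_num), mul_comm,
          Real.rpow_mul (by norm_num), Real.rpow_natCast]
      have := hε.1.ne'
      have h2 : β ^ l = 2 ^ l * ((1 / 2) ^ C) ^ l := by rw [hβ, mul_pow]
      rw [h1, div_pow β, h2]
      clear_value ρ
      field_simp
      ring
    have hgeom : ∑ l ∈ Finset.range (L + 1), (β / ρ ^ 2) ^ l ≤ (1 - β / ρ ^ 2)⁻¹ := by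
      rw [← tsum_geometric_of_lt_one hθ0.le hθ]
      exact (summable_geometric_of_lt_one hθ0.le hθ).sum_le_tsum _ fun _ _ => by positivity
    simp only [hterm, ← Finset.mul_sum]
    refine (mul_le_mul_of_nonneg_left hgeom (by positivity)).trans (le_of_eq ?_)
    have := hε.1.ne'
    have : 1 - β / ρ ^ 2 ≠ 0 := by linarith
    generalize 1 - β / ρ ^ 2 = z at *
    field_simp

/-- For `C = 1` the factors `2ˡ` and `γₗ` cancel, so equal accuracies are used: `L + 1` levels cost
`192² (L + 1)²/ε²` each, and `L + 1 = O(log (1/ε))`. -/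
lemma exists_schedule_one : ∃ (R : ℕ) (H : ℝ), 0 ≤ H ∧
    ∀ ε ∈ Set.Ioc (0 : ℝ) (1 / 2), ∀ L : ℕ, (1 / 2) ^ L ≤ ε → ε ≤ 2 * (1 / 2) ^ L →
      ∃ e, IsSchedule 1 R ε (H * (1 / ε ^ 2 * Real.log (1 / ε) ^ 3)) L e := by
  refine ⟨4, 192 ^ 2 * 5 ^ 3, by norm_num, fun ε hε L hL1 hL2 =>
    ⟨fun _ => ε / (192 * (L + 1)), fun _ => ?_, ?_, fun l hl => ?_, ?_⟩⟩
  · have := hε.1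
    positivity
  · rw [Finset.sum_const, Finset.card_range, nsmul_eq_mul]
    have : ((L + 1 : ℕ) : ℝ) * (ε / (192 * (L + 1))) = ε / 192 := by
      push_cast; field_simp
    rw [this]
    linarith
  · have hε0 := hε.1
    have h1 : ((L + 1 : ℕ) : ℝ) ≤ ((2 ^ L : ℕ) : ℝ) := by exact_mod_cast Nat.lt_two_pow_self
    push_cast at h1
    have h2 : (2 : ℝ) ^ L * ε ≤ 2 := by
      have : (2 : ℝ) ^ L * (1 / 2) ^ L = 1 := by rw [← mul_pow]; norm_num
      nlinarith [mul_le_mul_of_nonneg_left hL2 (show (0 : ℝ) ≤ 2 ^ L by positivity)]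
    have h3 : ε ^ 14 ≤ (1 / 2) ^ 14 := pow_le_pow_left₀ hε0.le hε.2 14
    rw [le_div_iff₀ (by positivity)]
    calc ε ^ 2 ^ 4 * (192 * (L + 1)) = ε ^ 14 * 192 * ((L + 1) * ε) * ε := by ring
      _ ≤ (1 / 2) ^ 14 * 192 * 2 * ε := by
          gcongr
          exact (mul_le_mul_of_nonneg_right h1 hε0.le).trans h2
      _ ≤ ε := by nlinarith
  · have hε0 := hε.1
    have hlog2 := Real.log_two_gt_d9
    have hL : (L : ℝ) + 1 ≤ 5 * Real.log (1 / ε) := by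
      have h1 : Real.log ε ≤ Real.log (2 * (1 / 2) ^ L) := Real.log_le_log hε0 hL2
      rw [Real.log_mul (by norm_num) (by positivity), Real.log_pow, one_div, Real.log_inv] at h1
      have h2 : Real.log 2 ≤ Real.log (1 / ε) := by
        refine Real.log_le_log (by norm_num) ?_
        rw [le_div_iff₀ hε0]
        linarith [hε.2]
      rw [one_div, Real.log_inv] at h2 ⊢
      nlinarith
    have hterm : ∀ l : ℕ, (2 : ℝ) ^ l * (((1 / 2) ^ l) ^ (1 : ℝ) / (ε / (192 * (L + 1))) ^ 2) =
        192 ^ 2 * (L + 1) ^ 2 / ε ^ 2 := by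
      intro l
      have : (2 : ℝ) ^ l * (1 / 2) ^ l = 1 := by rw [← mul_pow]; norm_num
      rw [Real.rpow_one, ← mul_div_assoc, this]
      field_simp
    simp only [hterm, Finset.sum_const, Finset.card_range, nsmul_eq_mul]
    push_cast
    calc ((L : ℝ) + 1) * (192 ^ 2 * (L + 1) ^ 2 / ε ^ 2) = 192 ^ 2 * (1 / ε ^ 2 * (L + 1) ^ 3) := by
          ring
      _ ≤ 192 ^ 2 * (1 / ε ^ 2 * (5 * Real.log (1 / ε)) ^ 3) := by gcongr
      _ = _ := by ring

/-! ### Assembling the devices and adding up the space -/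

/-- A device for level `l`, assembled from a strong tracker or a difference estimator. -/
lemma exists_device {n m : ℕ} {F : (Fin n → ℕ) → ℝ} {S₁ S₂ : ℝ → ℝ} {C δ Kd Kt B s₁ s₂ : ℝ}
    (hF : ∀ f, 0 ≤ F f) (hB0 : 0 ≤ B) (hs1 : 0 ≤ s₁) (hs2 : 0 ≤ s₂)
    (hS₁ : ∀ ε ∈ Set.Ioc (0 : ℝ) (1 / 2), 0 ≤ S₁ ε) (hS₂ : ∀ ε ∈ Set.Ioc (0 : ℝ) (1 / 2), 0 ≤ S₂ ε)
    (hdiff : ∀ γ ∈ Set.Ioc (0 : ℝ) 1, ∀ ε ∈ Set.Ioc (0 : ℝ) (1 / 2),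
      ∃ D : StreamAlg (Option (Fin n)), IsDifferenceEstimator F m γ ε δ D ∧
        D.bits ≤ Kd * (γ ^ C / ε ^ 2 * S₁ ε + S₂ ε))
    (htrack : ∀ ε ∈ Set.Ioc (0 : ℝ) (1 / 2), ∃ A : StreamAlg (Fin n),
      IsStrongTracker F m ε δ A ∧ A.bits ≤ Kt * (1 / ε ^ 2 * S₁ ε + S₂ ε))
    {e : ℕ → ℝ} {l : ℕ} (he : e l ∈ Set.Ioc (0 : ℝ) (1 / 2))
    (h₁ : S₁ (e l) ≤ B * s₁) (h₂ : S₂ (e l) ≤ B * s₂)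
    (h₃ : S₁ (1 / 4) ≤ B * s₁) (h₄ : S₂ (1 / 4) ≤ B * s₂) (b : Bool) :
    ∃ D : StreamAlg (Option (Fin n)), Satisfies (deviceSpec F e l b) m δ D ∧
      D.bits ≤ (|Kd| + 16 * |Kt|) * B * (((1 / 2) ^ l) ^ C / e l ^ 2 * s₁ + s₁ + s₂) + 1 := by
  have hquarter : (1 / 4 : ℝ) ∈ Set.Ioc (0 : ℝ) (1 / 2) := by constructor <;> norm_num
  have hmul : ∀ (K a x y : ℝ), 0 ≤ a → 0 ≤ x → 0 ≤ y → x ≤ B * s₁ → y ≤ B * s₂ →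
      K * (a * x + y) ≤ |K| * B * (a * s₁ + s₂) := by
    intro K a x y ha hx hy hxB hyB
    calc K * (a * x + y) ≤ |K| * (a * x + y) :=
          mul_le_mul_of_nonneg_right (le_abs_self K) (by positivity)
      _ ≤ |K| * (a * (B * s₁) + B * s₂) := by gcongr
      _ = _ := by ring
  have hKd : 0 ≤ |Kd| * B := by positivity
  have hKt : 0 ≤ |Kt| * B := by positivity
  have hg0 : 0 ≤ ((1 / 2 : ℝ) ^ l) ^ C / e l ^ 2 := by positivity
  have hn₁ := hS₁ _ he
  have hn₂ := hS₂ _ he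
  obtain ⟨g, hg⟩ : ∃ g, ((1 / 2 : ℝ) ^ l) ^ C / e l ^ 2 = g := ⟨_, rfl⟩
  rw [hg] at hg0 ⊢
  have hgs := mul_nonneg hg0 hs1
  have hexp : (|Kd| + 16 * |Kt|) * B * (g * s₁ + s₁ + s₂) =
      |Kd| * B * (g * s₁ + s₂) + |Kd| * B * s₁ + 16 * (|Kt| * B * (g * s₁ + s₂)) +
        |Kt| * B * (16 * s₁) := by ring
  have p1 : 0 ≤ |Kd| * B * (g * s₁ + s₂) := by positivity
  have p2 : 0 ≤ |Kt| * B * (g * s₁ + s₂) := by positivity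
  have p3 : 0 ≤ |Kd| * B * s₁ := by positivity
  have p4 : 0 ≤ |Kt| * B * (16 * s₁) := by positivity
  rw [hexp]
  cases b with
  | true =>
    by_cases h0 : l = 0
    · obtain ⟨D, hD, hDb⟩ := htrack (e l) he
      refine ⟨D.ignoreSplit, ?_, ?_⟩
      · have := hD.satisfies_ignoreSplit hF
        simp only [deviceSpec, h0, if_true]
        rwa [h0] at this
      · have h1 : D.ignoreSplit.bits ≤ |Kt| * B * (1 / e l ^ 2 * s₁ + s₂) :=
          hDb.trans (hmul _ _ _ _ (by positivity) hn₁ hn₂ h₁ h₂)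
        -- Level `0` has `γ = 1`, so the cost of a strong tracker fits the formula for difference
        -- estimators.
        have h2 : 1 / e l ^ 2 = g := by simp [← hg, h0]
        rw [h2] at h1
        linarith
    · obtain ⟨D, hD, hDb⟩ := hdiff ((1 / 2) ^ l)
        ⟨by positivity, pow_le_one₀ (by norm_num) (by norm_num)⟩ (e l) he
      refine ⟨D, ?_, ?_⟩
      · have := hD.satisfies
        simp only [deviceSpec, if_neg h0, if_true]
        exact this
      · rw [hg] at hDb
        have h1 : D.bits ≤ |Kd| * B * (g * s₁ + s₂) :=
          hDb.trans (hmul _ _ _ _ hg0 hn₁ hn₂ h₁ h₂)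
        linarith
  | false =>
    obtain ⟨D, hD, hDb⟩ := htrack (1 / 4) hquarter
    refine ⟨D.startAtSplit, ?_, ?_⟩
    · have := hD.satisfies_startAtSplit hF
      simpa only [deviceSpec, Bool.false_eq_true, if_false] using this
    · have h1 : D.bits ≤ |Kt| * B * (1 / (1 / 4) ^ 2 * s₁ + s₂) :=
        hDb.trans (hmul _ _ _ _ (by positivity) (hS₁ _ hquarter) (hS₂ _ hquarter) h₃ h₄)
      have h2 := D.startAtSplit_bits_le
      have h3 : |Kt| * B * (1 / (1 / 4) ^ 2 * s₁ + s₂) =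
          |Kt| * B * (16 * s₁) + |Kt| * B * s₂ := by ring
      have h4 : 0 ≤ |Kt| * B * (g * s₁) := by positivity
      have h5 : 0 ≤ |Kt| * B * s₂ := by positivity
      linarith

lemma logb_two_add_one_le {n : ℕ} (hn : 2 ≤ n) : Real.logb 2 (n + 1) ≤ 3 * Real.log n := by
  have hlog2 := Real.log_two_gt_d9
  have h0 : Real.log 2 ≤ Real.log n := Real.log_le_log (by norm_num) (by exact_mod_cast hn)
  have h1 : Real.log (n + 1) ≤ 2 * Real.log n := by
    have hn' : (2 : ℝ) ≤ n := by exact_mod_cast hn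
    have h : Real.log ((n : ℝ) + 1) ≤ Real.log ((n : ℝ) ^ 2) :=
      Real.log_le_log (by positivity) (by nlinarith)
    rw [Real.log_pow] at h
    push_cast at h
    linarith
  rw [Real.logb, div_le_iff₀ (by linarith)]
  nlinarith

/-- The total size of the devices, when the devices of level `l` have `T' * 2 ^ l` copies. -/
lemma total_bits_le {Q A s₁ s₂ lg ε cost T' r : ℝ} {L : ℕ} {g : ℕ → ℝ} {b : ℕ → Bool → ℝ}
    (hQ0 : 0 ≤ Q) (hA3 : 0 ≤ A) (hs1 : 0 ≤ s₁) (hs2 : 0 ≤ s₂) (hε0 : 0 < ε) (hε2 : ε ≤ 1 / 2)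
    (hlg : 1 / 2 ≤ lg) (hT'1 : 1 ≤ T') (hT'2 : T' ≤ A * lg) (hg0 : ∀ l, 0 ≤ g l)
    (hb : ∀ l ≤ L, ∀ i, b l i ≤ Q * (g l * s₁ + s₁ + s₂) + 1)
    (hpow2 : ∑ l ∈ Finset.range (L + 1), (2 : ℝ) ^ l ≤ 4 / ε)
    (hcost : ∑ l ∈ Finset.range (L + 1), (2 : ℝ) ^ l * g l ≤ cost) (hlogn : r ≤ 3 * lg) :
    r + ∑ l ∈ Finset.range (L + 1), (T' * 2 ^ l * (b l true + b l false + 2) + 1) ≤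
      (8 * Q * A + 20 * A + 3) * ((lg * cost + 1 / ε * lg) * s₁ + 1 / ε * lg * s₂ +
        1 / ε ^ 2 * lg ^ 2) := by
  have hlg0 : 0 < lg := by linarith
  have hterm : ∀ l ∈ Finset.range (L + 1), T' * 2 ^ l *
      (b l true + b l false + 2) + 1 ≤
      2 * Q * s₁ * T' * (2 ^ l * g l) + (2 * Q * (s₁ + s₂) + 5) * T' * 2 ^ l := by
    intro l hl
    have hl : l ≤ L := by simp at hl; omega
    have h1 := hb l hl true
    have h2 := hb l hl false
    have h3 : (1 : ℝ) ≤ T' * 2 ^ l := by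
      have h1 : (1 : ℝ) ≤ 2 ^ l := one_le_pow₀ (by norm_num)
      nlinarith
    have h4 : T' * 2 ^ l * (b l true + b l false + 2) ≤
        T' * 2 ^ l * (2 * (Q * (g l * s₁ + s₁ + s₂) + 1) + 2) := by
      refine mul_le_mul_of_nonneg_left ?_ (by positivity)
      linarith
    linarith
  have hsum := Finset.sum_le_sum hterm
  have hdistrib : ∀ x y : ℝ, ∑ l ∈ Finset.range (L + 1), (x * (2 ^ l * g l) + y * 2 ^ l) =
      x * ∑ l ∈ Finset.range (L + 1), 2 ^ l * g l + y * ∑ l ∈ Finset.range (L + 1), 2 ^ l :=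
    fun x y => by rw [Finset.sum_add_distrib, ← Finset.mul_sum, ← Finset.mul_sum]
  rw [hdistrib] at hsum
  have hcost' : ∑ l ∈ Finset.range (L + 1), (2 : ℝ) ^ l * g l ≤ cost := hcost
  have hcost0 : 0 ≤ cost := le_trans
    (Finset.sum_nonneg fun l _ => mul_nonneg (by positivity) (hg0 l)) hcost'
  have h1 : 2 * Q * s₁ * T' * ∑ l ∈ Finset.range (L + 1), (2 : ℝ) ^ l * g l ≤
      2 * Q * s₁ * (A * lg) * cost := by
    gcongr
    exact Finset.sum_nonneg fun l _ => mul_nonneg (by positivity) (hg0 l)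
  have h2 : (2 * Q * (s₁ + s₂) + 5) * T' * ∑ l ∈ Finset.range (L + 1), (2 : ℝ) ^ l ≤
      (2 * Q * (s₁ + s₂) + 5) * (A * lg) * (4 / ε) := by gcongr
  -- Since `lg ≥ 1/2` and `ε ≤ 1/2`, `y ≥ 1`; hence all bookkeeping terms are absorbed by `y²`, the
  -- last term of the bound.
  set y := 1 / ε * lg with hy
  have hy0 : 0 < y := by positivity
  have hlgy : lg ≤ y := by
    rw [hy, one_div, inv_mul_eq_div, le_div_iff₀ hε0]
    nlinarith
  have hy1 : 1 ≤ y := by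
    rw [hy, one_div, inv_mul_eq_div, le_div_iff₀ hε0]
    linarith
  have hyy : 1 / ε ^ 2 * lg ^ 2 = y ^ 2 := by rw [hy]; field_simp
  have hy2 : y ≤ y ^ 2 := by nlinarith
  have h2' : (2 * Q * (s₁ + s₂) + 5) * (A * lg) * (4 / ε) =
      8 * Q * A * (y * s₁) + 8 * Q * A * (y * s₂) + 20 * A * y := by
    rw [hy]; field_simp; ring
  have h1' : 2 * Q * s₁ * (A * lg) * cost = 2 * Q * A * (lg * cost * s₁) := by ring
  rw [hyy]
  rw [h2'] at h2
  rw [h1'] at h1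
  have hz1 : 0 ≤ lg * cost * s₁ := by positivity
  have hz2 : 0 ≤ y * s₁ := by positivity
  have hz3 : 0 ≤ y * s₂ := by positivity
  have hz4 : 0 ≤ y ^ 2 := by positivity
  have hQA : 0 ≤ Q * A := by positivity
  have e1 : (8 * Q * A + 20 * A + 3) * ((lg * cost + y) * s₁ + y * s₂ + y ^ 2) =
      (8 * (Q * A) + 20 * A + 3) * (lg * cost * s₁) + (8 * (Q * A) + 20 * A + 3) * (y * s₁) +
      (8 * (Q * A) + 20 * A + 3) * (y * s₂) + (8 * (Q * A) + 20 * A + 3) * y ^ 2 := by ring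
  rw [e1]
  have e2 : 2 * Q * A * (lg * cost * s₁) ≤ (8 * (Q * A) + 20 * A + 3) * (lg * cost * s₁) :=
    mul_le_mul_of_nonneg_right (by linarith) hz1
  have e3 : 8 * Q * A * (y * s₁) ≤ (8 * (Q * A) + 20 * A + 3) * (y * s₁) :=
    mul_le_mul_of_nonneg_right (by linarith) hz2
  have e4 : 8 * Q * A * (y * s₂) ≤ (8 * (Q * A) + 20 * A + 3) * (y * s₂) :=
    mul_le_mul_of_nonneg_right (by linarith) hz3
  have e5 : 20 * A * y + 3 * y ≤ (8 * (Q * A) + 20 * A + 3) * y ^ 2 := by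
    have := mul_nonneg hQA hz4
    nlinarith
  linarith

/-- The robust algorithm for a given schedule of accuracies. -/
theorem exists_robust_of_schedule
    (F : ∀ n : ℕ, (Fin n → ℕ) → ℝ) (m : ℕ → ℕ) (S₁ S₂ : ℕ → ℝ → ℝ → ℝ) (C : ℝ)
    (hF_nonneg : ∀ n f, 0 ≤ F n f)
    (hF_mono : ∀ n, Monotone (F n))
    (htwist : ∃ K : ℝ, ∀ n ≥ 2, ∀ ε ∈ Set.Ioc (0 : ℝ) (1 / 2), ∀ σ : List (Fin n),
      σ.length = m n → (twistNumber (F n) ε σ : ℝ) ≤ K * (Real.log n / ε))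
    (hS₁ : IsSpaceFunction S₁) (hS₂ : IsSpaceFunction S₂)
    (hdiff : ∃ K : ℝ, ∀ n ≥ 2, ∀ γ ∈ Set.Ioc (0 : ℝ) 1, ∀ ε ∈ Set.Ioc (0 : ℝ) (1 / 2),
      ∀ δ ∈ Set.Ioo (0 : ℝ) 1, ∃ B : StreamAlg (Option (Fin n)),
        IsDifferenceEstimator (F n) (m n) γ ε δ B ∧
        B.bits ≤ K * (γ ^ C / ε ^ 2 * S₁ n δ ε + S₂ n δ ε))
    (htrack : ∃ K : ℝ, ∀ n ≥ 2, ∀ ε ∈ Set.Ioc (0 : ℝ) (1 / 2), ∀ δ ∈ Set.Ioo (0 : ℝ) 1,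
      ∃ A : StreamAlg (Fin n), IsStrongTracker (F n) (m n) ε δ A ∧
        A.bits ≤ K * (1 / ε ^ 2 * S₁ n δ ε + S₂ n δ ε)) (R : ℕ) :
    ∃ (K c : ℝ), 0 ≤ K ∧ 0 < c ∧ c ≤ 1 ∧ ∀ n : ℕ, n ≥ 2 → ∀ ε ∈ Set.Ioc (0 : ℝ) (1 / 2),
      c * (ε / Real.log n) ^ 1 ∈ Set.Ioo (0 : ℝ) 1 ∧
      ∀ (L : ℕ) (e : ℕ → ℝ) (cost : ℝ), (1 / 2) ^ L ≤ ε → ε ≤ 2 * (1 / 2) ^ L →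
        IsSchedule C R ε cost L e →
        ∃ A : StreamAlg (Fin n), IsAdversariallyRobust (F n) (m n) ε (2 / 3) A ∧
          A.bits ≤ K * ((Real.log n * cost + 1 / ε * Real.log n) *
              S₁ n (c * (ε / Real.log n) ^ 1) ε +
            1 / ε * Real.log n * S₂ n (c * (ε / Real.log n) ^ 1) ε +
            1 / ε ^ 2 * Real.log n ^ 2) := by
  obtain ⟨Kw, hKw⟩ := htwist
  obtain ⟨Kd, hKd⟩ := hdiff
  obtain ⟨Kt, hKt⟩ := htrack
  obtain ⟨B₁, hB₁0, hB₁⟩ := hS₁.exists_pow_le R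
  obtain ⟨B₂, hB₂0, hB₂⟩ := hS₂.exists_pow_le R
  obtain ⟨B₃, hB₃0, hB₃⟩ := hS₁.exists_pow_le 1
  obtain ⟨B₄, hB₄0, hB₄⟩ := hS₂.exists_pow_le 1
  set B := B₁ + B₂ + B₃ + B₄ with hB
  set Q := (|Kd| + 16 * |Kt|) * B with hQ
  -- Chosen so that `T' ≤ 3 T + 2 ≤ A log n`, using `3 log 2 > 2`. There are then at most `8 A log
  -- n/ε` instances, which fixes `c = 1/(24 A)` for total failure probability `1/3`.
  set A := 48 * |Kw| + 3 with hA
  have hA3 : 3 ≤ A := by have := abs_nonneg Kw; linarith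
  have hB0 : 0 ≤ B := by positivity
  have hQ0 : 0 ≤ Q := by positivity
  refine ⟨8 * Q * A + 20 * A + 3, 1 / (24 * A), by positivity, by positivity,
    by rw [div_le_one (by positivity)]; linarith, fun n hn ε hε => ?_⟩
  have hε0 := hε.1
  have hε2 := hε.2
  set lg := Real.log n with hlg
  have hlg2 : Real.log 2 ≤ lg := Real.log_le_log (by norm_num) (by exact_mod_cast hn)
  have hlog2 := Real.log_two_gt_d9
  have hlg0 : 0 < lg := by linarith
  set δ := 1 / (24 * A) * (ε / lg) ^ 1 with hδ
  have hδ01 : δ ∈ Set.Ioo (0 : ℝ) 1 := by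
    refine ⟨by positivity, ?_⟩
    have h1 : 1 / (24 * A) < 1 := by rw [div_lt_one (by positivity)]; linarith
    have h2 : (ε / lg) ^ 1 ≤ 1 := by rw [pow_one, div_le_one hlg0]; linarith
    have h3 : 0 < (ε / lg) ^ 1 := by positivity
    nlinarith
  refine ⟨hδ01, fun L e cost hL1 hL2 he => ?_⟩
  -- The `16` comes from the twist parameter `2⁻ˡ/16`.
  set T := 16 * |Kw| * lg with hT
  have hT0 : 0 ≤ T := by positivity
  set T' := ⌈3 * T + 1⌉₊ with hT'
  have hT'1 : 3 * T + 1 ≤ T' := Nat.le_ceil _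
  have hT'2 : (T' : ℝ) ≤ A * lg := by
    have := Nat.ceil_lt_add_one (show 0 ≤ 3 * T + 1 by positivity)
    have h2 : A * lg = 3 * T + 3 * lg := by rw [hA, hT]; ring
    linarith
  have hs1 := hS₁.nonneg n hn δ hδ01 ε hε
  have hs2 := hS₂.nonneg n hn δ hδ01 ε hε
  set s₁ := S₁ n δ ε with hs₁
  set s₂ := S₂ n δ ε with hs₂
  have he2 : ∀ l ≤ L, e l ∈ Set.Ioc (0 : ℝ) (1 / 2) := by
    intro l hl
    have h1 : e l ≤ ∑ l ∈ Finset.range (L + 1), e l :=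
      Finset.single_le_sum (fun k _ => (he.pos k).le) (by simp; omega)
    have h2 : ((1 : ℝ) / 2) ^ L ≤ 1 := pow_le_one₀ (by norm_num) (by norm_num)
    have h3 := he.pos l
    exact ⟨h3, by linarith [he.sum_le]⟩
  have hbound₁ : ∀ l ≤ L, S₁ n δ (e l) ≤ B * s₁ := fun l hl =>
    (hB₁ n hn δ hδ01 ε hε (e l) (he2 l hl) (he.pow_le l hl)).trans
      (mul_le_mul_of_nonneg_right (by linarith) hs1)
  have hbound₂ : ∀ l ≤ L, S₂ n δ (e l) ≤ B * s₂ := fun l hl =>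
    (hB₂ n hn δ hδ01 ε hε (e l) (he2 l hl) (he.pow_le l hl)).trans
      (mul_le_mul_of_nonneg_right (by linarith) hs2)
  have hquarter : (1 / 4 : ℝ) ∈ Set.Ioc (0 : ℝ) (1 / 2) := by constructor <;> norm_num
  have hεq : ε ^ 2 ^ 1 ≤ 1 / 4 := by nlinarith
  have hbound₃ : S₁ n δ (1 / 4) ≤ B * s₁ :=
    (hB₃ n hn δ hδ01 ε hε _ hquarter hεq).trans (mul_le_mul_of_nonneg_right (by linarith) hs1)
  have hbound₄ : S₂ n δ (1 / 4) ≤ B * s₂ :=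
    (hB₄ n hn δ hδ01 ε hε _ hquarter hεq).trans (mul_le_mul_of_nonneg_right (by linarith) hs2)
  set g : ℕ → ℝ := fun l => ((1 / 2) ^ l) ^ C / e l ^ 2 with hg
  have hg0 : ∀ l, 0 ≤ g l := fun l => by have := he.pos l; positivity
  have hex : ∀ l b, ∃ D : StreamAlg (Option (Fin n)), l ≤ L →
      Satisfies (deviceSpec (F n) e l b) (m n) δ D ∧ D.bits ≤ Q * (g l * s₁ + s₁ + s₂) + 1 := by
    intro l b
    by_cases hl : l ≤ L
    · obtain ⟨D, hD⟩ := exists_device (hF_nonneg n) hB0 hs1 hs2 (hS₁.nonneg n hn δ hδ01)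
        (hS₂.nonneg n hn δ hδ01) (fun γ hγ ε' hε' => hKd n hn γ hγ ε' hε' δ hδ01)
        (fun ε' hε' => hKt n hn ε' hε' δ hδ01) (he2 l hl) (hbound₁ l hl) (hbound₂ l hl)
        hbound₃ hbound₄ b
      exact ⟨D, fun _ => hD⟩
    · obtain ⟨D, -⟩ := hKt n hn (1 / 4) hquarter δ hδ01
      exact ⟨D.ignoreSplit, fun h => absurd h hl⟩
  choose dev hdev using hex
  have hpow2 : ∑ l ∈ Finset.range (L + 1), (2 : ℝ) ^ l ≤ 4 / ε := by
    have h2 : (2 : ℝ) ^ L * ε ≤ 2 := by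
      have : (2 : ℝ) ^ L * (1 / 2) ^ L = 1 := by rw [← mul_pow]; norm_num
      nlinarith [mul_le_mul_of_nonneg_left hL2 (show (0 : ℝ) ≤ 2 ^ L by positivity)]
    rw [geom_sum_eq (by norm_num), le_div_iff₀ hε0, pow_succ]
    nlinarith
  have hsumM : ((∑ l ∈ Finset.range (L + 1), T' * 2 ^ l : ℕ) : ℝ) =
      T' * ∑ l ∈ Finset.range (L + 1), (2 : ℝ) ^ l := by
    push_cast
    rw [Finset.mul_sum]
  refine ⟨switching (L := L) (M := fun l => T' * 2 ^ l) dev (fun u => F n (freq [u])) instOutput,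
    ?_, ?_⟩
  · refine switching_isAdversariallyRobust (e := e) (T := T) (δ := δ) (hF_nonneg n) (hF_mono n)
      (fun l => (he.pos l).le) he.sum_le (fun l _ => ?_) (fun σ hσ l hl => ?_) hL1 hδ01.1.le
      (fun l hl b => (hdev l b hl).1) ?_
    · have h1 : (1 : ℝ) ≤ 2 ^ l := one_le_pow₀ (by norm_num)
      push_cast
      nlinarith [mul_le_mul_of_nonneg_right hT'1 (show (0 : ℝ) ≤ 2 ^ l by positivity)]
    · have hpos : (0 : ℝ) < (1 / 2) ^ l := by positivity
      have hle1 : ((1 : ℝ) / 2) ^ l ≤ 1 := pow_le_one₀ (by norm_num) (by norm_num)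
      have h1 := hKw n hn ((1 / 2) ^ l / 16) ⟨by positivity, by linarith⟩ σ hσ
      refine h1.trans ((mul_le_mul_of_nonneg_right (le_abs_self Kw) (by positivity)).trans ?_)
      refine le_of_eq ?_
      rw [hT, one_div, inv_pow]
      field_simp
      rfl
    · rw [Nat.cast_mul, hsumM]
      have h1 : (T' : ℝ) * ∑ l ∈ Finset.range (L + 1), (2 : ℝ) ^ l ≤ A * lg * (4 / ε) := by gcongr
      calc (((2 : ℕ) : ℝ) * (T' * ∑ l ∈ Finset.range (L + 1), (2 : ℝ) ^ l)) * δ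
          ≤ (2 * (A * lg * (4 / ε))) * δ := by
            refine mul_le_mul_of_nonneg_right ?_ hδ01.1.le
            push_cast
            linarith
        _ = 1 / 3 := by
            rw [hδ, pow_one]
            field_simp
            norm_num
  · refine (switching_bits_le _ _).trans ?_
    have h := total_bits_le (b := fun l i => (dev l i).bits) (T' := T') hQ0 (by linarith) hs1 hs2
      hε0 hε2 (by linarith) (by linarith) hT'2 hg0 (fun l hl i => (hdev l i hl).2) hpow2 he.cost_le
      (logb_two_add_one_le hn)
    refine le_trans (le_of_eq ?_) h
    push_cast
    rfl

lemma exists_level {ε : ℝ} (hε : ε ∈ Set.Ioc (0 : ℝ) (1 / 2)) :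
    ∃ L : ℕ, (1 / 2 : ℝ) ^ L ≤ ε ∧ ε ≤ 2 * (1 / 2) ^ L := by
  obtain ⟨k, h1, h2⟩ := exists_nat_pow_near_of_lt_one hε.1 (by linarith [hε.2])
    (show (0 : ℝ) < 1 / 2 by norm_num) (by norm_num)
  exact ⟨k + 1, h1.le, h2.trans (le_of_eq (by ring))⟩

theorem mainTheorem1
    (F : ∀ n : ℕ, (Fin n → ℕ) → ℝ) (m : ℕ → ℕ) (S₁ S₂ : ℕ → ℝ → ℝ → ℝ) (C : ℝ) (hC : 1 ≤ C)
    (hF_nonneg : ∀ n f, 0 ≤ F n f)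
    (hF_mono : ∀ n, Monotone (F n))
    (hm : ∃ K : ℝ, ∀ n ≥ 2, Real.log (m n) ≤ K * Real.log n)
    (htwist : ∃ K : ℝ, ∀ n ≥ 2, ∀ ε ∈ Set.Ioc (0 : ℝ) (1 / 2), ∀ σ : List (Fin n),
      σ.length = m n → (twistNumber (F n) ε σ : ℝ) ≤ K * (Real.log n / ε))
    (hS₁ : IsSpaceFunction S₁) (hS₂ : IsSpaceFunction S₂)
    (hdiff : ∃ K : ℝ, ∀ n ≥ 2, ∀ γ ∈ Set.Ioc (0 : ℝ) 1, ∀ ε ∈ Set.Ioc (0 : ℝ) (1 / 2),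
      ∀ δ ∈ Set.Ioo (0 : ℝ) 1, ∃ B : StreamAlg (Option (Fin n)),
        IsDifferenceEstimator (F n) (m n) γ ε δ B ∧
        B.bits ≤ K * (γ ^ C / ε ^ 2 * S₁ n δ ε + S₂ n δ ε))
    (htrack : ∃ K : ℝ, ∀ n ≥ 2, ∀ ε ∈ Set.Ioc (0 : ℝ) (1 / 2), ∀ δ ∈ Set.Ioo (0 : ℝ) 1,
      ∃ A : StreamAlg (Fin n), IsStrongTracker (F n) (m n) ε δ A ∧
        A.bits ≤ K * (1 / ε ^ 2 * S₁ n δ ε + S₂ n δ ε)) :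
    ∃ (K c : ℝ) (q : ℕ), 0 < c ∧ c ≤ 1 ∧ 1 ≤ q ∧
      ∀ n ≥ 2, ∀ ε ∈ Set.Ioc (0 : ℝ) (1 / 2),
        ∃ A : StreamAlg (Fin n), IsAdversariallyRobust (F n) (m n) ε (2 / 3) A ∧
          (1 < C → A.bits ≤ K *
            (1 / ε ^ 2 * Real.log n * S₁ n (c * (ε / Real.log n) ^ q) ε +
              1 / ε * Real.log n * Real.log (1 / ε) * S₂ n (c * (ε / Real.log n) ^ q) ε +
              1 / ε ^ 2 * Real.log n ^ 2)) ∧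
          (C = 1 → A.bits ≤ K *
            (1 / ε ^ 2 * Real.log n * Real.log (1 / ε) ^ 3 * S₁ n (c * (ε / Real.log n) ^ q) ε +
              1 / ε * Real.log n * Real.log (1 / ε) * S₂ n (c * (ε / Real.log n) ^ q) ε +
              1 / ε ^ 2 * Real.log n ^ 2)) := by
  have hlogs : ∀ n : ℕ, n ≥ 2 → 0 < Real.log n := fun n hn =>
    Real.log_pos (by exact_mod_cast hn)
  have hloge : ∀ ε ∈ Set.Ioc (0 : ℝ) (1 / 2), Real.log 2 ≤ Real.log (1 / ε) := by
    intro ε hε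
    refine Real.log_le_log (by norm_num) ?_
    rw [le_div_iff₀ hε.1]
    linarith [hε.2]
  have hlog2 := Real.log_two_gt_d9
  -- Absorbs the `1/ε` part of the `S₁` term, caused by the suffix trackers of accuracy `1/4`.
  have hinv : ∀ ε ∈ Set.Ioc (0 : ℝ) (1 / 2), 1 / ε ≤ 1 / 2 * (1 / ε ^ 2) := by
    intro ε hε
    have := hε.1
    rw [← mul_div_assoc, div_le_div_iff₀ hε.1 (by positivity)]
    nlinarith [hε.2]
  -- The construction needs no factor `log (1/ε)` at `S₂`; since `log 2 > 1/2`, inserting it costs a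
  -- factor `2`.
  have hterm₂ : ∀ (a l s : ℝ), 0 ≤ a → 0 ≤ s → Real.log 2 ≤ l → a * s ≤ 2 * (a * l * s) := by
    intro a l s ha hs hl
    have := mul_nonneg ha hs
    nlinarith
  rcases hC.lt_or_eq with hC1 | hC1
  · obtain ⟨R, H, hH, hsched⟩ := exists_schedule_of_one_lt hC1
    obtain ⟨K, c, hK, hc0, hc1, h⟩ := exists_robust_of_schedule F m S₁ S₂ C hF_nonneg hF_mono htwist
      hS₁ hS₂ hdiff htrack R
    refine ⟨K * (H + 2), c, 1, hc0, hc1, le_rfl, fun n hn ε hε => ?_⟩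
    obtain ⟨hδ, h⟩ := h n hn ε hε
    obtain ⟨L, hL1, hL2⟩ := exists_level hε
    obtain ⟨e, he⟩ := hsched ε hε L hL1 hL2
    obtain ⟨A, hA, hbits⟩ := h L e _ hL1 hL2 he
    refine ⟨A, hA, fun _ => hbits.trans ?_, fun h => absurd h hC1.ne'⟩
    have hs₁ := hS₁.nonneg n hn _ hδ ε hε
    have hs₂ := hS₂.nonneg n hn _ hδ ε hε
    have hlg := hlogs n hn
    have hε0 := hε.1
    generalize S₁ n _ ε = s₁ at *
    generalize S₂ n _ ε = s₂ at *
    rw [mul_assoc K]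
    refine mul_le_mul_of_nonneg_left ?_ hK
    have h1 : (Real.log n * (H * (1 / ε ^ 2)) + 1 / ε * Real.log n) * s₁ ≤
        (H + 2) * (1 / ε ^ 2 * Real.log n * s₁) := by
      have h0 : 0 ≤ 1 / ε ^ 2 * Real.log n * s₁ := by positivity
      have h2 := mul_le_mul_of_nonneg_right (hinv ε hε) (mul_nonneg hlg.le hs₁)
      nlinarith
    have h2 := hterm₂ (1 / ε * Real.log n) (Real.log (1 / ε)) s₂ (by positivity) hs₂ (hloge ε hε)
    have h3 : 0 ≤ 1 / ε * Real.log n * Real.log (1 / ε) * s₂ := by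
      have := hloge ε hε
      have : 0 ≤ Real.log (1 / ε) := by linarith
      positivity
    have h4 : 0 ≤ 1 / ε ^ 2 * Real.log n ^ 2 := by positivity
    nlinarith
  · subst hC1
    obtain ⟨R, H, hH, hsched⟩ := exists_schedule_one
    obtain ⟨K, c, hK, hc0, hc1, h⟩ := exists_robust_of_schedule F m S₁ S₂ 1 hF_nonneg hF_mono htwist
      hS₁ hS₂ hdiff htrack R
    refine ⟨K * (H + 2), c, 1, hc0, hc1, le_rfl, fun n hn ε hε => ?_⟩
    obtain ⟨hδ, h⟩ := h n hn ε hε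
    obtain ⟨L, hL1, hL2⟩ := exists_level hε
    obtain ⟨e, he⟩ := hsched ε hε L hL1 hL2
    obtain ⟨A, hA, hbits⟩ := h L e _ hL1 hL2 he
    refine ⟨A, hA, fun h => absurd h (lt_irrefl _), fun _ => hbits.trans ?_⟩
    have hs₁ := hS₁.nonneg n hn _ hδ ε hε
    have hs₂ := hS₂.nonneg n hn _ hδ ε hε
    have hlg := hlogs n hn
    have hε0 := hε.1
    have hl := hloge ε hε
    have hl3 : 1 ≤ 4 * Real.log (1 / ε) ^ 3 := by
      have : (0.69 : ℝ) ^ 3 ≤ Real.log (1 / ε) ^ 3 :=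
        pow_le_pow_left₀ (by norm_num) (by linarith) 3
      norm_num at this ⊢
      linarith
    generalize S₁ n _ ε = s₁ at *
    generalize S₂ n _ ε = s₂ at *
    rw [mul_assoc K]
    refine mul_le_mul_of_nonneg_left ?_ hK
    have h1 : (Real.log n * (H * (1 / ε ^ 2 * Real.log (1 / ε) ^ 3)) + 1 / ε * Real.log n) * s₁ ≤
        (H + 2) * (1 / ε ^ 2 * Real.log n * Real.log (1 / ε) ^ 3 * s₁) := by
      have h0 : 0 ≤ 1 / ε ^ 2 * Real.log n * s₁ := by positivity
      have h2 := mul_le_mul_of_nonneg_right (hinv ε hε) (mul_nonneg hlg.le hs₁)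
      have h3 := mul_le_mul_of_nonneg_left hl3 h0
      linarith
    have h2 := hterm₂ (1 / ε * Real.log n) (Real.log (1 / ε)) s₂ (by positivity) hs₂ hl
    have h3 : 0 ≤ 1 / ε * Real.log n * Real.log (1 / ε) * s₂ := by
      have : 0 ≤ Real.log (1 / ε) := by linarith
      positivity
    have h4 : 0 ≤ 1 / ε ^ 2 * Real.log n ^ 2 := by positivity
    nlinarith [mul_nonneg hH h3, mul_nonneg hH h4]
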